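/- Let $N\ge 1$, $k\ge 0$, $1<p<1+\frac4N$, $\lambda>0$, and let $Q:\mathbb R^N\to(0,\infty)$ be a ground state of $-\Delta Q+Q-\lambda Q^p=0$, i.e. a positive, radially symmetric, strictly radially decreasing $C^2$ solution belonging to $H^1(\mathbb R^N)$. For $\mu,\varepsilon>0$ put $\eta_{\mu,\varepsilon}(x)=\mu^{1/(p-1)}Q(\sqrt\mu\,x/\varepsilon)$, the corresponding ground state of $-\varepsilon^2\Delta\eta+\mu\eta-\lambda\eta^p=0$, and $m(\mu)=\frac12\int_{\mathbb R^N}\varepsilon^{-N}|\eta_{\mu,\varepsilon}|^2dx$. For $\sigma=(a,v,\gamma,\mu)\in\mathbb R^N\times\mathbb R^N\times\mathbb R/2\pi\mathbb Z\times(0,\infty)$ let $$\Psi_{\sigma,\varepsilon}(x)=e^{\mathbf i\left(\frac12 v\cdot\frac{x-a}{\varepsilon}+\gamma\right)}\eta_{\mu,\varepsilon}(x-a),$$ and let $\mathbf T_{\Psi_{\sigma,\varepsilon}}\mathbf M$ be the real span of $\varepsilon\partial_{a_i}\Psi_{\sigma,\varepsilon}$, $2\partial_{v_i}\Psi_{\sigma,\varepsilon}$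 $(1\le i\le N)$, $\partial_\gamma\Psi_{\sigma,\varepsilon}$ and $\partial_\mu\Psi_{\sigma,\varepsilon}$. On $H^1(\mathbb R^N,\mathbb C)$ use the norm $\|u\|_{H^1}^2=\int\varepsilon^{-N}(\varepsilon^2|\nabla u|^2+|u|^2)dx$ and the symplectic form $\omega_\varepsilon(u_1,u_2)=\operatorname{Im}\int\varepsilon^{-N}u_1\bar u_2\,dx$. Let $K,L>0$ and $0<\mu_{inf}<\mu_{sup}$. There are constants $c,C,\varepsilon_0>0$, depending only on $N,k,p,\lambda,Q,K,L,\mu_{inf},\mu_{sup}$, such that the following holds for every nonempty interval $I\subset(\mu_{inf},\mu_{sup})$, all $a_{1,0},\dots,a_{k,0}\in\mathbb R^N$ with $|a_{i,0}-a_{j,0}|>6L$ for $i\ne j$, every $0<\varepsilon<\varepsilon_0$ and every $0<\delta\le c\inf_{\mu\in I}m'(\mu)$. Let $$\boldsymbol\Sigma=\prod_{j=1}^k B_L(a_{j,0})\times B_{K\varepsilon}(0)\times\mathbb R/2\pi\mathbb Z\times I,\qquad U_\delta=\Big\{\psi\in H^1(\mathbb R^N,\mathbb C):\inf_{\boldsymbol\sigma\in\boldsymbol\Sigma}\Big\|\psi-\sum_{l=1}^k\Psi_{\sigma_l,\varepsilon}\Big\|_{H^1}\le\delta\Big\},$$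 and let $\boldsymbol\Sigma^{C\delta}=\prod_{j=1}^k B_{L+C\delta}(a_{j,0})\times B_{K\varepsilon+C\delta}(0)\times\mathbb R/2\pi\mathbb Z\times\{\mu>0:\operatorname{dist}(\mu,I)<C\delta\}$ (open balls). Then there is a unique $C^1$ map $\boldsymbol\sigma=(\sigma_1,\dots,\sigma_k):U_\delta\to\boldsymbol\Sigma^{C\delta}$ such that for every $\psi\in U_\delta$ $$\omega_\varepsilon\Big(\psi-\sum_{j=1}^k\Psi_{\sigma_j(\psi),\varepsilon},\,z\Big)=0\qquad\text{for all } z\in\mathbf T_{\Psi_{\sigma_l(\psi),\varepsilon}}\mathbf M,\quad l=1,\dots,k.$$ -/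

import Mathlib

open MeasureTheory

noncomputable section

namespace NLSSoliton

/-- The Euclidean space `ℝ^N`. -/
abbrev E (N : ℕ) : Type := EuclideanSpace ℝ (Fin N)

/-- The `i`-th standard basis vector of `ℝ^N`. -/
def basisVec {N : ℕ} (i : Fin N) : E N := EuclideanSpace.single i 1

/-- `L²(ℝ^N, ℂ)`. -/
abbrev L2 (N : ℕ) : Type := Lp ℂ 2 (volume : Measure (E N))

theorem integrable_test_smul {N : ℕ} (u : L2 N) {φ : E N → ℝ} (hφ : Continuous φ)
    (hc : HasCompactSupport φ) : Integrable (fun x => φ x • u x) :=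
  ((Lp.memLp u).locallyIntegrable (by norm_num)).integrable_smul_left_of_hasCompactSupport hφ hc

theorem continuous_partial {N : ℕ} {φ : E N → ℝ} (hφ : ContDiff ℝ (⊤ : ℕ∞) φ) (v : E N) :
    Continuous (fun x => fderiv ℝ φ x v) :=
  (hφ.continuous_fderiv (by simp)).clm_apply continuous_const

theorem hasCompactSupport_partial {N : ℕ} {φ : E N → ℝ} (hc : HasCompactSupport φ) (v : E N) :
    HasCompactSupport (fun x => fderiv ℝ φ x v) :=
  hc.fderiv_apply ℝ v

/-- `g` is the weak `i`-th partial derivative of `u`. -/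
def IsWeakPartial {N : ℕ} (i : Fin N) (u g : L2 N) : Prop :=
  ∀ φ : E N → ℝ, ContDiff ℝ (⊤ : ℕ∞) φ → HasCompactSupport φ →
    ∫ x, fderiv ℝ φ x (basisVec i) • u x = - ∫ x, φ x • g x

/-- The real vector space `H¹(ℝ^N, ℂ)`: an element is an `L²` function together with its weak
partial derivatives in `L²` (which are determined by the function).  The norm inherited from the
product is equivalent to each of the norms `h1Norm ε` below. -/
def H1 (N : ℕ) : Submodule ℝ (L2 N × (Fin N → L2 N)) where
  carrier := {w | ∀ i, IsWeakPartial i w.1 (w.2 i)}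
  zero_mem' := by
    intro i φ _ _
    have h0 : ∀ᵐ x, (0 : L2 N) x = 0 := Lp.coeFn_zero ℂ 2 volume
    have h1 : ∫ x, fderiv ℝ φ x (basisVec i) • (0 : L2 N) x = 0 := by
      refine integral_eq_zero_of_ae ?_
      filter_upwards [h0] with x hx
      rw [hx, smul_zero, Pi.zero_apply]
    have h2 : ∫ x, φ x • (0 : L2 N) x = 0 := by
      refine integral_eq_zero_of_ae ?_
      filter_upwards [h0] with x hx
      rw [hx, smul_zero, Pi.zero_apply]
    simp only [Prod.fst_zero, Prod.snd_zero, Pi.zero_apply]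
    rw [h1, h2, neg_zero]
  add_mem' := by
    intro w w' hw hw' i φ hφ hc
    have key : ∀ (a b : L2 N) (χ : E N → ℝ), Continuous χ → HasCompactSupport χ →
        ∫ x, χ x • (a + b : L2 N) x = (∫ x, χ x • a x) + ∫ x, χ x • b x := by
      intro a b χ h1 h2
      rw [← integral_add (integrable_test_smul a h1 h2) (integrable_test_smul b h1 h2)]
      refine integral_congr_ae ?_
      filter_upwards [Lp.coeFn_add a b] with x hx
      rw [hx, Pi.add_apply, smul_add]
    simp only [Prod.fst_add, Prod.snd_add, Pi.add_apply]
    rw [key _ _ _ (continuous_partial hφ _) (hasCompactSupport_partial hc _),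
      key _ _ _ hφ.continuous hc, hw i φ hφ hc, hw' i φ hφ hc]
    ring
  smul_mem' := by
    intro c w hw i φ hφ hc
    have key : ∀ (a : L2 N) (χ : E N → ℝ),
        ∫ x, χ x • (c • a : L2 N) x = c • ∫ x, χ x • a x := by
      intro a χ
      rw [← integral_smul]
      refine integral_congr_ae ?_
      filter_upwards [Lp.coeFn_smul c a] with x hx
      simp only [hx, Pi.smul_apply]
      rw [smul_comm]
    simp only [Prod.smul_fst, Prod.smul_snd, Pi.smul_apply]
    rw [key, key, hw i φ hφ hc, smul_neg]

/-- A representative function of an element of `H¹`. -/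
def toFn {N : ℕ} (u : H1 N) : E N → ℂ := u.1.1

/-- The `ε`-dependent norm `(∫ ε^{-N} (ε² |∇u|² + |u|²) dx)^{1/2}` on `H¹`. -/
def h1Norm {N : ℕ} (ε : ℝ) (u : H1 N) : ℝ :=
  Real.sqrt (∫ x, (1 / ε ^ N) * (ε ^ 2 * (∑ i, ‖u.1.2 i x‖ ^ 2) + ‖u.1.1 x‖ ^ 2))

/-- The symplectic form `Im ∫ ε^{-N} u₁ conj(u₂) dx`. -/
def sympl {N : ℕ} (ε : ℝ) (u₁ u₂ : E N → ℂ) : ℝ :=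
  (∫ x, ((1 / ε ^ N : ℝ) : ℂ) * (u₁ x * (starRingEnd ℂ) (u₂ x))).im

theorem memLp_partial {N : ℕ} {f : E N → ℂ} (hf : ContDiff ℝ 1 f)
    (h : MemLp (fun x => fderiv ℝ f x) 2 volume) (v : E N) :
    MemLp (fun x => fderiv ℝ f x v) 2 volume := by
  refine (h.norm.const_mul ‖v‖).mono'
    ((hf.continuous_fderiv (by simp)).clm_apply continuous_const).aestronglyMeasurable ?_
  filter_upwards with x
  rw [mul_comm]
  exact (fderiv ℝ f x).le_opNorm v

theorem isWeakPartial_toLp {N : ℕ} {f : E N → ℂ} (hf : ContDiff ℝ 1 f)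
    (h0 : MemLp f 2 volume) (h1 : MemLp (fun x => fderiv ℝ f x) 2 volume) (i : Fin N) :
    IsWeakPartial i (h0.toLp f) ((memLp_partial hf h1 (basisVec i)).toLp _) := by
  intro φ hφ hc
  have e0 := h0.coeFn_toLp
  have e1 := (memLp_partial hf h1 (basisVec i)).coeFn_toLp
  have l0 := (h0.locallyIntegrable (by norm_num))
  have l1 := ((memLp_partial hf h1 (basisVec i)).locallyIntegrable (by norm_num))
  have a : ∫ x, fderiv ℝ φ x (basisVec i) • (h0.toLp f) x
      = ∫ x, fderiv ℝ φ x (basisVec i) • f x := by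
    refine integral_congr_ae ?_
    filter_upwards [e0] with x hx
    rw [hx]
  have b : ∫ x, φ x • ((memLp_partial hf h1 (basisVec i)).toLp _) x
      = ∫ x, φ x • fderiv ℝ f x (basisVec i) := by
    refine integral_congr_ae ?_
    filter_upwards [e1] with x hx
    rw [hx]
  rw [a, b, integral_smul_fderiv_eq_neg_fderiv_smul_of_integrable, neg_neg]
  · exact l0.integrable_smul_left_of_hasCompactSupport (continuous_partial hφ _)
      (hasCompactSupport_partial hc _)
  · exact l1.integrable_smul_left_of_hasCompactSupport hφ.continuous hc
  · exact l0.integrable_smul_left_of_hasCompactSupport hφ.continuous hc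
  · exact fun x _ => (hφ.differentiable (by simp)).differentiableAt
  · exact fun x _ => (hf.differentiable (by simp)).differentiableAt

/-- A `C¹` function that is in `L²` together with its gradient, as an element of `H¹`. -/
def H1.ofC1 {N : ℕ} (f : E N → ℂ) (hf : ContDiff ℝ 1 f)
    (h0 : MemLp f 2 volume) (h1 : MemLp (fun x => fderiv ℝ f x) 2 volume) : H1 N :=
  ⟨(h0.toLp f, fun i => (memLp_partial hf h1 (basisVec i)).toLp _),
    fun i => isWeakPartial_toLp hf h0 h1 i⟩

/-- `η` is a ground state of `-ε² Δη + μ η - lam η^p = 0` on `ℝ^N`: a positive, radially symmetric,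
radially decreasing `C²` solution in `H¹`. -/
structure IsGroundState {N : ℕ} (p lam μ ε : ℝ) (η : E N → ℝ) : Prop where
  contDiff : ContDiff ℝ 2 η
  pos : ∀ x, 0 < η x
  radial : ∀ x y, ‖x‖ = ‖y‖ → η x = η y
  decreasing : ∀ x y, ‖x‖ < ‖y‖ → η y < η x
  equation : ∀ x, -ε ^ 2 * Laplacian.laplacian η x + μ * η x - lam * η x ^ p = 0
  memLp : MemLp η 2 volume
  memLp_fderiv : MemLp (fun x => fderiv ℝ η x) 2 volume

/-- The rescaled profile `η_{μ,ε}(x) = μ^{1/(p-1)} Q(√μ x / ε)`, where `Q = η_{1,1}`. -/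
def profile {N : ℕ} (p : ℝ) (Q : E N → ℝ) (μ ε : ℝ) (x : E N) : ℝ :=
  μ ^ (1 / (p - 1)) * Q ((Real.sqrt μ / ε) • x)

theorem memLp_comp_smul {N : ℕ} {F : Type*} [NormedAddCommGroup F] {f : E N → F}
    (hf : MemLp f 2 volume) {s : ℝ} (hs : s ≠ 0) : MemLp (fun x => f (s • x)) 2 volume := by
  refine MemLp.comp_of_map (g := f) (f := fun x : E N => s • x) ?_ (by fun_prop)
  rw [Measure.map_addHaar_smul _ hs]
  exact hf.smul_measure (by simp)

theorem fderiv_profile {N : ℕ} {p : ℝ} {Q : E N → ℝ} (hQ : ContDiff ℝ 2 Q) (μ ε : ℝ) (x : E N) :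
    fderiv ℝ (profile p Q μ ε) x
      = (μ ^ (1 / (p - 1)) * (Real.sqrt μ / ε)) • fderiv ℝ Q ((Real.sqrt μ / ε) • x) := by
  have h : HasFDerivAt Q (fderiv ℝ Q ((Real.sqrt μ / ε) • x)) ((Real.sqrt μ / ε) • x) :=
    ((hQ.differentiable (by simp)).differentiableAt).hasFDerivAt
  have h2 : HasFDerivAt (fun y : E N => (Real.sqrt μ / ε) • y)
      ((Real.sqrt μ / ε) • ContinuousLinearMap.id ℝ (E N)) x :=
    ((Real.sqrt μ / ε) • ContinuousLinearMap.id ℝ (E N)).hasFDerivAt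
  have h3 := (h.comp x h2).const_mul (μ ^ (1 / (p - 1)))
  refine h3.fderiv.trans ?_
  ext y
  simp
  ring

/-- The profile `η_{μ,ε}` is a ground state with parameters `μ`, `ε`. -/
theorem IsGroundState.profile {N : ℕ} {p lam : ℝ} {Q : E N → ℝ} (hp : 1 < p)
    (hQ : IsGroundState p lam 1 1 Q) {μ ε : ℝ} (hμ : 0 < μ) (hε : 0 < ε) :
    IsGroundState p lam μ ε (profile p Q μ ε) := by
  have hs : 0 < Real.sqrt μ / ε := div_pos (Real.sqrt_pos.2 hμ) hε
  have hc : 0 < μ ^ (1 / (p - 1)) := Real.rpow_pos_of_pos hμ _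
  have hpow : (μ ^ (1 / (p - 1))) ^ p = μ ^ (1 / (p - 1)) * μ := by
    rw [← Real.rpow_mul hμ.le, ← Real.rpow_add_one hμ.ne']
    congr 1
    field_simp [sub_ne_zero.2 hp.ne']
    ring
  refine ⟨?_, ?_, ?_, ?_, ?_, ?_, ?_⟩
  · exact contDiff_const.mul (hQ.contDiff.comp (contDiff_const_smul _))
  · exact fun x => mul_pos hc (hQ.pos _)
  · intro x y hxy
    unfold NLSSoliton.profile
    rw [hQ.radial _ ((Real.sqrt μ / ε) • y)]
    rw [norm_smul, norm_smul, hxy]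
  · intro x y hxy
    refine mul_lt_mul_of_pos_left (hQ.decreasing _ _ ?_) hc
    rw [norm_smul, norm_smul]
    exact mul_lt_mul_of_pos_left hxy (norm_pos_iff.2 hs.ne')
  · intro x
    have hL : Laplacian.laplacian (NLSSoliton.profile p Q μ ε) x
        = μ ^ (1 / (p - 1)) * (Real.sqrt μ / ε) ^ 2
          * Laplacian.laplacian Q ((Real.sqrt μ / ε) • x) := by
      rw [InnerProductSpace.laplacian_eq_iteratedFDeriv_stdOrthonormalBasis,
        InnerProductSpace.laplacian_eq_iteratedFDeriv_stdOrthonormalBasis]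
      simp only
      rw [Finset.mul_sum]
      refine Finset.sum_congr rfl fun i _ => ?_
      rw [iteratedFDeriv_two_apply, iteratedFDeriv_two_apply]
      have h1 : fderiv ℝ (NLSSoliton.profile p Q μ ε) = fun x =>
          (μ ^ (1 / (p - 1)) * (Real.sqrt μ / ε)) • fderiv ℝ Q ((Real.sqrt μ / ε) • x) :=
        funext fun x => fderiv_profile hQ.contDiff μ ε x
      have hd : Differentiable ℝ (fderiv ℝ Q) :=
        (hQ.contDiff.fderiv_right (m := 1) (by norm_num)).differentiable (by simp)
      have h2 : HasFDerivAt (fun y : E N => (Real.sqrt μ / ε) • y)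
          ((Real.sqrt μ / ε) • ContinuousLinearMap.id ℝ (E N)) x :=
        ((Real.sqrt μ / ε) • ContinuousLinearMap.id ℝ (E N)).hasFDerivAt
      have h3 := ((hd ((Real.sqrt μ / ε) • x)).hasFDerivAt.comp x h2).const_smul
        (μ ^ (1 / (p - 1)) * (Real.sqrt μ / ε))
      rw [h1]
      have h4 := h3.fderiv
      simp only [Function.comp_def] at h4
      change (fderiv ℝ ((μ ^ (1 / (p - 1)) * (Real.sqrt μ / ε)) •
        fun x => fderiv ℝ Q ((Real.sqrt μ / ε) • x)) x _) _ = _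
      rw [h4]
      simp
      ring
    have hq := hQ.equation ((Real.sqrt μ / ε) • x)
    have e2 : (Real.sqrt μ / ε) ^ 2 = μ / ε ^ 2 := by rw [div_pow, Real.sq_sqrt hμ.le]
    rw [hL, e2]
    unfold NLSSoliton.profile
    rw [Real.mul_rpow hc.le (hQ.pos _).le, hpow]
    have : -ε ^ 2 * (μ ^ (1 / (p - 1)) * (μ / ε ^ 2)
        * Laplacian.laplacian Q ((Real.sqrt μ / ε) • x))
        = μ ^ (1 / (p - 1)) * μ * (-Laplacian.laplacian Q ((Real.sqrt μ / ε) • x)) := by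
      field_simp
    rw [this]
    linear_combination (μ ^ (1 / (p - 1)) * μ) * hq
  · exact (memLp_comp_smul hQ.memLp hs.ne').const_mul _
  · have := (memLp_comp_smul hQ.memLp_fderiv hs.ne').const_smul
      (μ ^ (1 / (p - 1)) * (Real.sqrt μ / ε))
    refine this.congr_norm ?_ ?_
    · have : ContDiff ℝ 2 (NLSSoliton.profile p Q μ ε) :=
        contDiff_const.mul (hQ.contDiff.comp (contDiff_const_smul _))
      exact (this.continuous_fderiv (by simp)).aestronglyMeasurable
    · filter_upwards with x
      rw [fderiv_profile hQ.contDiff]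
      rfl

/-- The mass `m(μ) = ½ ∫ ε^{-N} |η_{μ,ε}|² dx`. -/
def mass {N : ℕ} (p : ℝ) (Q : E N → ℝ) (ε μ : ℝ) : ℝ :=
  1 / 2 * ∫ x, (1 / ε ^ N) * |profile p Q μ ε x| ^ 2

/-- The soliton `Ψ_{σ,ε}(x) = exp(i (v·(x-a)/(2ε) + γ)) η_{μ,ε}(x-a)`, `σ = (a,v,γ,μ)`. -/
def soliton {N : ℕ} (p : ℝ) (Q : E N → ℝ) (ε : ℝ) (a v : E N) (γ : Real.Angle) (μ : ℝ)
    (x : E N) : ℂ :=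
  Complex.exp (Complex.I * ((inner ℝ v (x - a) / (2 * ε) : ℝ) : ℂ)) * (γ.toCircle : ℂ)
    * (profile p Q μ ε (x - a) : ℂ)

/-- The tangent space at `Ψ_{σ,ε}` of the manifold of solitons: the real span of the partial
derivatives `ε ∂_{a_i} Ψ`, `2 ∂_{v_i} Ψ`, `∂_γ Ψ`, `∂_μ Ψ`. -/
def tangentSpace {N : ℕ} (p : ℝ) (Q : E N → ℝ) (ε : ℝ) (a v : E N) (γ : Real.Angle) (μ : ℝ) :
    Submodule ℝ (E N → ℂ) :=
  Submodule.span ℝ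
    (Set.range (fun (i : Fin N) (x : E N) =>
        (ε : ℂ) * deriv (fun t : ℝ => soliton p Q ε (a + t • basisVec i) v γ μ x) 0)
      ∪ Set.range (fun (i : Fin N) (x : E N) =>
        2 * deriv (fun t : ℝ => soliton p Q ε a (v + t • basisVec i) γ μ x) 0)
      ∪ {fun x : E N => deriv (fun t : ℝ => soliton p Q ε a v (γ + (t : Real.Angle)) μ x) 0}
      ∪ {fun x : E N => deriv (fun t : ℝ => soliton p Q ε a v γ t x) μ})

/-- Parameters `σ = (a, v, γ, μ)` of one soliton, with `γ ∈ ℝ/2πℤ` and `μ > 0`. -/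
structure Param (N : ℕ) where
  a : E N
  v : E N
  γ : Real.Angle
  μ : ℝ
  μ_pos : 0 < μ

/-- The smooth embedding `(a, v, γ, μ) ↦ (a, v, e^{iγ}, μ)` of the parameter manifold
`ℝ^N × ℝ^N × ℝ/2πℤ × (0,∞)` in a vector space. -/
def Param.coords {N : ℕ} (σ : Param N) : E N × E N × ℂ × ℝ :=
  (σ.a, σ.v, (σ.γ.toCircle : ℂ), σ.μ)

/-- The set of all `(σ_1, …, σ_k)` with `a_j ∈ B_R(a_{j,0})`, `v_j ∈ B_V(0)`, `μ_j ∈ J`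
(the phases being arbitrary). -/
def paramSet {N k : ℕ} (a₀ : Fin k → E N) (R V : ℝ) (J : Set ℝ) : Set (Fin k → Param N) :=
  {σ | ∀ j, (σ j).a ∈ Metric.ball (a₀ j) R ∧ (σ j).v ∈ Metric.ball 0 V ∧ (σ j).μ ∈ J}

theorem soliton_mem {N : ℕ} {p lam ε : ℝ} {Q : E N → ℝ} (hp : 1 < p)
    (hQ : IsGroundState p lam 1 1 Q) (hε : 0 < ε) (σ : Param N) :
    ContDiff ℝ 1 (soliton p Q ε σ.a σ.v σ.γ σ.μ) ∧
    MemLp (soliton p Q ε σ.a σ.v σ.γ σ.μ) 2 volume ∧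
    MemLp (fun x => fderiv ℝ (soliton p Q ε σ.a σ.v σ.γ σ.μ) x) 2 volume := by
  have hη := hQ.profile hp σ.μ_pos hε
  set η := profile p Q σ.μ ε
  have hmp : MeasurePreserving (fun x : E N => x - σ.a) volume volume :=
    measurePreserving_sub_right volume σ.a
  have m0 : MemLp (fun x => η (x - σ.a)) 2 volume := hη.memLp.comp_measurePreserving hmp
  have m1 : MemLp (fun x => fderiv ℝ η (x - σ.a)) 2 volume :=
    hη.memLp_fderiv.comp_measurePreserving hmp
  have hC : ContDiff ℝ 1 (soliton p Q ε σ.a σ.v σ.γ σ.μ) := by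
    have h1 : ContDiff ℝ 1 (fun x : E N => η (x - σ.a)) :=
      (hη.contDiff.of_le (by norm_num)).comp (contDiff_id.sub contDiff_const)
    have h2 : ContDiff ℝ 1 (fun x : E N => inner ℝ σ.v (x - σ.a) / (2 * ε)) :=
      (contDiff_const.inner ℝ (contDiff_id.sub contDiff_const)).div_const _
    exact (((contDiff_const.mul (Complex.ofRealCLM.contDiff.comp h2)).cexp).mul
      contDiff_const).mul (Complex.ofRealCLM.contDiff.comp h1)
  have hnorm : ∀ x : E N, ‖Complex.exp (Complex.I *
      ((inner ℝ σ.v (x - σ.a) / (2 * ε) : ℝ) : ℂ))‖ = 1 := by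
    intro x
    rw [mul_comm]
    exact Complex.norm_exp_ofReal_mul_I _
  refine ⟨hC, ?_, ?_⟩
  · refine m0.congr_norm hC.continuous.aestronglyMeasurable ?_
    filter_upwards with x
    have h := hnorm x
    rw [soliton, norm_mul, norm_mul, h, Circle.norm_coe, one_mul, one_mul, Complex.norm_real]
  · refine (((m0.norm.const_mul (‖σ.v‖ / (2 * ε)))).add m1.norm).mono'
      (hC.continuous_fderiv (by simp)).aestronglyMeasurable ?_
    filter_upwards with x
    have d1 : HasFDerivAt (fun x : E N => η (x - σ.a)) (fderiv ℝ η (x - σ.a)) x := by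
      have h := ((hη.contDiff.differentiable (by simp)) (x - σ.a)).hasFDerivAt.comp x
        ((hasFDerivAt_id x).sub_const σ.a)
      exact h
    have d2 : HasFDerivAt (fun x : E N => inner ℝ σ.v (x - σ.a) / (2 * ε))
        ((2 * ε)⁻¹ • innerSL ℝ σ.v) x := by
      have h := (((innerSL ℝ σ.v).hasFDerivAt (x := x - σ.a)).comp x
        ((hasFDerivAt_id x).sub_const σ.a)).const_smul ((2 * ε)⁻¹)
      refine (h.congr_of_eventuallyEq (Filter.Eventually.of_forall fun y => ?_))
      simp [div_eq_inv_mul]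
    have c1 := Complex.ofRealCLM.hasFDerivAt.comp x d1
    have c2 := Complex.ofRealCLM.hasFDerivAt.comp x d2
    have c3 := (((c2.const_mul Complex.I).cexp).mul_const (σ.γ.toCircle : ℂ)).mul c1
    have hf : HasFDerivAt (soliton p Q ε σ.a σ.v σ.γ σ.μ) _ x := c3
    rw [hf.fderiv]
    have hpos : 0 ≤ ‖σ.v‖ / (2 * ε) := by positivity
    refine ContinuousLinearMap.opNorm_le_bound _ (add_nonneg (mul_nonneg hpos (norm_nonneg _))
      (norm_nonneg _)) fun y => ?_
    have b1 := (fderiv ℝ η (x - σ.a)).le_opNorm y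
    have b2 := abs_real_inner_le_norm σ.v y
    have hn := hnorm x
    push_cast at hn
    simp only [Real.norm_eq_abs] at b1 ⊢
    refine le_trans (b := |fderiv ℝ η (x - σ.a) y|
      + |η (x - σ.a)| * (ε⁻¹ * 2⁻¹ * |inner ℝ σ.v y|)) ?_ ?_
    · simp
      refine (norm_add_le _ _).trans ?_
      simp only [norm_mul, hn, Circle.norm_coe, Complex.norm_real, Complex.norm_I, norm_inv,
        Complex.norm_ofNat, Real.norm_eq_abs, abs_of_pos hε, one_mul]
      exact le_rfl
    · have h3 : |η (x - σ.a)| * (ε⁻¹ * 2⁻¹ * |inner ℝ σ.v y|)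
          ≤ |η (x - σ.a)| * (ε⁻¹ * 2⁻¹ * (‖σ.v‖ * ‖y‖)) := by gcongr
      have h4 : (‖σ.v‖ / (2 * ε) * |η (x - σ.a)| + ‖fderiv ℝ η (x - σ.a)‖) * ‖y‖
          = ‖fderiv ℝ η (x - σ.a)‖ * ‖y‖ + |η (x - σ.a)| * (ε⁻¹ * 2⁻¹ * (‖σ.v‖ * ‖y‖)) := by
        field_simp
        ring
      exact (add_le_add b1 h3).trans h4.ge

/-- The superposition `∑_l Ψ_{σ_l,ε}` as an element of `H¹`. -/
def multiSoliton {N k : ℕ} {p lam ε : ℝ} {Q : E N → ℝ} (hp : 1 < p)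
    (hQ : IsGroundState p lam 1 1 Q) (hε : 0 < ε) (σ : Fin k → Param N) : H1 N :=
  ∑ l, H1.ofC1 (soliton p Q ε (σ l).a (σ l).v (σ l).γ (σ l).μ)
    (soliton_mem hp hQ hε (σ l)).1 (soliton_mem hp hQ hε (σ l)).2.1
    (soliton_mem hp hQ hε (σ l)).2.2

/-- The `δ`-neighbourhood, in the norm `h1Norm ε`, of the multi-soliton manifold
`{∑_l Ψ_{σ_l,ε} : σ ∈ S}`. -/
def nbhd {N k : ℕ} {p lam ε : ℝ} {Q : E N → ℝ} (hp : 1 < p)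
    (hQ : IsGroundState p lam 1 1 Q) (hε : 0 < ε) (S : Set (Fin k → Param N)) (δ : ℝ) :
    Set (H1 N) :=
  {ψ | ⨅ σ : S, h1Norm ε (ψ - multiSoliton hp hQ hε σ.1) ≤ δ}

/-- `σ` is a `C¹` map from `U` to the set `T` of parameters such that, for every `ψ ∈ U`,
`ψ - ∑_l Ψ_{σ_l(ψ),ε}` is symplectically orthogonal to the tangent spaces of the soliton manifold
at all the solitons `Ψ_{σ_l(ψ),ε}`. -/
structure IsSkewDecomposition {N k : ℕ} {p lam ε : ℝ} {Q : E N → ℝ} (hp : 1 < p)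
    (hQ : IsGroundState p lam 1 1 Q) (hε : 0 < ε) (U : Set (H1 N)) (T : Set (Fin k → Param N))
    (σ : H1 N → Fin k → Param N) : Prop where
  contDiffOn : ContDiffOn ℝ 1 (fun ψ l => (σ ψ l).coords) U
  mapsTo : Set.MapsTo σ U T
  orthogonal : ∀ ψ ∈ U, ∀ l, ∀ z ∈ tangentSpace p Q ε (σ ψ l).a (σ ψ l).v (σ ψ l).γ (σ ψ l).μ,
    sympl ε (toFn (ψ - multiSoliton hp hQ hε (σ ψ))) z = 0

end NLSSoliton

end

open NLSSoliton

namespace NLSSoliton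

/-! ### Exponential decay of the ground state and of its first two derivatives -/

section Decay

variable {N : ℕ} {Q : E N → ℝ} {e : E N}

/-! Put a = εb, x = εy, μ = e^s and lift the phase to a real number θ. The weight ε^{-N} is then the
Jacobian, and ε disappears from the solitons and from the symplectic form: a soliton becomes the
value of a fixed C² map `solMap` from parameters to L², and the orthogonality conditions become the
zero set of the C¹ map `orth` on L² × parameters (`orthogonal_iff`). Since the L² part is dominated
by the H¹ norm, the equations are solved in L². What remains of ε is the mutual distance of the
rescaled centres, of order L/ε, which is as large as desired when ε is small.

Existence. The derivative of `orth` in the parameters consists of one diagonal block per soliton,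
interactions of different solitons, and the residual paired with second derivatives. The radial ODE
gives exponential decay of Q, ∇Q and D²Q (`IsGroundState.exists_exp_decay`), so interactions are
small at large separation; the residual is small by assumption. The blocks are uniformly invertible
(`IsDecaying.exists_nondegenerate`): v and θ change only the phase, so their symplectic products
with every direction are explicit (`IsDecaying.omega_gauge`). The velocity pairs with the position
through the mass, the phase with the scale through the derivative of the mass, whose sign is that of
2/(p-1) - N/2, positive because p < 1 + 4/N. A quantitative inverse function theorem then gives a
zero at distance O(δ).

Regularity. The zeros are first chosen pointwise, without continuity. Two multi-solitons near the
same ψ have nearly equal parameters up to turns of the phases, by injectivity and compactness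
(`IsDecaying.exists_close`). With local uniqueness of zeros, the chosen values agree modulo 2π with
the implicit function, which is C¹.

Uniqueness. The target set is large, and zeros of `orth` far from the chosen one are not excluded
pointwise. Instead, local uniqueness shows that two C¹ decompositions agree on an open and closed
subset of U, and U is connected (`isPreconnected_nbhd`), so one point of agreement suffices. It is
an exact multi-soliton with all μ within δ of inf I. Write u_l for its solitons and w_l for those of
a competitor. Orthogonality to i w_l gives Re⟨w_l, u_l - w_l⟩ ≈ 0, hence ‖u_l - w_l‖² ≈ ‖u_l‖² -
‖w_l‖². The mass increases with μ and the competitor's μ cannot lie much below inf I, so the right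
side is at most a small number; w_l is close to u_l, and local uniqueness applies.

On the given range m' is bounded above, so the hypothesis δ ≤ c inf m' enters only as δ ≤ const. -/

theorem radial_eq (hr : ∀ x y, ‖x‖ = ‖y‖ → Q x = Q y) (he : ‖e‖ = 1) (x : E N) :
    Q x = Q (‖x‖ • e) :=
  hr _ _ (by rw [norm_smul, he, norm_norm, mul_one])

theorem hasDerivAt_norm_line {x : E N} (hx : x ≠ 0) (u : E N) :
    HasDerivAt (fun t : ℝ => ‖x + t • u‖) (inner ℝ x u / ‖x‖) 0 := by
  have h1 : HasDerivAt (fun t : ℝ => x + t • u) u 0 := by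
    simpa using ((hasDerivAt_id (0 : ℝ)).smul_const u).const_add x
  have h2 := h1.norm_sq
  have hx' : 0 < ‖x‖ := norm_pos_iff.2 hx
  have h3 := h2.sqrt (by simpa using hx)
  simp only [zero_smul, add_zero, Real.sqrt_sq (norm_nonneg _)] at h3
  rwa [mul_div_mul_left _ _ two_ne_zero] at h3

theorem fderiv_radial (hQ : ContDiff ℝ 2 Q) (hr : ∀ x y, ‖x‖ = ‖y‖ → Q x = Q y) (he : ‖e‖ = 1)
    {x : E N} (hx : x ≠ 0) (u : E N) :
    fderiv ℝ Q x u = deriv (fun r : ℝ => Q (r • e)) ‖x‖ * (inner ℝ x u / ‖x‖) := by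
  have hq : ContDiff ℝ 2 (fun r : ℝ => Q (r • e)) := hQ.comp (contDiff_id.smul contDiff_const)
  have h1 : HasDerivAt (fun t : ℝ => x + t • u) u 0 := by
    simpa using ((hasDerivAt_id (0 : ℝ)).smul_const u).const_add x
  have h2 : HasDerivAt (fun t : ℝ => Q (x + t • u)) (fderiv ℝ Q x u) 0 := by
    have h : HasFDerivAt Q (fderiv ℝ Q x) (x + (0 : ℝ) • u) := by
      simpa using ((hQ.differentiable (by simp)) x).hasFDerivAt
    exact h.comp_hasDerivAt (0 : ℝ) h1
  have h3 : HasDerivAt (fun t : ℝ => Q (‖x + t • u‖ • e))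
      (deriv (fun r : ℝ => Q (r • e)) ‖x‖ * (inner ℝ x u / ‖x‖)) 0 := by
    have h : HasDerivAt (fun r : ℝ => Q (r • e)) (deriv (fun r : ℝ => Q (r • e)) ‖x‖)
        ‖x + (0 : ℝ) • u‖ := by
      simpa using ((hq.differentiable (by simp)) ‖x‖).hasDerivAt
    exact h.comp (0 : ℝ) (hasDerivAt_norm_line hx u)
  refine h2.unique (h3.congr_of_eventuallyEq (Filter.Eventually.of_forall fun t => ?_))
  exact radial_eq hr he _

/-- Differentiates `fderiv_radial` along x + tu, which avoids the origin for small t. The diagonal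
u, u suffices: its trace is the Laplacian, and polarization recovers the full Hessian. -/
theorem fderiv_fderiv_radial (hQ : ContDiff ℝ 2 Q) (hr : ∀ x y, ‖x‖ = ‖y‖ → Q x = Q y)
    (he : ‖e‖ = 1) {x : E N} (hx : x ≠ 0) (u : E N) :
    fderiv ℝ (fderiv ℝ Q) x u u
      = deriv (deriv (fun r : ℝ => Q (r • e))) ‖x‖ * (inner ℝ x u / ‖x‖) ^ 2
        + deriv (fun r : ℝ => Q (r • e)) ‖x‖ * (‖u‖ ^ 2 / ‖x‖ - inner ℝ x u ^ 2 / ‖x‖ ^ 3) := by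
  have hx' : 0 < ‖x‖ := norm_pos_iff.2 hx
  have hq : ContDiff ℝ 2 (fun r : ℝ => Q (r • e)) := hQ.comp (contDiff_id.smul contDiff_const)
  set q' := deriv (fun r : ℝ => Q (r • e)) with hq'
  have hq'd : Differentiable ℝ q' := by
    have := (contDiff_succ_iff_deriv (n := 1)).1 hq
    exact this.2.2.differentiable (by simp)
  have h1 : HasDerivAt (fun t : ℝ => x + t • u) u 0 := by
    simpa using ((hasDerivAt_id (0 : ℝ)).smul_const u).const_add x
  have hd : Differentiable ℝ (fderiv ℝ Q) :=
    (hQ.fderiv_right (m := 1) (by norm_num)).differentiable (by simp)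
  have h2 : HasDerivAt (fun t : ℝ => fderiv ℝ Q (x + t • u) u)
      (fderiv ℝ (fderiv ℝ Q) x u u) 0 := by
    have h : HasFDerivAt (fderiv ℝ Q) (fderiv ℝ (fderiv ℝ Q) x) (x + (0 : ℝ) • u) := by
      simpa using (hd x).hasFDerivAt
    exact (ContinuousLinearMap.apply ℝ ℝ u).hasFDerivAt.comp_hasDerivAt (0 : ℝ)
      (h.comp_hasDerivAt (0 : ℝ) h1)
  have hn := hasDerivAt_norm_line hx u
  have hi : HasDerivAt (fun t : ℝ => inner ℝ (x + t • u) u) (‖u‖ ^ 2) 0 := by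
    have h := h1.inner ℝ (hasDerivAt_const (0 : ℝ) u)
    simpa using h
  have h3 : HasDerivAt (fun t : ℝ => q' ‖x + t • u‖)
      (deriv q' ‖x‖ * (inner ℝ x u / ‖x‖)) 0 := by
    have h : HasDerivAt q' (deriv q' ‖x‖) ‖x + (0 : ℝ) • u‖ := by
      simpa using (hq'd ‖x‖).hasDerivAt
    exact h.comp (0 : ℝ) hn
  have h4 := h3.mul (hi.div hn (by simpa using hx))
  have hev : (fun t : ℝ => fderiv ℝ Q (x + t • u) u) =ᶠ[nhds 0]
      ((fun t => q' ‖x + t • u‖) * ((fun t => inner ℝ (x + t • u) u) / fun t => ‖x + t • u‖)) := by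
    have : ∀ᶠ t : ℝ in nhds 0, x + t • u ≠ 0 := by
      refine h1.continuousAt.eventually_ne ?_
      simpa using hx
    filter_upwards [this] with t ht
    rw [fderiv_radial hQ hr he ht u]
    rfl
  rw [h2.unique (h4.congr_of_eventuallyEq hev)]
  simp only [zero_smul, add_zero, Pi.div_apply]
  field_simp

theorem laplacian_radial (hQ : ContDiff ℝ 2 Q) (hr : ∀ x y, ‖x‖ = ‖y‖ → Q x = Q y)
    (he : ‖e‖ = 1) {r : ℝ} (hr0 : 0 < r) :
    Laplacian.laplacian Q (r • e) = deriv (deriv (fun r : ℝ => Q (r • e))) r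
      + (N - 1) / r * deriv (fun r : ℝ => Q (r • e)) r := by
  have hx : r • e ≠ 0 := smul_ne_zero hr0.ne' (by rintro rfl; simp at he)
  have hn : ‖r • e‖ = r := by rw [norm_smul, he, mul_one, Real.norm_of_nonneg hr0.le]
  rw [InnerProductSpace.laplacian_eq_iteratedFDeriv_stdOrthonormalBasis]
  simp only
  have h1 : ∀ i, iteratedFDeriv ℝ 2 Q (r • e)
      ![stdOrthonormalBasis ℝ (E N) i, stdOrthonormalBasis ℝ (E N) i]
      = (deriv (deriv (fun r : ℝ => Q (r • e))) r / r ^ 2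
          - deriv (fun r : ℝ => Q (r • e)) r / r ^ 3)
          * inner ℝ (r • e) (stdOrthonormalBasis ℝ (E N) i) ^ 2
        + deriv (fun r : ℝ => Q (r • e)) r / r := by
    intro i
    rw [iteratedFDeriv_two_apply]
    simp only [Matrix.cons_val_zero, Matrix.cons_val_one]
    rw [fderiv_fderiv_radial hQ hr he hx, hn, (stdOrthonormalBasis ℝ (E N)).norm_eq_one]
    field_simp
    ring
  rw [Finset.sum_congr rfl fun i _ => h1 i, Finset.sum_add_distrib, ← Finset.mul_sum]
  have h2 : ∑ i, inner ℝ (r • e) (stdOrthonormalBasis ℝ (E N) i) ^ 2 = r ^ 2 := by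
    have := (stdOrthonormalBasis ℝ (E N)).sum_sq_norm_inner_left (r • e)
    rw [hn] at this
    rw [← this]
    refine Finset.sum_congr rfl fun i _ => ?_
    rw [Real.norm_eq_abs, sq_abs]
  rw [h2]
  simp
  field_simp
  ring

/-- Polarization with the parallelogram law. The supremum with 0 covers the trivial space, where C
may be negative. -/
theorem norm_bilin_le_of_diag {B : E N →L[ℝ] E N →L[ℝ] ℝ} (hs : ∀ u w, B u w = B w u) {C : ℝ}
    (hC : ∀ u, |B u u| ≤ C * ‖u‖ ^ 2) : ‖B‖ ≤ 2 * C ⊔ 0 := by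
  refine B.opNorm_le_of_unit_norm (le_sup_right) fun u hu => ?_
  refine (B u).opNorm_le_of_unit_norm (le_sup_right) fun w hw => ?_
  have h1 := hC (u + w)
  have h2 := hC u
  have h3 := hC w
  have h4 : B (u + w) (u + w) = B u u + 2 * B u w + B w w := by
    simp [hs w u]; ring
  have h5 : ‖u + w‖ ≤ 2 := (norm_add_le _ _).trans (by rw [hu, hw]; norm_num)
  have hC0 : 0 ≤ C := by
    have := (abs_nonneg _).trans h2
    simpa [hu] using this
  have h1' := hC (u - w)
  have h4' : B (u - w) (u - w) = B u u - 2 * B u w + B w w := by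
    simp [hs w u]; ring
  have hp := parallelogram_law_with_norm ℝ u w
  rw [hu, hw] at hp
  rw [h4] at h1
  rw [h4'] at h1'
  refine le_max_of_le_left ?_
  rw [Real.norm_eq_abs, abs_le]
  rw [abs_le] at h1 h1'
  have hq : C * ‖u + w‖ ^ 2 + C * ‖u - w‖ ^ 2 = C * 4 := by
    rw [← mul_add]; congr 1; nlinarith [hp]
  constructor <;> linarith [h1.1, h1.2, h1'.1, h1'.2]

/-- A nonnegative decreasing function whose second derivative is at least `κ²` times the function
decays exponentially. -/
theorem exp_decay_of_deriv_ineq {q q' q'' : ℝ → ℝ} {R κ : ℝ} (hκ : 0 < κ)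
    (h1 : ∀ r, HasDerivAt q (q' r) r) (h2 : ∀ r, HasDerivAt q' (q'' r) r)
    (hq1 : ∀ r, R ≤ r → q' r ≤ 0) (hq2 : ∀ r, R ≤ r → κ ^ 2 * q r ≤ q'' r)
    {r : ℝ} (hr : R ≤ r) : q r ≤ q R * Real.exp (-(κ * (r - R))) := by
  have hE : ∀ (c r : ℝ), HasDerivAt (fun r => Real.exp (c * r)) (Real.exp (c * r) * c) r := by
    intro c r
    simpa using ((hasDerivAt_id r).const_mul c).exp
  have hanti : ∀ r s, R ≤ r → r ≤ s → q s ≤ q r := by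
    intro r s hr hs
    have : AntitoneOn q (Set.Ici R) := by
      refine antitoneOn_of_deriv_nonpos (convex_Ici R)
        (fun x _ => (h1 x).continuousAt.continuousWithinAt)
        (fun x _ => (h1 x).differentiableAt.differentiableWithinAt) fun x hx => ?_
      rw [(h1 x).deriv]
      rw [interior_Ici] at hx
      exact hq1 x (le_of_lt hx)
    exact this hr (hr.trans hs) hs
  -- Factor ∂² - κ² as (∂ - κ)(∂ + κ): the derivative of this function is (q'' - κ² q) e^{-κr} ≥ 0.
  have hmono : MonotoneOn (fun r => (q' r + κ * q r) * Real.exp (-κ * r)) (Set.Ici R) := by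
    have hd : ∀ x, HasDerivAt (fun r => (q' r + κ * q r) * Real.exp (-κ * r))
        ((q'' x + κ * q' x) * Real.exp (-κ * x)
          + (q' x + κ * q x) * (Real.exp (-κ * x) * -κ)) x :=
      fun x => ((h2 x).add ((h1 x).const_mul κ)).mul (hE (-κ) x)
    refine monotoneOn_of_deriv_nonneg (convex_Ici R)
      (fun x _ => (hd x).continuousAt.continuousWithinAt)
      (fun x _ => (hd x).differentiableAt.differentiableWithinAt) fun x hx => ?_
    rw [(hd x).deriv]
    rw [interior_Ici] at hx
    have := hq2 x (le_of_lt hx)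
    have he := Real.exp_pos (-κ * x)
    have : (q'' x + κ * q' x) * Real.exp (-κ * x)
          + (q' x + κ * q x) * (Real.exp (-κ * x) * -κ)
        = (q'' x - κ ^ 2 * q x) * Real.exp (-κ * x) := by ring
    rw [this]
    exact mul_nonneg (by linarith) he.le
  -- A positive value at r would persist, and with q' ≤ 0 it would force κ q(s) ≥ A e^{κs} for all s
  -- ≥ r, impossible for a nonincreasing q.
  have hf : ∀ r, R ≤ r → q' r + κ * q r ≤ 0 := by
    intro r hr
    by_contra! hc
    set A := (q' r + κ * q r) * Real.exp (-κ * r) with hA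
    have hA0 : 0 < A := mul_pos hc (Real.exp_pos _)
    have hge : ∀ s, r ≤ s → A * Real.exp (κ * s) ≤ κ * q r := by
      intro s hs
      have h3 : A ≤ (q' s + κ * q s) * Real.exp (-κ * s) := hmono hr (hr.trans hs) hs
      have h4 : (q' s + κ * q s) * Real.exp (-κ * s) * Real.exp (κ * s) = q' s + κ * q s := by
        rw [mul_assoc, ← Real.exp_add]; simp
      have h5 := mul_le_mul_of_nonneg_right h3 (Real.exp_pos (κ * s)).le
      rw [h4] at h5
      have h6 := hq1 s (hr.trans hs)
      have h7 := mul_le_mul_of_nonneg_left (hanti r s hr hs) hκ.le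
      linarith
    have ht : Filter.Tendsto (fun s => A * Real.exp (κ * s)) Filter.atTop Filter.atTop :=
      (Real.tendsto_exp_atTop.comp (Filter.tendsto_id.const_mul_atTop hκ)).const_mul_atTop hA0
    obtain ⟨s, hs1, hs2⟩ := ((Filter.eventually_ge_atTop r).and
      (ht.eventually_gt_atTop (κ * q r))).exists
    exact absurd (hge s hs1) (not_le.2 hs2)
  have hmono2 : AntitoneOn (fun r => q r * Real.exp (κ * r)) (Set.Ici R) := by
    have hd : ∀ x, HasDerivAt (fun r => q r * Real.exp (κ * r))
        (q' x * Real.exp (κ * x) + q x * (Real.exp (κ * x) * κ)) x :=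
      fun x => (h1 x).mul (hE κ x)
    refine antitoneOn_of_deriv_nonpos (convex_Ici R)
      (fun x _ => (hd x).continuousAt.continuousWithinAt)
      (fun x _ => (hd x).differentiableAt.differentiableWithinAt) fun x hx => ?_
    rw [(hd x).deriv]
    rw [interior_Ici] at hx
    have := hf x (le_of_lt hx)
    have he := Real.exp_pos (κ * x)
    nlinarith
  have h3 : q r * Real.exp (κ * r) ≤ q R * Real.exp (κ * R) := hmono2 Set.self_mem_Ici hr hr
  have h4 := mul_le_mul_of_nonneg_right h3 (Real.exp_pos (-(κ * r))).le
  rw [mul_assoc, mul_assoc, ← Real.exp_add, ← Real.exp_add] at h4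
  simp only [add_neg_cancel, Real.exp_zero, mul_one] at h4
  refine h4.trans (le_of_eq ?_)
  congr 2
  ring

theorem exists_exp_bound {F : Type*} [NormedAddCommGroup F] {f : E N → F} (hf : Continuous f)
    {κ A R : ℝ} (hκ : 0 ≤ κ) (h : ∀ x, R ≤ ‖x‖ → ‖f x‖ ≤ A * Real.exp (-(κ * ‖x‖))) :
    ∃ C, 0 ≤ C ∧ ∀ x, ‖f x‖ ≤ C * Real.exp (-(κ * ‖x‖)) := by
  obtain ⟨C, hC⟩ := (isCompact_closedBall (0 : E N) R).exists_bound_of_continuousOn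
    hf.continuousOn
  refine ⟨max (max A 0) (C * Real.exp (κ * R)), le_max_of_le_left (le_max_right _ _), fun x => ?_⟩
  have he := Real.exp_pos (-(κ * ‖x‖))
  rcases le_total R ‖x‖ with hx | hx
  · refine (h x hx).trans (mul_le_mul_of_nonneg_right ?_ he.le)
    exact le_max_of_le_left (le_max_left _ _)
  · have h1 := hC x (by simpa using hx)
    have h2 : 1 ≤ Real.exp (κ * R) * Real.exp (-(κ * ‖x‖)) := by
      rw [← Real.exp_add]
      refine Real.one_le_exp ?_
      nlinarith
    have hC0 : 0 ≤ C := (norm_nonneg _).trans h1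
    calc ‖f x‖ ≤ C * 1 := by linarith
      _ ≤ C * (Real.exp (κ * R) * Real.exp (-(κ * ‖x‖))) := by gcongr
      _ = C * Real.exp (κ * R) * Real.exp (-(κ * ‖x‖)) := by ring
      _ ≤ _ := mul_le_mul_of_nonneg_right (le_max_right _ _) he.le

theorem IsGroundState.antitone {p lam μ ε : ℝ} (hQ : IsGroundState p lam μ ε Q) {x y : E N}
    (h : ‖x‖ ≤ ‖y‖) : Q y ≤ Q x := by
  rcases h.lt_or_eq with h | h
  · exact (hQ.decreasing _ _ h).le
  · exact (hQ.radial _ _ h).ge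

/-- A positive lower bound would put a nonzero constant into L² of a space of infinite measure. -/
theorem IsGroundState.exists_lt {p lam μ ε : ℝ} (hN : 1 ≤ N) (hQ : IsGroundState p lam μ ε Q)
    {c : ℝ} (hc : 0 < c) : ∃ x, Q x < c := by
  by_contra! h
  have : MemLp (fun _ : E N => c) 2 volume := by
    refine hQ.memLp.mono (by fun_prop) ?_
    filter_upwards with x
    rw [Real.norm_of_nonneg hc.le]
    exact (h x).trans (le_abs_self _)
  have : Nonempty (Fin N) := ⟨⟨0, hN⟩⟩
  rcases (memLp_const_iff (by simp) (by simp)).1 ‹MemLp (fun _ : E N => c) 2 volume› with h0 | h0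
  · exact hc.ne' h0
  · simp at h0

/-- The radial profile satisfies q'' = q - lam q^p - (N-1)q'/r with q' ≤ 0. Where q is small the
nonlinear term is at most q/2, so q'' ≥ q/4 and comparison gives the rate 1/2. Convexity of q there
bounds |q'(r)| by q(r-1), the equation then bounds q'', and the radial formulas pass these bounds on
to ∇Q and D²Q. -/
theorem IsGroundState.exists_exp_decay {p lam : ℝ} (hN : 1 ≤ N) (hp : 1 < p) (hlam : 0 < lam)
    (hQ : IsGroundState p lam 1 1 Q) : ∃ C, 0 ≤ C ∧ ∀ x,
      ‖Q x‖ ≤ C * Real.exp (-(1 / 2 * ‖x‖)) ∧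
      ‖fderiv ℝ Q x‖ ≤ C * Real.exp (-(1 / 2 * ‖x‖)) ∧
      ‖fderiv ℝ (fderiv ℝ Q) x‖ ≤ C * Real.exp (-(1 / 2 * ‖x‖)) := by
  have hp1 : 0 < p - 1 := by linarith
  set e : E N := basisVec ⟨0, hN⟩ with he_def
  have he : ‖e‖ = 1 := by simp [he_def, basisVec]
  set q : ℝ → ℝ := fun r => Q (r • e) with hq_def
  have hq : ContDiff ℝ 2 q := hQ.contDiff.comp (contDiff_id.smul contDiff_const)
  have hq1 : ContDiff ℝ 1 (deriv q) := ((contDiff_succ_iff_deriv (n := 1)).1 hq).2.2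
  have hd1 : ∀ r, HasDerivAt q (deriv q r) r := fun r =>
    ((hq.differentiable (by simp)) r).hasDerivAt
  have hd2 : ∀ r, HasDerivAt (deriv q) (deriv (deriv q) r) r := fun r =>
    ((hq1.differentiable (by simp)) r).hasDerivAt
  have hqpos : ∀ r, 0 < q r := fun r => hQ.pos _
  have hqanti : ∀ r s, 0 ≤ r → r ≤ s → q s ≤ q r := fun r s h0 hs => hQ.antitone (by
    rw [norm_smul, norm_smul, he, Real.norm_of_nonneg h0, Real.norm_of_nonneg (h0.trans hs)]
    linarith)
  -- The threshold is the value of q at which lam q^{p-1} = 1/2.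
  obtain ⟨x₀, hx₀⟩ := hQ.exists_lt hN
    (c := (1 / (2 * lam)) ^ (1 / (p - 1))) (Real.rpow_pos_of_pos (by positivity) _)
  set R := max ‖x₀‖ 1 with hR
  have hR1 : 1 ≤ R := le_max_right _ _
  have hsmall : ∀ r, R ≤ r → lam * q r ^ p ≤ q r / 2 := by
    intro r hr
    have h1 : q r < (1 / (2 * lam)) ^ (1 / (p - 1)) := by
      refine lt_of_le_of_lt (hQ.antitone ?_) hx₀
      rw [norm_smul, he, Real.norm_of_nonneg (by linarith)]
      linarith [le_max_left ‖x₀‖ 1]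
    have h2 : q r ^ (p - 1) ≤ 1 / (2 * lam) := by
      have := Real.rpow_le_rpow (hqpos r).le h1.le hp1.le
      rwa [← Real.rpow_mul (by positivity), one_div_mul_cancel hp1.ne', Real.rpow_one] at this
    have h3 : q r ^ p = q r ^ (p - 1) * q r := by
      rw [← Real.rpow_add_one (hqpos r).ne']; congr 1; ring
    rw [h3]
    have h4 : lam * q r ^ (p - 1) ≤ 1 / 2 := by
      calc lam * q r ^ (p - 1) ≤ lam * (1 / (2 * lam)) := by gcongr
        _ = 1 / 2 := by field_simp
    nlinarith [hqpos r]
  have hode : ∀ r, 0 < r → deriv (deriv q) r = q r - lam * q r ^ p - (N - 1) / r * deriv q r := by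
    intro r hr
    have h1 := hQ.equation (r • e)
    rw [laplacian_radial hQ.contDiff hQ.radial he hr] at h1
    simp only [hq_def]
    linarith
  have hN' : (1 : ℝ) ≤ N := by exact_mod_cast hN
  have hq'neg : ∀ r, 0 < r → deriv q r ≤ 0 := by
    intro r hr
    have h1 : AntitoneOn q (Set.Ici 0) := fun a ha b _ hab => hqanti a b ha hab
    have h2 := h1.derivWithin_nonpos (x := r)
    rwa [derivWithin_of_mem_nhds (Ici_mem_nhds hr)] at h2
  have hq''lb : ∀ r, R ≤ r → (1 / 2 : ℝ) ^ 2 * q r ≤ deriv (deriv q) r := by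
    intro r hr
    have hr0 : 0 < r := by linarith
    rw [hode r hr0]
    have h1 : 0 ≤ (N - 1) / r * (-deriv q r) :=
      mul_nonneg (div_nonneg (by linarith) hr0.le) (by linarith [hq'neg r hr0])
    have := hsmall r hr
    have := hqpos r
    nlinarith
  have hdec : ∀ r, R ≤ r → q r ≤ q R * Real.exp (-(1 / 2 * (r - R))) := fun r hr =>
    exp_decay_of_deriv_ineq (by norm_num) hd1 hd2 (fun r hr => hq'neg r (by linarith)) hq''lb hr
  set A := q R * Real.exp (1 / 2 * (R + 1)) with hA
  have hA0 : 0 < A := mul_pos (hqpos _) (Real.exp_pos _)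
  -- Stated at r - 1 because the mean value theorem on [r-1, r] will bound |q'(r)| by q(r-1); the R
  -- + 1 in A pays for the shift.
  have hdec1 : ∀ r, R + 1 ≤ r → q (r - 1) ≤ A * Real.exp (-(1 / 2 * r)) := by
    intro r hr
    refine (hdec (r - 1) (by linarith)).trans (le_of_eq ?_)
    rw [hA, mul_assoc, ← Real.exp_add]
    congr 2
    ring
  have hmono : MonotoneOn (deriv q) (Set.Ici R) := by
    refine monotoneOn_of_deriv_nonneg (convex_Ici R)
      (fun x _ => (hd2 x).continuousAt.continuousWithinAt)
      (fun x _ => (hd2 x).differentiableAt.differentiableWithinAt) fun x hx => ?_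
    rw [interior_Ici] at hx
    exact le_trans (mul_nonneg (by norm_num) (hqpos x).le) (hq''lb x (le_of_lt hx))
  have hq'b : ∀ r, R + 1 ≤ r → |deriv q r| ≤ A * Real.exp (-(1 / 2 * r)) := by
    intro r hr
    rw [abs_of_nonpos (hq'neg r (by linarith))]
    obtain ⟨ξ, hξ, hξ'⟩ := exists_hasDerivAt_eq_slope q (deriv q) (by linarith : r - 1 < r)
      (fun x _ => (hd1 x).continuousAt.continuousWithinAt) (fun x _ => hd1 x)
    have h1 := hmono (show R ≤ ξ by linarith [hξ.1]) (show R ≤ r by linarith) hξ.2.le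
    have h2 : r - (r - 1) = 1 := by ring
    rw [h2, div_one] at hξ'
    have := hdec1 r hr
    have := hqpos r
    linarith
  have hqb : ∀ r, R + 1 ≤ r → q r ≤ A * Real.exp (-(1 / 2 * r)) := fun r hr =>
    (hqanti (r - 1) r (by linarith) (by linarith)).trans (hdec1 r hr)
  have hq''b : ∀ r, R + 1 ≤ r → |deriv (deriv q) r| ≤ N * (A * Real.exp (-(1 / 2 * r))) := by
    intro r hr
    have hr0 : 0 < r := by linarith
    have h0 : 0 ≤ deriv (deriv q) r :=
      le_trans (mul_nonneg (by norm_num) (hqpos r).le) (hq''lb r (by linarith))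
    rw [abs_of_nonneg h0, hode r hr0]
    have h1 := hqb r hr
    have h2 := hq'b r hr
    rw [abs_of_nonpos (hq'neg r hr0)] at h2
    have h3 : 0 ≤ lam * q r ^ p := mul_nonneg hlam.le (Real.rpow_nonneg (hqpos r).le _)
    have h4 : (N - 1) / r ≤ (N - 1 : ℝ) := div_le_self (by linarith) (by linarith)
    have h5 : (N - 1) / r * (-deriv q r) ≤ (N - 1) * (A * Real.exp (-(1 / 2 * r))) :=
      mul_le_mul h4 h2 (by linarith [hq'neg r hr0]) (by linarith)
    linarith
  have hx0 : ∀ x : E N, R + 1 ≤ ‖x‖ → x ≠ 0 := fun x hx => norm_pos_iff.1 (by linarith)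
  have hcs : ∀ x u : E N, x ≠ 0 → |inner ℝ x u / ‖x‖| ≤ ‖u‖ := by
    intro x u hx
    rw [abs_div, abs_norm, div_le_iff₀ (norm_pos_iff.2 hx), mul_comm]
    exact abs_real_inner_le_norm x u
  have hQ1 : Continuous (fderiv ℝ Q) := hQ.contDiff.continuous_fderiv (by simp)
  have hQ2 : Continuous (fderiv ℝ (fderiv ℝ Q)) :=
    (hQ.contDiff.fderiv_right (m := 1) (by norm_num)).continuous_fderiv (by simp)
  obtain ⟨C0, hC0, hb0⟩ := exists_exp_bound (κ := 1 / 2) (A := A) (R := R + 1)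
    hQ.contDiff.continuous (by norm_num) (fun x hx => by
      rw [Real.norm_of_nonneg (hQ.pos x).le, radial_eq hQ.radial he x]
      exact hqb _ hx)
  obtain ⟨C1, hC1, hb1⟩ := exists_exp_bound (κ := 1 / 2) (A := A) (R := R + 1) hQ1 (by norm_num)
    (fun x hx => by
      refine ContinuousLinearMap.opNorm_le_bound _ (by positivity) fun u => ?_
      rw [fderiv_radial hQ.contDiff hQ.radial he (hx0 x hx), norm_mul]
      exact mul_le_mul (hq'b _ hx) (hcs x u (hx0 x hx)) (norm_nonneg _) (by positivity))
  obtain ⟨C2, hC2, hb2⟩ := exists_exp_bound (F := E N →L[ℝ] E N →L[ℝ] ℝ)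
    (f := fderiv ℝ (fderiv ℝ Q)) (κ := 1 / 2) (A := 2 * ((N + 1) * A)) (R := R + 1) hQ2
    (by norm_num) (fun x hx => by
      have hx' := hx0 x hx
      have hxp : 1 ≤ ‖x‖ := by linarith
      have h1 : ∀ u w, fderiv ℝ (fderiv ℝ Q) x u w = fderiv ℝ (fderiv ℝ Q) x w u := fun u w =>
        (hQ.contDiff.contDiffAt.isSymmSndFDerivAt (by simp)) u w
      have h2 := norm_bilin_le_of_diag h1 (C := (N + 1) * (A * Real.exp (-(1 / 2 * ‖x‖)))) ?_
      · refine h2.trans (le_of_eq ?_)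
        rw [max_eq_left (by positivity)]
        ring
      · intro u
        rw [fderiv_fderiv_radial hQ.contDiff hQ.radial he hx']
        set t := inner ℝ x u / ‖x‖ with ht
        have h3 : ‖u‖ ^ 2 / ‖x‖ - inner ℝ x u ^ 2 / ‖x‖ ^ 3 = (‖u‖ ^ 2 - t ^ 2) / ‖x‖ := by
          rw [ht]; field_simp
        have h4 := hcs x u hx'
        have h5 : t ^ 2 ≤ ‖u‖ ^ 2 := sq_le_sq.2 (by rwa [abs_norm])
        have h6 : |(‖u‖ ^ 2 - t ^ 2) / ‖x‖| ≤ ‖u‖ ^ 2 := by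
          rw [abs_of_nonneg (div_nonneg (by linarith) (norm_nonneg _))]
          refine (div_le_self (by linarith) hxp).trans ?_
          nlinarith [sq_nonneg t]
        rw [h3]
        refine (abs_add_le _ _).trans ?_
        rw [abs_mul, abs_mul, abs_of_nonneg (sq_nonneg t)]
        have h7 := mul_le_mul (hq''b _ hx) h5 (sq_nonneg _) (by positivity)
        have h8 := mul_le_mul (hq'b _ hx) h6 (abs_nonneg _) (by positivity)
        refine (add_le_add h7 h8).trans (le_of_eq ?_)
        ring)
  refine ⟨max C0 (max C1 C2), le_max_of_le_left hC0, fun x => ⟨?_, ?_, ?_⟩⟩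
  · exact (hb0 x).trans (mul_le_mul_of_nonneg_right (le_max_left _ _) (Real.exp_pos _).le)
  · exact (hb1 x).trans (mul_le_mul_of_nonneg_right
      ((le_max_left _ _).trans (le_max_right _ _)) (Real.exp_pos _).le)
  · exact (hb2 x).trans (mul_le_mul_of_nonneg_right
      ((le_max_right _ _).trans (le_max_right _ _)) (Real.exp_pos _).le)

end Decay

end NLSSoliton

namespace NLSSoliton

/-! ### Parameter-dependent families in L² and the symplectic form -/

section L2Tools

open Classical in
/-- The class in `L²` of a square integrable function, and `0` for other functions. -/
noncomputable def toL2 {N : ℕ} (f : E N → ℂ) : L2 N :=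
  if h : MemLp f 2 volume then h.toLp f else 0

variable {N : ℕ}

theorem toL2_eq {f : E N → ℂ} (h : MemLp f 2 volume) : toL2 f = h.toLp f := dif_pos h

theorem coeFn_toL2 {f : E N → ℂ} (h : MemLp f 2 volume) : toL2 f =ᵐ[volume] f := by
  rw [toL2_eq h]; exact h.coeFn_toLp

theorem toL2_congr {f g : E N → ℂ} (h : f =ᵐ[volume] g) : toL2 f = toL2 g := by
  by_cases hf : MemLp f 2 volume
  · rw [toL2_eq hf, toL2_eq (hf.ae_eq h)]
    exact MemLp.toLp_congr _ _ h
  · have hg : ¬ MemLp g 2 volume := fun hg => hf (hg.ae_eq h.symm)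
    rw [toL2, toL2, dif_neg hf, dif_neg hg]

theorem toL2_add {f g : E N → ℂ} (hf : MemLp f 2 volume) (hg : MemLp g 2 volume) :
    toL2 (fun x => f x + g x) = toL2 f + toL2 g := by
  rw [toL2_eq hf, toL2_eq hg, toL2_eq (f := fun x => f x + g x) (hf.add hg)]
  exact MemLp.toLp_add hf hg

theorem toL2_sub {f g : E N → ℂ} (hf : MemLp f 2 volume) (hg : MemLp g 2 volume) :
    toL2 (fun x => f x - g x) = toL2 f - toL2 g := by
  rw [toL2_eq hf, toL2_eq hg, toL2_eq (f := fun x => f x - g x) (hf.sub hg)]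
  exact MemLp.toLp_sub hf hg

theorem toL2_smul {f : E N → ℂ} (c : ℝ) (hf : MemLp f 2 volume) :
    toL2 (fun x => c • f x) = c • toL2 f := by
  rw [toL2_eq hf, toL2_eq (f := fun x => c • f x) (hf.const_smul c)]
  exact MemLp.toLp_const_smul c hf

theorem norm_sq_L2 (u : L2 N) : ‖u‖ ^ 2 = ∫ x, ‖u x‖ ^ 2 := by
  have h := L2.inner_def (𝕜 := ℂ) u u
  rw [inner_self_eq_norm_sq_to_K] at h
  have h2 : ∀ x, inner ℂ (u x) (u x) = ((‖u x‖ ^ 2 : ℝ) : ℂ) := fun x => by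
    rw [inner_self_eq_norm_sq_to_K]; simp
  simp only [h2] at h
  rw [integral_complex_ofReal] at h
  exact Complex.ofReal_injective (by simpa using h)

theorem norm_sq_toL2 {f : E N → ℂ} (hf : MemLp f 2 volume) :
    ‖toL2 f‖ ^ 2 = ∫ x, ‖f x‖ ^ 2 := by
  rw [norm_sq_L2]
  refine integral_congr_ae ?_
  filter_upwards [coeFn_toL2 hf] with x hx
  rw [hx]

theorem memLp_of_le {f : E N → ℂ} {b : E N → ℝ} (hf : Continuous f) (hb : MemLp b 2 volume)
    (h : ∀ x, ‖f x‖ ≤ b x) : MemLp f 2 volume :=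
  hb.mono' hf.aestronglyMeasurable (Filter.Eventually.of_forall h)

theorem norm_toL2_le {f : E N → ℂ} {b : E N → ℝ} (hf : Continuous f) (hb : MemLp b 2 volume)
    (h : ∀ x, ‖f x‖ ≤ b x) : ‖toL2 f‖ ≤ Real.sqrt (∫ x, b x ^ 2) := by
  refine Real.le_sqrt_of_sq_le ?_
  rw [norm_sq_toL2 (memLp_of_le hf hb h)]
  exact integral_mono ((memLp_of_le hf hb h).integrable_norm_pow (by norm_num)) hb.integrable_sq
    fun x => pow_le_pow_left₀ (norm_nonneg _) (h x) 2

theorem real_smul_L2 (c : ℝ) (u : L2 N) : c • u = (c : ℂ) • u := by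
  refine Lp.ext ?_
  filter_upwards [Lp.coeFn_smul c u, Lp.coeFn_smul (c : ℂ) u] with x h1 h2
  rw [h1, h2]
  simp

/-- The symplectic form on `L²`. -/
noncomputable def omega : L2 N →L[ℝ] L2 N →L[ℝ] ℝ :=
  LinearMap.mkContinuous₂
    (LinearMap.mk₂ ℝ (fun u w : L2 N => (inner ℂ w u).im)
      (fun u u' w => by rw [inner_add_right, Complex.add_im])
      (fun c u w => by
        rw [real_smul_L2, inner_smul_right]; simp)
      (fun u w w' => by rw [inner_add_left, Complex.add_im])
      (fun c u w => by
        rw [real_smul_L2, inner_smul_left]; simp))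
    1 (fun u w => by
      simp only [LinearMap.mk₂_apply, one_mul, Real.norm_eq_abs]
      refine (Complex.abs_im_le_norm _).trans ?_
      rw [mul_comm]
      exact norm_inner_le_norm w u)

theorem omega_apply (u w : L2 N) : omega u w = (inner ℂ w u).im := rfl

theorem abs_omega_le (u w : L2 N) : |omega u w| ≤ ‖u‖ * ‖w‖ := by
  rw [omega_apply, mul_comm]
  exact (Complex.abs_im_le_norm _).trans (norm_inner_le_norm w u)

theorem norm_omega_le (u : L2 N) : ‖omega u‖ ≤ ‖u‖ :=
  ContinuousLinearMap.opNorm_le_bound _ (norm_nonneg _) fun w => abs_omega_le u w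

theorem omega_swap (u w : L2 N) : omega u w = - omega w u := by
  rw [omega_apply, omega_apply, ← inner_conj_symm w u, Complex.conj_im]

theorem omega_eq_integral (u w : L2 N) :
    omega u w = (∫ x, u x * (starRingEnd ℂ) (w x)).im := by
  rw [omega_apply, L2.inner_def]
  congr 1

theorem omega_toL2 {f g : E N → ℂ} (hf : MemLp f 2 volume) (hg : MemLp g 2 volume) :
    omega (toL2 f) (toL2 g) = (∫ x, f x * (starRingEnd ℂ) (g x)).im := by
  rw [omega_eq_integral]
  congr 1
  refine integral_congr_ae ?_
  filter_upwards [coeFn_toL2 hf, coeFn_toL2 hg] with x hx hy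
  rw [hx, hy]

theorem inner_toL2 {f g : E N → ℂ} (hf : MemLp f 2 volume) (hg : MemLp g 2 volume) :
    inner ℂ (toL2 f) (toL2 g) = ∫ x, g x * (starRingEnd ℂ) (f x) := by
  rw [L2.inner_def]
  refine integral_congr_ae ?_
  filter_upwards [coeFn_toL2 hf, coeFn_toL2 hg] with x hx hy
  rw [hx, hy]
  rfl

variable {P : Type*} [NormedAddCommGroup P]

/-- Local domination, in the parameter, of a family of functions by a square integrable one. -/
def LocDominated {F : Type*} [NormedAddCommGroup F] (f : P × E N → F) : Prop :=
  ∀ σ₀, ∃ s ∈ nhds σ₀, ∃ b : E N → ℝ, MemLp b 2 volume ∧ ∀ σ ∈ s, ∀ x, ‖f (σ, x)‖ ≤ b x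

theorem LocDominated.memLp {f : P × E N → ℂ} (h : LocDominated f) (hf : Continuous f) (σ : P) :
    MemLp (fun x => f (σ, x)) 2 volume := by
  obtain ⟨s, hs, b, hb, hfb⟩ := h σ
  exact memLp_of_le (by fun_prop) hb fun x => hfb σ (mem_of_mem_nhds hs) x

theorem LocDominated.continuous_toL2 {f : P × E N → ℂ} (h : LocDominated f) (hf : Continuous f) :
    Continuous (fun σ => toL2 (fun x => f (σ, x))) := by
  refine continuous_iff_continuousAt.2 fun σ₀ => ?_
  obtain ⟨s, hs, b, hb, hfb⟩ := h σ₀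
  rw [ContinuousAt, tendsto_iff_norm_sub_tendsto_zero]
  have hsq : Filter.Tendsto (fun σ => ‖toL2 (fun x => f (σ, x)) - toL2 (fun x => f (σ₀, x))‖ ^ 2)
      (nhds σ₀) (nhds 0) := by
    have h1 : ∀ σ, ‖toL2 (fun x => f (σ, x)) - toL2 (fun x => f (σ₀, x))‖ ^ 2
        = ∫ x, ‖f (σ, x) - f (σ₀, x)‖ ^ 2 := by
      intro σ
      rw [← toL2_sub (h.memLp hf σ) (h.memLp hf σ₀)]
      exact norm_sq_toL2 ((h.memLp hf σ).sub (h.memLp hf σ₀))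
    simp only [h1]
    have h2 : (0 : ℝ) = ∫ _ : E N, (0 : ℝ) := by simp
    rw [h2]
    refine tendsto_integral_filter_of_dominated_convergence (fun x => (2 * b x) ^ 2) ?_ ?_ ?_ ?_
    · exact Filter.Eventually.of_forall fun σ => (by fun_prop : Continuous
        (fun x => ‖f (σ, x) - f (σ₀, x)‖ ^ 2)).aestronglyMeasurable
    · filter_upwards [hs] with σ hσ
      filter_upwards with x
      rw [norm_pow, norm_norm]
      refine pow_le_pow_left₀ (norm_nonneg _) ((norm_sub_le _ _).trans ?_) 2
      linarith [hfb σ hσ x, hfb σ₀ (mem_of_mem_nhds hs) x]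
    · exact (hb.const_mul 2).integrable_sq
    · filter_upwards with x
      have : Continuous (fun σ => ‖f (σ, x) - f (σ₀, x)‖ ^ 2) := by fun_prop
      simpa using this.tendsto σ₀
  have := hsq.sqrt
  simpa [Real.sqrt_sq (norm_nonneg _)] using this

theorem LocDominated.clm_apply {F F' : Type*} [NormedAddCommGroup F] [NormedSpace ℝ F]
    [NormedAddCommGroup F'] [NormedSpace ℝ F']
    {f : P × E N → F →L[ℝ] F'} (h : LocDominated f) (v : F) :
    LocDominated (fun z => f z v) := by
  intro σ₀
  obtain ⟨s, hs, b, hb, hfb⟩ := h σ₀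
  refine ⟨s, hs, fun x => ‖v‖ * b x, hb.const_mul _, fun σ hσ x => ?_⟩
  refine ((f (σ, x)).le_opNorm v).trans ?_
  rw [mul_comm]
  exact mul_le_mul_of_nonneg_left (hfb σ hσ x) (norm_nonneg _)

variable [NormedSpace ℝ P]

/-- Dominated convergence for the square of the normalised Taylor remainder: the mean value
inequality bounds the difference quotient by the majorant b of the derivative, and the linear term
is bounded by b as well, whence (2b)². The derivative is produced existentially because the
pointwise formula must first be shown to define a bounded linear map into L². -/
theorem hasFDerivAt_toL2 {f : P × E N → ℂ} (hf : ContDiff ℝ 1 f) (h0 : LocDominated f)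
    (h1 : LocDominated (fderiv ℝ f)) (σ₀ : P) :
    ∃ G' : P →L[ℝ] L2 N, (∀ h, G' h = toL2 (fun x => fderiv ℝ f (σ₀, x) (h, 0))) ∧
      HasFDerivAt (fun σ => toL2 (fun x => f (σ, x))) G' σ₀ := by
  obtain ⟨s, hs, b, hb, hfb⟩ := h1 σ₀
  obtain ⟨r, hr, hrs⟩ := Metric.mem_nhds_iff.1 hs
  have hfc : Continuous f := hf.continuous
  have hfd : Continuous (fderiv ℝ f) := hf.continuous_fderiv (by simp)
  have hle : ∀ σ x (h : P), ‖fderiv ℝ f (σ, x) (h, 0)‖ ≤ ‖fderiv ℝ f (σ, x)‖ * ‖h‖ := by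
    intro σ x h
    refine ((fderiv ℝ f (σ, x)).le_opNorm _).trans (le_of_eq ?_)
    simp [Prod.norm_def]
  have hc : ∀ h : P, Continuous (fun x => fderiv ℝ f (σ₀, x) (h, 0)) := fun h =>
    (hfd.comp (by fun_prop)).clm_apply continuous_const
  have hbd : ∀ (h : P) x, ‖fderiv ℝ f (σ₀, x) (h, 0)‖ ≤ ‖h‖ * b x := fun h x =>
    (hle _ _ _).trans (by
      rw [mul_comm]
      exact mul_le_mul_of_nonneg_left (hfb σ₀ (mem_of_mem_nhds hs) x) (norm_nonneg _))
  have hm : ∀ h : P, MemLp (fun x => fderiv ℝ f (σ₀, x) (h, 0)) 2 volume := fun h =>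
    memLp_of_le (hc h) (hb.const_mul ‖h‖) (hbd h)
  let A : P →ₗ[ℝ] L2 N :=
    { toFun := fun h => toL2 (fun x => fderiv ℝ f (σ₀, x) (h, 0))
      map_add' := fun h h' => by
        rw [← toL2_add (hm h) (hm h')]
        congr 1
        funext x
        rw [← map_add]; simp
      map_smul' := fun c h => by
        rw [RingHom.id_apply, ← toL2_smul c (hm h)]
        congr 1
        funext x
        rw [← map_smul]; simp }
  let G' : P →L[ℝ] L2 N := A.mkContinuous (Real.sqrt (∫ x, b x ^ 2)) fun h => by
    have := norm_toL2_le (hc h) (hb.const_mul ‖h‖) (hbd h)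
    simp only [mul_pow, integral_const_mul] at this
    rwa [Real.sqrt_mul (sq_nonneg _), Real.sqrt_sq (norm_nonneg _), mul_comm] at this
  refine ⟨G', fun h => rfl, ?_⟩
  rw [hasFDerivAt_iff_tendsto]
  have hder : ∀ σ x, HasFDerivAt (fun σ => f (σ, x))
      ((fderiv ℝ f (σ, x)).comp (ContinuousLinearMap.inl ℝ P (E N))) σ := fun σ x =>
    ((hf.differentiable (by simp)) (σ, x)).hasFDerivAt.comp σ (hasFDerivAt_prodMk_left σ x)
  have hmv : ∀ σ ∈ Metric.ball σ₀ r, ∀ x, ‖f (σ, x) - f (σ₀, x)‖ ≤ b x * ‖σ - σ₀‖ := by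
    intro σ hσ x
    refine (convex_ball σ₀ r).norm_image_sub_le_of_norm_hasFDerivWithin_le
      (fun τ hτ => (hder τ x).hasFDerivWithinAt) (fun τ hτ => ?_) (Metric.mem_ball_self hr) hσ
    refine ContinuousLinearMap.opNorm_le_bound _
      ((norm_nonneg _).trans (hfb σ₀ (mem_of_mem_nhds hs) x)) fun h => ?_
    exact (hle τ x h).trans (mul_le_mul_of_nonneg_right (hfb τ (hrs hτ) x) (norm_nonneg _))
  have hsq : Filter.Tendsto (fun σ => (‖σ - σ₀‖⁻¹ * ‖toL2 (fun x => f (σ, x))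
      - toL2 (fun x => f (σ₀, x)) - G' (σ - σ₀)‖) ^ 2) (nhds σ₀) (nhds 0) := by
    have h1 : ∀ σ, (‖σ - σ₀‖⁻¹ * ‖toL2 (fun x => f (σ, x))
        - toL2 (fun x => f (σ₀, x)) - G' (σ - σ₀)‖) ^ 2
        = ∫ x, (‖σ - σ₀‖⁻¹
          * ‖f (σ, x) - f (σ₀, x) - fderiv ℝ f (σ₀, x) (σ - σ₀, 0)‖) ^ 2 := by
      intro σ
      have e : G' (σ - σ₀) = toL2 (fun x => fderiv ℝ f (σ₀, x) (σ - σ₀, 0)) := rfl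
      have m1 : MemLp (fun x => f (σ, x) - f (σ₀, x)) 2 volume :=
        (h0.memLp hfc σ).sub (h0.memLp hfc σ₀)
      have m2 : MemLp (fun x => f (σ, x) - f (σ₀, x) - fderiv ℝ f (σ₀, x) (σ - σ₀, 0)) 2 volume :=
        m1.sub (hm _)
      rw [e, ← toL2_sub (h0.memLp hfc σ) (h0.memLp hfc σ₀), ← toL2_sub m1 (hm _), mul_pow,
        norm_sq_toL2 m2, ← integral_const_mul]
      simp only [mul_pow]
    simp only [h1]
    have h2 : (0 : ℝ) = ∫ _ : E N, (0 : ℝ) := by simp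
    rw [h2]
    refine tendsto_integral_filter_of_dominated_convergence (fun x => (2 * b x) ^ 2) ?_ ?_ ?_ ?_
    · refine Filter.Eventually.of_forall fun σ => Continuous.aestronglyMeasurable ?_
      have := hc (σ - σ₀)
      fun_prop
    · filter_upwards [Metric.ball_mem_nhds σ₀ hr] with σ hσ
      filter_upwards with x
      rw [norm_pow, Real.norm_of_nonneg (by positivity)]
      refine pow_le_pow_left₀ (by positivity) ?_ 2
      have h3 := hmv σ hσ x
      have h4 := hbd (σ - σ₀) x
      have hb0 : 0 ≤ b x := (norm_nonneg _).trans (hfb σ₀ (mem_of_mem_nhds hs) x)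
      have h5 : ‖f (σ, x) - f (σ₀, x) - fderiv ℝ f (σ₀, x) (σ - σ₀, 0)‖
          ≤ ‖σ - σ₀‖ * (2 * b x) := (norm_sub_le _ _).trans (by linarith)
      refine (mul_le_mul_of_nonneg_left h5 (by positivity)).trans ?_
      rw [← mul_assoc]
      exact mul_le_of_le_one_left (by positivity) inv_mul_le_one
    · exact (hb.const_mul 2).integrable_sq
    · filter_upwards with x
      have := (hasFDerivAt_iff_tendsto.1 (hder σ₀ x)).pow 2
      simpa using this
  have := hsq.sqrt
  simp only [Real.sqrt_zero] at this
  refine this.congr fun σ => ?_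
  rw [Real.sqrt_sq (by positivity)]

theorem fderiv_toL2 {f : P × E N → ℂ} (hf : ContDiff ℝ 1 f) (h0 : LocDominated f)
    (h1 : LocDominated (fderiv ℝ f)) (σ h : P) :
    fderiv ℝ (fun σ => toL2 (fun x => f (σ, x))) σ h
      = toL2 (fun x => fderiv ℝ f (σ, x) (h, 0)) := by
  obtain ⟨G', hG', hd⟩ := hasFDerivAt_toL2 hf h0 h1 σ
  rw [hd.fderiv, hG']

/-- With finitely many parameters it suffices that the derivative in each fixed direction is
continuous, and that derivative is again a locally dominated family. -/
theorem contDiff_one_toL2 [FiniteDimensional ℝ P] {f : P × E N → ℂ} (hf : ContDiff ℝ 1 f)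
    (h0 : LocDominated f) (h1 : LocDominated (fderiv ℝ f)) :
    ContDiff ℝ 1 (fun σ => toL2 (fun x => f (σ, x))) := by
  have e : (1 : WithTop ℕ∞) = 0 + 1 := by simp
  rw [e, contDiff_succ_iff_fderiv_apply]
  refine ⟨fun σ => ?_, by simp, fun h => ?_⟩
  · obtain ⟨G', -, hd⟩ := hasFDerivAt_toL2 hf h0 h1 σ
    exact hd.differentiableAt
  · simp only [fderiv_toL2 hf h0 h1]
    exact contDiff_zero.2 ((h1.clm_apply (h, (0 : E N))).continuous_toL2
      ((hf.continuous_fderiv (by simp)).clm_apply continuous_const))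

theorem fderiv_clm_apply_const {F F' D : Type*} [NormedAddCommGroup F] [NormedSpace ℝ F]
    [NormedAddCommGroup F'] [NormedSpace ℝ F'] [NormedAddCommGroup D] [NormedSpace ℝ D]
    {f : D → F →L[ℝ] F'} {z : D} (hf : DifferentiableAt ℝ f z) (v : F) :
    fderiv ℝ (fun z => f z v) z = (ContinuousLinearMap.apply ℝ F' v).comp (fderiv ℝ f z) :=
  ((ContinuousLinearMap.apply ℝ F' v).hasFDerivAt.comp z hf.hasFDerivAt).fderiv

theorem LocDominated.fderiv_clm_apply {f : P × E N → ℂ} (hf : ContDiff ℝ 2 f)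
    (h2 : LocDominated (fderiv ℝ (fderiv ℝ f))) (v : P × E N) :
    LocDominated (fderiv ℝ (fun z => fderiv ℝ f z v)) := by
  intro σ₀
  obtain ⟨s, hs, b, hb, hfb⟩ := h2 σ₀
  have hd : Differentiable ℝ (fderiv ℝ f) :=
    (hf.fderiv_right (m := 1) (by norm_num)).differentiable (by simp)
  refine ⟨s, hs, fun x => ‖v‖ * b x, hb.const_mul _, fun σ hσ x => ?_⟩
  rw [fderiv_clm_apply_const (hd _)]
  have hb0 : 0 ≤ b x := (norm_nonneg (fderiv ℝ (fderiv ℝ f) (σ, x))).trans (hfb σ hσ x)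
  refine ContinuousLinearMap.opNorm_le_bound _ (mul_nonneg (norm_nonneg _) hb0) fun w => ?_
  calc ‖fderiv ℝ (fderiv ℝ f) (σ, x) w v‖ ≤ ‖fderiv ℝ (fderiv ℝ f) (σ, x)‖ * ‖w‖ * ‖v‖ :=
        (fderiv ℝ (fderiv ℝ f) (σ, x)).le_opNorm₂ w v
    _ ≤ b x * ‖w‖ * ‖v‖ := by gcongr; exact hfb σ hσ x
    _ = _ := by ring

theorem contDiff_two_toL2 [FiniteDimensional ℝ P] {f : P × E N → ℂ} (hf : ContDiff ℝ 2 f)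
    (h0 : LocDominated f) (h1 : LocDominated (fderiv ℝ f))
    (h2 : LocDominated (fderiv ℝ (fderiv ℝ f))) :
    ContDiff ℝ 2 (fun σ => toL2 (fun x => f (σ, x))) := by
  have hf1 : ContDiff ℝ 1 f := hf.of_le (by norm_num)
  have e : (2 : WithTop ℕ∞) = 1 + 1 := by norm_num
  rw [e, contDiff_succ_iff_fderiv_apply]
  refine ⟨(contDiff_one_toL2 hf1 h0 h1).differentiable (by simp), by simp, fun h => ?_⟩
  simp only [fderiv_toL2 hf1 h0 h1]
  have hd : ContDiff ℝ 1 (fun z => fderiv ℝ f z (h, (0 : E N))) :=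
    (hf.fderiv_right (m := 1) (by norm_num)).clm_apply contDiff_const
  exact contDiff_one_toL2 hd (h1.clm_apply _) (.fderiv_clm_apply hf h2 _)

theorem fderiv_fderiv_toL2 [FiniteDimensional ℝ P] {f : P × E N → ℂ} (hf : ContDiff ℝ 2 f)
    (h0 : LocDominated f) (h1 : LocDominated (fderiv ℝ f))
    (h2 : LocDominated (fderiv ℝ (fderiv ℝ f))) (σ h h' : P) :
    fderiv ℝ (fderiv ℝ (fun σ => toL2 (fun x => f (σ, x)))) σ h h'
      = toL2 (fun x => fderiv ℝ (fderiv ℝ f) (σ, x) (h, 0) (h', 0)) := by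
  have hf1 : ContDiff ℝ 1 f := hf.of_le (by norm_num)
  have hG := contDiff_two_toL2 hf h0 h1 h2
  have hd : ContDiff ℝ 1 (fun z => fderiv ℝ f z (h', (0 : E N))) :=
    (hf.fderiv_right (m := 1) (by norm_num)).clm_apply contDiff_const
  have hdf : Differentiable ℝ (fderiv ℝ f) :=
    (hf.fderiv_right (m := 1) (by norm_num)).differentiable (by simp)
  have hdG : Differentiable ℝ (fderiv ℝ (fun σ => toL2 (fun x => f (σ, x)))) :=
    (hG.fderiv_right (m := 1) (by norm_num)).differentiable (by simp)
  have e1 := fderiv_clm_apply_const (hdG σ) h'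
  simp only [fderiv_toL2 hf1 h0 h1] at e1
  have e2 := fderiv_toL2 hd (h1.clm_apply _) (.fderiv_clm_apply hf h2 _) σ h
  rw [e1] at e2
  simp only [fderiv_clm_apply_const (hdf _)] at e2
  exact e2

end L2Tools

end NLSSoliton

namespace NLSSoliton

/-! ### Geometric bounds on two derivatives under products and composition -/

section DerivativeBounds

variable {Z F F' G : Type*} [NormedAddCommGroup Z] [NormedSpace ℝ Z] [NormedAddCommGroup F]
  [NormedSpace ℝ F] [NormedAddCommGroup F'] [NormedSpace ℝ F'] [NormedAddCommGroup G]
  [NormedSpace ℝ G]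

/-- Geometric bounds for the first two derivatives at a point. -/
def DerivBound (f : Z → F) (z : Z) (C D : ℝ) : Prop :=
  ∀ i, 1 ≤ i → i ≤ 2 → ‖iteratedFDeriv ℝ i f z‖ ≤ C * D ^ i

/-- Geometric bounds for a function and its first two derivatives at a point. -/
def JetBound (f : Z → F) (z : Z) (C D : ℝ) : Prop :=
  ∀ i, i ≤ 2 → ‖iteratedFDeriv ℝ i f z‖ ≤ C * D ^ i

theorem JetBound.derivBound {f : Z → F} {z : Z} {C D : ℝ} (h : JetBound f z C D) :
    DerivBound f z C D := fun i _ hi => h i hi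

theorem JetBound.mono {f : Z → F} {z : Z} {C D C' D' : ℝ} (h : JetBound f z C D) (hC : 0 ≤ C)
    (hD : 0 ≤ D) (hCC : C ≤ C') (hDD : D ≤ D') : JetBound f z C' D' := fun i hi =>
  (h i hi).trans (mul_le_mul hCC (pow_le_pow_left₀ hD hDD i) (by positivity) (hC.trans hCC))

theorem norm_iteratedFDeriv_two (f : Z → F) (z : Z) :
    ‖iteratedFDeriv ℝ 2 f z‖ = ‖fderiv ℝ (fderiv ℝ f) z‖ := by
  rw [← norm_iteratedFDeriv_fderiv, norm_iteratedFDeriv_one]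

theorem derivBound_clm (A : Z →L[ℝ] F) (z : Z) {C D : ℝ} (hC : 0 ≤ C) (hD : ‖A‖ ≤ C * D) :
    DerivBound A z C D := by
  intro i h1 h2
  interval_cases i
  · rw [norm_iteratedFDeriv_one, A.fderiv]; simpa using hD
  · have : fderiv ℝ (fderiv ℝ A) z = 0 := by
      have h : fderiv ℝ A = fun _ => A := funext fun z => A.fderiv
      rw [h]; simp
    rw [norm_iteratedFDeriv_two, this]
    exact (norm_zero (E := Z →L[ℝ] Z →L[ℝ] F)).trans_le (mul_nonneg hC (sq_nonneg _))

theorem jetBound_clm (A : Z →L[ℝ] F) (z : Z) {C D : ℝ} (h0 : ‖A z‖ ≤ C) (hD : ‖A‖ ≤ C * D) :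
    JetBound A z C D := by
  intro i h2
  rcases Nat.eq_zero_or_pos i with rfl | h
  · simpa using h0
  · exact derivBound_clm A z ((norm_nonneg _).trans h0) hD i h h2

theorem DerivBound.add {f g : Z → F} {z : Z} {C C' D : ℝ} (hf : ContDiff ℝ 2 f)
    (hg : ContDiff ℝ 2 g) (h : DerivBound f z C D) (h' : DerivBound g z C' D) :
    DerivBound (fun z => f z + g z) z (C + C') D := by
  intro i h1 h2
  have hi : (i : WithTop ℕ∞) ≤ 2 := by exact_mod_cast h2
  have e : iteratedFDeriv ℝ i (fun z => f z + g z) z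
      = iteratedFDeriv ℝ i f z + iteratedFDeriv ℝ i g z :=
    iteratedFDeriv_add_apply (hf.of_le hi).contDiffAt (hg.of_le hi).contDiffAt
  rw [e, add_mul]
  exact (norm_add_le _ _).trans (add_le_add (h i h1 h2) (h' i h1 h2))

/-- In Leibniz' rule all terms have the same size C C' D^i, and the binomial coefficients sum to
2^i; the geometric form C D^i is kept because it absorbs this factor into D. -/
theorem JetBound.bilinear (B : F →L[ℝ] F' →L[ℝ] G) (hB : ‖B‖ ≤ 1) {f : Z → F} {g : Z → F'}
    {z : Z} {C C' D : ℝ} (hf : ContDiff ℝ 2 f) (hg : ContDiff ℝ 2 g) (hC : 0 ≤ C) (hD : 0 ≤ D)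
    (h : JetBound f z C D) (h' : JetBound g z C' D) :
    JetBound (fun z => B (f z) (g z)) z (C * C') (2 * D) := by
  intro i hi
  have hi' : (i : WithTop ℕ∞) ≤ 2 := by exact_mod_cast hi
  refine (B.norm_iteratedFDeriv_le_of_bilinear_of_le_one hf hg z hi' hB).trans ?_
  have : C * C' * (2 * D) ^ i = ∑ j ∈ Finset.range (i + 1), (i.choose j : ℝ) * (C * C' * D ^ i) := by
    rw [← Finset.sum_mul, ← Nat.cast_sum, Nat.sum_range_choose, mul_pow]
    push_cast
    ring
  rw [this]
  refine Finset.sum_le_sum fun j hj => ?_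
  have hj' : j ≤ i := by simpa [Nat.lt_succ_iff] using hj
  have e : D ^ i = D ^ j * D ^ (i - j) := by rw [← pow_add]; congr 1; omega
  calc (i.choose j : ℝ) * ‖iteratedFDeriv ℝ j f z‖ * ‖iteratedFDeriv ℝ (i - j) g z‖
      ≤ (i.choose j : ℝ) * (C * D ^ j) * (C' * D ^ (i - j)) := by
        gcongr
        · exact h j (by omega)
        · exact h' (i - j) (by omega)
    _ = _ := by rw [e]; ring

/-- The Faà di Bruno bound, with i! ≤ 2; C' ≥ 1 gives C' ≤ C'^i. Of the inner map only derivatives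
of order at least one enter, so the unbounded variable θ in the phase is harmless. -/
theorem JetBound.comp {g : F → G} {f : Z → F} {z : Z} {C C' D : ℝ} (hg : ContDiff ℝ 2 g)
    (hf : ContDiff ℝ 2 f) (hC' : 1 ≤ C') (hD : 0 ≤ D)
    (h : ∀ i, i ≤ 2 → ‖iteratedFDeriv ℝ i g (f z)‖ ≤ C) (h' : DerivBound f z C' D) :
    JetBound (fun z => g (f z)) z (2 * C) (C' * D) := by
  intro i hi
  have hi' : (i : WithTop ℕ∞) ≤ 2 := by exact_mod_cast hi
  have hC : 0 ≤ C := (norm_nonneg _).trans (h 0 (by norm_num))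
  refine (norm_iteratedFDeriv_comp_le hg hf hi' z (C := C) (D := C' * D)
    (fun j hj => h j (hj.trans hi)) (fun j hj hj' => ?_)).trans ?_
  · refine (h' j hj (hj'.trans hi)).trans ?_
    rw [mul_pow]
    refine mul_le_mul_of_nonneg_right ?_ (by positivity)
    exact le_self_pow₀ hC' (by omega)
  · refine mul_le_mul_of_nonneg_right (mul_le_mul_of_nonneg_right ?_ hC) (by positivity)
    interval_cases i <;> simp [Nat.factorial]

end DerivativeBounds

/-! ### The rescaled soliton as a function of parameters and position -/

section Wave

/-- Lifted and rescaled soliton parameters `(b, v, θ, s)`, with `a = ε b`, `γ = θ mod 2π` and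
`μ = e^s`. -/
abbrev LParam (N : ℕ) : Type := E N × E N × ℝ × ℝ

variable {N : ℕ}

/-- The phase of a soliton. -/
noncomputable def phase (z : LParam N × E N) : ℝ :=
  inner ℝ ((1 / 2 : ℝ) • z.1.2.1) (z.2 - z.1.1) + z.1.2.2.1

/-- The modulus of a soliton. -/
noncomputable def ampl (α : ℝ) (Q : E N → ℝ) (z : LParam N × E N) : ℝ :=
  Real.exp (α * z.1.2.2.2) * Q (Real.exp (1 / 2 * z.1.2.2.2) • (z.2 - z.1.1))

/-- The rescaled soliton as a function of all parameters and of the space variable. -/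
noncomputable def wave (α : ℝ) (Q : E N → ℝ) (z : LParam N × E N) : ℂ :=
  ampl α Q z • Complex.exp ((phase z : ℂ) * Complex.I)

/-- The coordinate `v`. -/
noncomputable def vCLM (N : ℕ) : LParam N × E N →L[ℝ] E N :=
  (ContinuousLinearMap.fst ℝ _ _).comp ((ContinuousLinearMap.snd ℝ _ _).comp
    (ContinuousLinearMap.fst ℝ _ _))

/-- The coordinate `θ`. -/
noncomputable def θCLM (N : ℕ) : LParam N × E N →L[ℝ] ℝ :=
  (ContinuousLinearMap.fst ℝ _ _).comp ((ContinuousLinearMap.snd ℝ _ _).comp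
    ((ContinuousLinearMap.snd ℝ _ _).comp (ContinuousLinearMap.fst ℝ _ _)))

/-- The coordinate `s`. -/
noncomputable def sCLM (N : ℕ) : LParam N × E N →L[ℝ] ℝ :=
  (ContinuousLinearMap.snd ℝ _ _).comp ((ContinuousLinearMap.snd ℝ _ _).comp
    ((ContinuousLinearMap.snd ℝ _ _).comp (ContinuousLinearMap.fst ℝ _ _)))

/-- The relative position `y - b`. -/
noncomputable def wCLM (N : ℕ) : LParam N × E N →L[ℝ] E N :=
  ContinuousLinearMap.snd ℝ _ _ -
    (ContinuousLinearMap.fst ℝ _ _).comp (ContinuousLinearMap.fst ℝ _ _)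

theorem vCLM_apply (z : LParam N × E N) : vCLM N z = z.1.2.1 := rfl
theorem θCLM_apply (z : LParam N × E N) : θCLM N z = z.1.2.2.1 := rfl
theorem sCLM_apply (z : LParam N × E N) : sCLM N z = z.1.2.2.2 := rfl
theorem wCLM_apply (z : LParam N × E N) : wCLM N z = z.2 - z.1.1 := rfl

theorem norm_vCLM : ‖vCLM N‖ ≤ 1 :=
  ContinuousLinearMap.opNorm_le_bound _ zero_le_one fun z => by
    rw [one_mul, vCLM_apply]
    exact ((norm_fst_le _).trans (norm_snd_le _)).trans (norm_fst_le z)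

theorem norm_θCLM : ‖θCLM N‖ ≤ 1 :=
  ContinuousLinearMap.opNorm_le_bound _ zero_le_one fun z => by
    rw [one_mul, θCLM_apply]
    exact (((norm_fst_le _).trans (norm_snd_le _)).trans (norm_snd_le _)).trans (norm_fst_le z)

theorem norm_sCLM : ‖sCLM N‖ ≤ 1 :=
  ContinuousLinearMap.opNorm_le_bound _ zero_le_one fun z => by
    rw [one_mul, sCLM_apply]
    exact (((norm_snd_le _).trans (norm_snd_le _)).trans (norm_snd_le _)).trans (norm_fst_le z)

theorem norm_wCLM : ‖wCLM N‖ ≤ 2 :=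
  ContinuousLinearMap.opNorm_le_bound _ zero_le_two fun z => by
    rw [wCLM_apply]
    refine (norm_sub_le _ _).trans ?_
    linarith [norm_snd_le z, (norm_fst_le z.1).trans (norm_fst_le z)]

theorem contDiff_phase : ContDiff ℝ 2 (phase (N := N)) := by
  have h1 : ContDiff ℝ 2 (fun z => (1 / 2 : ℝ) • vCLM N z) :=
    ((1 / 2 : ℝ) • vCLM N).contDiff
  have h2 : ContDiff ℝ 2 (fun z => inner ℝ ((1 / 2 : ℝ) • vCLM N z) (wCLM N z)) :=
    h1.inner ℝ (wCLM N).contDiff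
  exact h2.add (θCLM N).contDiff

theorem contDiff_ampl {α : ℝ} {Q : E N → ℝ} (hQ : ContDiff ℝ 2 Q) : ContDiff ℝ 2 (ampl α Q) :=
  (contDiff_const.mul (sCLM N).contDiff).exp.mul (hQ.comp
    ((contDiff_const.mul (sCLM N).contDiff).exp.smul (wCLM N).contDiff))

theorem contDiff_expI : ContDiff ℝ 2 (fun t : ℝ => Complex.exp ((t : ℂ) * Complex.I)) :=
  ((Complex.ofRealCLM.contDiff).mul contDiff_const).cexp

theorem contDiff_wave {α : ℝ} {Q : E N → ℝ} (hQ : ContDiff ℝ 2 Q) : ContDiff ℝ 2 (wave α Q) :=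
  (contDiff_ampl hQ).smul (contDiff_expI.comp contDiff_phase)

theorem hasDerivAt_expI (t : ℝ) : HasDerivAt (fun t : ℝ => Complex.exp ((t : ℂ) * Complex.I))
    (Complex.exp ((t : ℂ) * Complex.I) * Complex.I) t := by
  have h := ((Complex.ofRealCLM.hasDerivAt (x := t)).mul_const Complex.I).cexp
  simpa using h

theorem norm_iteratedFDeriv_expI (t : ℝ) (i : ℕ) (_ : i ≤ 2) :
    ‖iteratedFDeriv ℝ i (fun t : ℝ => Complex.exp ((t : ℂ) * Complex.I)) t‖ ≤ 1 := by
  have h : ∀ i : ℕ, iteratedDeriv i (fun t : ℝ => Complex.exp ((t : ℂ) * Complex.I))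
      = fun t : ℝ => Complex.exp ((t : ℂ) * Complex.I) * Complex.I ^ i := by
    intro i
    induction i with
    | zero => simp
    | succ n ih =>
      rw [iteratedDeriv_succ, ih]
      funext t
      rw [((hasDerivAt_expI t).mul_const _).deriv, pow_succ]
      ring
  rw [norm_iteratedFDeriv_eq_norm_iteratedDeriv, h]
  simp [Complex.norm_exp_ofReal_mul_I]

theorem norm_iteratedFDeriv_rexp (t : ℝ) (i : ℕ) :
    ‖iteratedFDeriv ℝ i Real.exp t‖ = Real.exp t := by
  rw [norm_iteratedFDeriv_eq_norm_iteratedDeriv, iteratedDeriv_eq_iterate, Real.iter_deriv_exp]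
  simp

theorem norm_iteratedFDeriv_of_bounds {Q : E N → ℝ} {x : E N} {C : ℝ} (h0 : ‖Q x‖ ≤ C)
    (h1 : ‖fderiv ℝ Q x‖ ≤ C) (h2 : ‖fderiv ℝ (fderiv ℝ Q) x‖ ≤ C) (i : ℕ) (hi : i ≤ 2) :
    ‖iteratedFDeriv ℝ i Q x‖ ≤ C := by
  interval_cases i
  · simpa using h0
  · rwa [norm_iteratedFDeriv_one]
  · rwa [norm_iteratedFDeriv_two]

/-- A derivative can produce a factor of size ‖y - b‖, from the phase ½ v·(y-b) + θ or from the
dilation e^{s/2}(y-b), while Q and its derivatives are exponentially small there. The 8 comes from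
three compositions (phase factor, e^{αs}, Q), the leading 4 from two products; the summands in the
bracket dominate the growth rates of the separate factors. Neither b nor θ needs to be bounded. -/
theorem jetBound_wave {α ρ A : ℝ} {Q : E N → ℝ} (hQ : ContDiff ℝ 2 Q) (hρ : 0 ≤ ρ) (hA : 0 ≤ A)
    (hdec : ∀ x, ‖Q x‖ ≤ A * Real.exp (-(1 / 2 * ‖x‖)) ∧
      ‖fderiv ℝ Q x‖ ≤ A * Real.exp (-(1 / 2 * ‖x‖)) ∧
      ‖fderiv ℝ (fderiv ℝ Q) x‖ ≤ A * Real.exp (-(1 / 2 * ‖x‖)))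
    {z : LParam N × E N} (hv : ‖z.1.2.1‖ ≤ ρ) (hs : |z.1.2.2.2| ≤ ρ) :
    JetBound (wave α Q) z
      (8 * Real.exp (|α| * ρ) * A
        * Real.exp (-(1 / 2 * Real.exp (-(1 / 2 * ρ)) * ‖z.2 - z.1.1‖)))
      (4 * (16 * Real.exp (1 / 2 * ρ) + |α| + 4 * (ρ + 1) + 3) * (1 + ‖z.2 - z.1.1‖)) := by
  set T := 1 + ‖z.2 - z.1.1‖ with hT
  have hT1 : 1 ≤ T := by rw [hT]; linarith [norm_nonneg (z.2 - z.1.1)]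
  have hT0 : 0 ≤ T := by linarith
  set D := (16 * Real.exp (1 / 2 * ρ) + |α| + 4 * (ρ + 1) + 3) * T with hD
  have hw : JetBound (wCLM N) z (2 * T) 1 := jetBound_clm _ _
    (by rw [wCLM_apply]; linarith [norm_nonneg (z.2 - z.1.1)])
    (by linarith [norm_wCLM (N := N)])
  -- the phase factor
  have hvb : JetBound (fun z => (1 / 2 : ℝ) • vCLM N z) z (ρ + 1) 1 := by
    refine jetBound_clm ((1 / 2 : ℝ) • vCLM N) z ?_ ?_
    · rw [smul_apply, norm_smul, vCLM_apply]
      norm_num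
      linarith
    · rw [norm_smul]
      norm_num
      linarith [norm_vCLM (N := N)]
  have hph : DerivBound (phase (N := N)) z (2 * (ρ + 1) * T + 1) 2 := by
    have h1 := JetBound.bilinear (innerSL ℝ (E := E N)) (norm_innerSL_le ℝ)
      (by fun_prop) (wCLM N).contDiff (by linarith) zero_le_one hvb hw
    have h2 := derivBound_clm (θCLM N) z (C := 1) (D := 2) (by norm_num)
      (by linarith [norm_θCLM (N := N)])
    have h3 := DerivBound.add (f := fun z => innerSL ℝ ((1 / 2 : ℝ) • vCLM N z) (wCLM N z))
      (g := θCLM N) (C' := 1) ?_ (θCLM N).contDiff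
      (by rw [mul_one] at h1; exact h1.derivBound) h2
    · have e : (ρ + 1) * (2 * T) + 1 = 2 * (ρ + 1) * T + 1 := by ring
      rw [e] at h3
      exact h3
    · exact (ContDiff.inner ℝ (by fun_prop) (wCLM N).contDiff)
  have hexp := JetBound.comp (C := 1) contDiff_expI contDiff_phase
    (by nlinarith) zero_le_two (fun i hi => norm_iteratedFDeriv_expI _ i hi) hph
  -- the amplitude
  have hes : ∀ c : ℝ, JetBound (fun z => Real.exp (c * sCLM N z)) z
      (2 * Real.exp (|c| * ρ)) (1 * (|c| + 1)) := by
    intro c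
    refine JetBound.comp (g := Real.exp) (f := fun z => c * sCLM N z) Real.contDiff_exp
      (contDiff_const.mul (sCLM N).contDiff) le_rfl (by positivity)
      (fun i hi => ?_) (derivBound_clm (c • sCLM N) z zero_le_one ?_)
    · rw [norm_iteratedFDeriv_rexp, sCLM_apply]
      refine Real.exp_le_exp.2 ((le_abs_self _).trans ?_)
      rw [abs_mul]
      gcongr
    · rw [norm_smul, Real.norm_eq_abs, one_mul]
      nlinarith [norm_sCLM (N := N), abs_nonneg c, norm_nonneg (sCLM N)]
  have hc1 : ∀ c : ℝ, ContDiff ℝ 2 (fun z => Real.exp (c * sCLM N z)) := fun c =>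
    (contDiff_const.mul (sCLM N).contDiff).exp
  have hm : JetBound (fun z => Real.exp (1 / 2 * sCLM N z) • wCLM N z) z
      (2 * Real.exp (1 / 2 * ρ) * (2 * T)) (2 * 2) := by
    refine JetBound.bilinear (ContinuousLinearMap.lsmul ℝ ℝ) ContinuousLinearMap.opNorm_lsmul_le
      (hc1 _) (wCLM N).contDiff (by positivity) (by norm_num)
      ((hes (1 / 2)).mono (by positivity) (by positivity) ?_ ?_)
      (hw.mono (by linarith) zero_le_one le_rfl (by norm_num))
    · rw [abs_of_pos (by norm_num : (0 : ℝ) < 1 / 2)]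
    · rw [abs_of_pos (by norm_num : (0 : ℝ) < 1 / 2)]; norm_num
  have he1 : 1 ≤ Real.exp (1 / 2 * ρ) := Real.one_le_exp (by positivity)
  have hmc : ContDiff ℝ 2 (fun z => Real.exp (1 / 2 * sCLM N z) • wCLM N z) :=
    (hc1 _).smul (wCLM N).contDiff
  have hQm := JetBound.comp (g := Q)
    (C := A * Real.exp (-(1 / 2 * Real.exp (-(1 / 2 * ρ)) * ‖z.2 - z.1.1‖))) hQ hmc
    (by nlinarith) (by norm_num) (fun i hi => ?_) hm.derivBound
  · have hamp := JetBound.bilinear (ContinuousLinearMap.mul ℝ ℝ)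
      (ContinuousLinearMap.opNorm_mul_le ℝ ℝ) (hc1 α)
      (hQ.comp hmc) (by positivity) (by positivity : 0 ≤ D)
      ((hes α).mono (by positivity) (by positivity) le_rfl ?_)
      (hQm.mono (by positivity) (by positivity) le_rfl ?_)
    · have hfin := JetBound.bilinear (ContinuousLinearMap.lsmul ℝ ℝ (E := ℂ))
        ContinuousLinearMap.opNorm_lsmul_le (contDiff_ampl hQ) (contDiff_expI.comp contDiff_phase)
        (by positivity) (by positivity) hamp
        (hexp.mono (by positivity) (by positivity) le_rfl ?_)
      · refine hfin.mono (by positivity) (by positivity) (le_of_eq ?_) (le_of_eq ?_)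
        · ring
        · rw [hD]; ring
      · rw [hD]
        nlinarith [abs_nonneg α, Real.exp_pos (1 / 2 * ρ), mul_nonneg (abs_nonneg α) hT0,
          mul_nonneg (Real.exp_pos (1 / 2 * ρ)).le hT0, mul_nonneg hρ hT0]
    · rw [hD]
      nlinarith [abs_nonneg α, Real.exp_pos (1 / 2 * ρ), mul_nonneg (abs_nonneg α) hT0,
          mul_nonneg (Real.exp_pos (1 / 2 * ρ)).le hT0, mul_nonneg hρ hT0,
          mul_le_mul_of_nonneg_left hT1 (abs_nonneg α)]
    · rw [hD]
      nlinarith [abs_nonneg α, Real.exp_pos (1 / 2 * ρ), mul_nonneg (abs_nonneg α) hT0,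
          mul_nonneg (Real.exp_pos (1 / 2 * ρ)).le hT0, mul_nonneg hρ hT0]
  -- On the slab e^{s/2} ≥ e^{-ρ/2}, which fixes a common decay rate.
  · have hle : A * Real.exp (-(1 / 2 * ‖Real.exp (1 / 2 * sCLM N z) • wCLM N z‖))
        ≤ A * Real.exp (-(1 / 2 * Real.exp (-(1 / 2 * ρ)) * ‖z.2 - z.1.1‖)) := by
      refine mul_le_mul_of_nonneg_left (Real.exp_le_exp.2 (neg_le_neg ?_)) hA
      rw [norm_smul, Real.norm_of_nonneg (Real.exp_pos _).le, wCLM_apply, sCLM_apply, mul_assoc]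
      have : Real.exp (-(1 / 2 * ρ)) ≤ Real.exp (1 / 2 * z.1.2.2.2) :=
        Real.exp_le_exp.2 (by linarith [(abs_le.1 hs).1])
      gcongr
    obtain ⟨h0, h1, h2⟩ := hdec (Real.exp (1 / 2 * sCLM N z) • wCLM N z)
    exact norm_iteratedFDeriv_of_bounds (h0.trans hle) (h1.trans hle) (h2.trans hle) i hi

end Wave

end NLSSoliton

namespace NLSSoliton

/-! ### Polynomial weights and the overlap of distant functions -/

section Bracket

variable {N : ℕ}

/-- A rapidly decaying weight. -/
noncomputable def bracket (n : ℕ) (w : E N) : ℝ := ((1 + ‖w‖) ^ n)⁻¹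

theorem bracket_pos (n : ℕ) (w : E N) : 0 < bracket n w := by unfold bracket; positivity

theorem continuous_bracket (n : ℕ) : Continuous (bracket (N := N) n) := by
  unfold bracket
  exact Continuous.inv₀ (by fun_prop) fun w => by positivity

theorem bracket_anti {n m : ℕ} (h : n ≤ m) (w : E N) : bracket m w ≤ bracket n w := by
  unfold bracket
  gcongr
  linarith [norm_nonneg w]

theorem bracket_mul (n m : ℕ) (w : E N) : bracket n w * bracket m w = bracket (n + m) w := by
  unfold bracket
  rw [pow_add, mul_inv]

theorem norm_mul_bracket_le (n : ℕ) (w : E N) : ‖w‖ * bracket (n + 1) w ≤ bracket n w := by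
  unfold bracket
  rw [pow_succ, mul_inv]
  have h : ‖w‖ * (1 + ‖w‖)⁻¹ ≤ 1 := by
    rw [← div_eq_mul_inv, div_le_one (by positivity)]; linarith
  calc ‖w‖ * (((1 + ‖w‖) ^ n)⁻¹ * (1 + ‖w‖)⁻¹) = ((1 + ‖w‖) ^ n)⁻¹ * (‖w‖ * (1 + ‖w‖)⁻¹) := by ring
    _ ≤ ((1 + ‖w‖) ^ n)⁻¹ * 1 := by gcongr
    _ = _ := by ring

theorem integrable_bracket {n : ℕ} (hn : N < n) : Integrable (bracket (N := N) n) := by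
  have h := integrable_one_add_norm (E := E N) (μ := volume) (r := n)
    (by simpa using hn)
  refine h.congr (Filter.Eventually.of_forall fun w => ?_)
  simp only [bracket]
  rw [Real.rpow_neg (by positivity), Real.rpow_natCast]

theorem memLp_bracket {n : ℕ} (hn : N < n) : MemLp (bracket (N := N) n) 2 volume := by
  refine (memLp_two_iff_integrable_sq (continuous_bracket n).aestronglyMeasurable).2 ?_
  simp only [sq, bracket_mul]
  exact integrable_bracket (by omega)

theorem bracket_sub_le (n : ℕ) (w b : E N) : bracket n (w - b) ≤ (1 + ‖b‖) ^ n * bracket n w := by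
  unfold bracket
  rw [← div_eq_mul_inv, le_div_iff₀ (by positivity), inv_mul_le_iff₀ (by positivity), ← mul_pow]
  refine pow_le_pow_left₀ (by positivity) ?_ n
  have : ‖w‖ ≤ ‖w - b‖ + ‖b‖ := by simpa using norm_add_le (w - b) b
  nlinarith [mul_nonneg (norm_nonneg (w - b)) (norm_nonneg b)]

/-- Of the N + 2 powers in each weight, one is spent on (1+‖y-b‖)(1+‖y-b'‖) ≥ 1+‖b-b'‖, and the
other N + 1 on integrability after u u' ≤ (u² + u'²)/2. First-order decay in the separation is all
that is needed later. -/
theorem norm_inner_toL2_le {f g : E N → ℂ} (hf : Continuous f) (hg : Continuous g) {C C' : ℝ}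
    (hC : 0 ≤ C) {b b' : E N} (hfb : ∀ y, ‖f y‖ ≤ C * bracket (N + 2) (y - b))
    (hgb : ∀ y, ‖g y‖ ≤ C' * bracket (N + 2) (y - b')) :
    ‖inner ℂ (toL2 f) (toL2 g)‖
      ≤ C * C' * (∫ y : E N, bracket (2 * (N + 1)) y) * (1 + ‖b - b'‖)⁻¹ := by
  have hC' : 0 ≤ C' := nonneg_of_mul_nonneg_left ((norm_nonneg _).trans (hgb 0)) (bracket_pos _ _)
  have hm : ∀ b : E N, MemLp (fun y => bracket (N + 2) (y - b)) 2 volume := fun b =>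
    (memLp_bracket (by omega)).comp_measurePreserving (measurePreserving_sub_right volume b)
  have mf := memLp_of_le hf ((hm b).const_mul C) hfb
  have mg := memLp_of_le hg ((hm b').const_mul C') hgb
  have hi : Integrable (bracket (N := N) (2 * (N + 1))) := integrable_bracket (by omega)
  rw [inner_toL2 mf mg]
  have hpt : ∀ y, ‖g y * (starRingEnd ℂ) (f y)‖ ≤ C * C' * (1 + ‖b - b'‖)⁻¹ / 2 *
      (bracket (2 * (N + 1)) (y - b) + bracket (2 * (N + 1)) (y - b')) := by
    intro y
    rw [norm_mul, RCLike.norm_conj]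
    set u := bracket (N + 1) (y - b) with hu
    set u' := bracket (N + 1) (y - b') with hu'
    have h1 : bracket (N + 2) (y - b) * bracket (N + 2) (y - b') ≤ (1 + ‖b - b'‖)⁻¹ * (u * u') := by
      have e : ∀ w : E N, bracket (N + 2) w = bracket (N + 1) w * bracket 1 w := fun w => by
        rw [bracket_mul]
      rw [e, e]
      have h2 : bracket 1 (y - b) * bracket 1 (y - b') ≤ (1 + ‖b - b'‖)⁻¹ := by
        unfold bracket
        rw [pow_one, pow_one, ← mul_inv]
        refine inv_anti₀ (by positivity) ?_
        have : ‖b - b'‖ ≤ ‖y - b'‖ + ‖y - b‖ := by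
          have h := norm_sub_le (y - b') (y - b)
          rwa [sub_sub_sub_cancel_left] at h
        nlinarith [mul_nonneg (norm_nonneg (y - b)) (norm_nonneg (y - b'))]
      have hp := mul_pos (bracket_pos (N + 1) (y - b)) (bracket_pos (N + 1) (y - b'))
      calc _ = u * u' * (bracket 1 (y - b) * bracket 1 (y - b')) := by rw [hu, hu']; ring
        _ ≤ u * u' * (1 + ‖b - b'‖)⁻¹ := by gcongr
        _ = _ := by ring
    have e2 : ∀ w : E N, bracket (2 * (N + 1)) w = bracket (N + 1) w ^ 2 := fun w => by
      rw [sq, bracket_mul]; congr 1; ring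
    rw [e2, e2, ← hu, ← hu']
    have h3 : u * u' ≤ (u ^ 2 + u' ^ 2) / 2 := by nlinarith [sq_nonneg (u - u')]
    calc ‖g y‖ * ‖f y‖ ≤ (C' * bracket (N + 2) (y - b')) * (C * bracket (N + 2) (y - b)) :=
          mul_le_mul (hgb y) (hfb y) (norm_nonneg _) (mul_nonneg hC' (bracket_pos _ _).le)
      _ = C * C' * (bracket (N + 2) (y - b) * bracket (N + 2) (y - b')) := by ring
      _ ≤ C * C' * ((1 + ‖b - b'‖)⁻¹ * ((u ^ 2 + u' ^ 2) / 2)) := by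
          refine mul_le_mul_of_nonneg_left (h1.trans ?_) (mul_nonneg hC hC')
          exact mul_le_mul_of_nonneg_left h3 (by positivity)
      _ = _ := by ring
  have hs : ∀ b : E N, ∫ y, bracket (2 * (N + 1)) (y - b) = ∫ y : E N, bracket (2 * (N + 1)) y :=
    fun b => integral_sub_right_eq_self (bracket (N := N) (2 * (N + 1))) b
  refine (norm_integral_le_of_norm_le (((hi.comp_sub_right b).add (hi.comp_sub_right b')).const_mul
    (C * C' * (1 + ‖b - b'‖)⁻¹ / 2)) (Filter.Eventually.of_forall hpt)).trans (le_of_eq ?_)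
  rw [integral_const_mul]
  have h := integral_add (hi.comp_sub_right b) (hi.comp_sub_right b')
  rw [hs, hs] at h
  refine (congrArg (fun t => C * C' * (1 + ‖b - b'‖)⁻¹ / 2 * t) h).trans ?_
  ring

end Bracket

/-! ### The soliton map into L²: smoothness and uniform bounds -/

section SolitonMap

variable {N : ℕ} {α ρ : ℝ} {Q : E N → ℝ}

/-- A `C²` function that decays exponentially together with its first two derivatives. -/
structure IsDecaying (Q : E N → ℝ) : Prop where
  contDiff : ContDiff ℝ 2 Q
  decay : ∃ A, 0 ≤ A ∧ ∀ x, ‖Q x‖ ≤ A * Real.exp (-(1 / 2 * ‖x‖)) ∧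
      ‖fderiv ℝ Q x‖ ≤ A * Real.exp (-(1 / 2 * ‖x‖)) ∧
      ‖fderiv ℝ (fderiv ℝ Q) x‖ ≤ A * Real.exp (-(1 / 2 * ‖x‖))

theorem IsGroundState.isDecaying {p lam : ℝ} (hN : 1 ≤ N) (hp : 1 < p) (hlam : 0 < lam)
    (hQ : IsGroundState p lam 1 1 Q) : IsDecaying Q :=
  ⟨hQ.contDiff, hQ.exists_exp_decay hN hp hlam⟩

theorem pow_mul_exp_le_bracket {c : ℝ} (hc : 0 < c) (n : ℕ) : ∃ C, 0 ≤ C ∧ ∀ w : E N,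
    (1 + ‖w‖) ^ 2 * Real.exp (-(c * ‖w‖)) ≤ C * bracket n w := by
  refine ⟨(n + 2).factorial * (c ^ (n + 2))⁻¹ * Real.exp c, by positivity, fun w => ?_⟩
  have h := Real.pow_div_factorial_le_exp (x := c * (1 + ‖w‖)) (by positivity) (n + 2)
  rw [div_le_iff₀ (by positivity), mul_pow] at h
  unfold bracket
  rw [← div_eq_mul_inv _ ((1 + ‖w‖) ^ n), le_div_iff₀ (by positivity)]
  have e : (1 + ‖w‖) ^ 2 * Real.exp (-(c * ‖w‖)) * (1 + ‖w‖) ^ n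
      = (c ^ (n + 2) * (1 + ‖w‖) ^ (n + 2)) * ((c ^ (n + 2))⁻¹ * Real.exp (-(c * ‖w‖))) := by
    rw [pow_add (1 + ‖w‖)]; field_simp
  rw [e]
  have hexp : Real.exp (c * (1 + ‖w‖)) * Real.exp (-(c * ‖w‖)) = Real.exp c := by
    rw [← Real.exp_add]; congr 1; ring
  calc _ ≤ (Real.exp (c * (1 + ‖w‖)) * ((n + 2).factorial : ℝ))
        * ((c ^ (n + 2))⁻¹ * Real.exp (-(c * ‖w‖))) := by gcongr
    _ = (n + 2).factorial * (c ^ (n + 2))⁻¹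
        * (Real.exp (c * (1 + ‖w‖)) * Real.exp (-(c * ‖w‖))) := by ring
    _ = _ := by rw [hexp]

/-- The exponential absorbs the polynomial growth in `jetBound_wave`; the power N + 2 is the one
that `norm_inner_toL2_le` consumes. -/
theorem IsDecaying.wave_bound (hQ : IsDecaying Q) (α : ℝ) (hρ : 0 ≤ ρ) :
    ∃ C, 0 ≤ C ∧ ∀ z : LParam N × E N, ‖z.1.2.1‖ ≤ ρ → |z.1.2.2.2| ≤ ρ →
      ‖wave α Q z‖ ≤ C * bracket (N + 2) (z.2 - z.1.1) ∧
      ‖fderiv ℝ (wave α Q) z‖ ≤ C * bracket (N + 2) (z.2 - z.1.1) ∧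
      ‖fderiv ℝ (fderiv ℝ (wave α Q)) z‖ ≤ C * bracket (N + 2) (z.2 - z.1.1) := by
  obtain ⟨A, hA, hdec⟩ := hQ.decay
  set c := 1 / 2 * Real.exp (-(1 / 2 * ρ)) with hc
  obtain ⟨B, hB, hBd⟩ := pow_mul_exp_le_bracket (N := N) (c := c) (by positivity) (N + 2)
  set D := 4 * (16 * Real.exp (1 / 2 * ρ) + |α| + 4 * (ρ + 1) + 3) with hD
  have hD1 : 1 ≤ D := by
    rw [hD]; nlinarith [Real.exp_pos (1 / 2 * ρ), abs_nonneg α]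
  refine ⟨8 * Real.exp (|α| * ρ) * A * D ^ 2 * B, by positivity, fun z hv hs => ?_⟩
  have hj := jetBound_wave (α := α) hQ.contDiff hρ hA hdec hv hs
  have key : ∀ i, i ≤ 2 → ‖iteratedFDeriv ℝ i (wave α Q) z‖
      ≤ 8 * Real.exp (|α| * ρ) * A * D ^ 2 * B * bracket (N + 2) (z.2 - z.1.1) := by
    intro i hi
    refine (hj i hi).trans ?_
    have h1 : (D * (1 + ‖z.2 - z.1.1‖)) ^ i ≤ (D * (1 + ‖z.2 - z.1.1‖)) ^ 2 :=
      pow_le_pow_right₀ (by nlinarith [norm_nonneg (z.2 - z.1.1)]) hi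
    have h2 := hBd (z.2 - z.1.1)
    calc _ ≤ 8 * Real.exp (|α| * ρ) * A * Real.exp (-(c * ‖z.2 - z.1.1‖))
            * (D * (1 + ‖z.2 - z.1.1‖)) ^ 2 := by gcongr
      _ = 8 * Real.exp (|α| * ρ) * A * D ^ 2
            * ((1 + ‖z.2 - z.1.1‖) ^ 2 * Real.exp (-(c * ‖z.2 - z.1.1‖))) := by ring
      _ ≤ 8 * Real.exp (|α| * ρ) * A * D ^ 2 * (B * bracket (N + 2) (z.2 - z.1.1)) := by gcongr
      _ = _ := by ring
  refine ⟨?_, ?_, ?_⟩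
  · simpa using key 0 (by norm_num)
  · simpa only [norm_iteratedFDeriv_one] using key 1 (by norm_num)
  · simpa only [norm_iteratedFDeriv_two] using key 2 (by norm_num)

/-- Parameters within distance 1 of σ₀ lie in the slab of size ‖σ₀‖ + 1, and recentring the weight
from b to the origin costs only (1 + ‖b‖)^{N+2}. -/
theorem locDominated_of_bracket {F : Type*} [NormedAddCommGroup F] {f : LParam N × E N → F}
    (h : ∀ ρ, 0 ≤ ρ → ∃ C, 0 ≤ C ∧ ∀ z : LParam N × E N, ‖z.1.2.1‖ ≤ ρ → |z.1.2.2.2| ≤ ρ →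
      ‖f z‖ ≤ C * bracket (N + 2) (z.2 - z.1.1)) : LocDominated f := by
  intro σ₀
  obtain ⟨C, hC, hb⟩ := h (‖σ₀‖ + 1) (by positivity)
  refine ⟨Metric.ball σ₀ 1, Metric.ball_mem_nhds _ one_pos,
    fun y => C * (1 + (‖σ₀‖ + 1)) ^ (N + 2) * bracket (N + 2) y,
    (memLp_bracket (by omega)).const_mul _, fun σ hσ y => ?_⟩
  have hσ' : ‖σ‖ ≤ ‖σ₀‖ + 1 := by
    have h1 : ‖σ - σ₀‖ < 1 := by simpa [dist_eq_norm] using hσ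
    have h2 := norm_add_le (σ - σ₀) σ₀
    rw [sub_add_cancel] at h2
    linarith
  have h1 : ‖σ.1‖ ≤ ‖σ‖ := norm_fst_le σ
  have h2 : ‖σ.2.1‖ ≤ ‖σ‖ := (norm_fst_le σ.2).trans (norm_snd_le σ)
  have h3 : |σ.2.2.2| ≤ ‖σ‖ := ((norm_snd_le σ.2.2).trans (norm_snd_le σ.2)).trans (norm_snd_le σ)
  refine (hb (σ, y) (h2.trans hσ') (h3.trans hσ')).trans ?_
  simp only [mul_assoc]
  refine mul_le_mul_of_nonneg_left ((bracket_sub_le _ _ _).trans ?_) hC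
  refine mul_le_mul_of_nonneg_right (pow_le_pow_left₀ (by positivity) ?_ _) (bracket_pos _ _).le
  linarith

theorem IsDecaying.locDominated (hQ : IsDecaying Q) (α : ℝ) : LocDominated (wave α Q) :=
  locDominated_of_bracket fun _ hρ => (hQ.wave_bound α hρ).imp fun _ h =>
    ⟨h.1, fun z hv hs => (h.2 z hv hs).1⟩

theorem IsDecaying.locDominated_fderiv (hQ : IsDecaying Q) (α : ℝ) :
    LocDominated (fderiv ℝ (wave α Q)) :=
  locDominated_of_bracket fun _ hρ => (hQ.wave_bound α hρ).imp fun _ h =>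
    ⟨h.1, fun z hv hs => (h.2 z hv hs).2.1⟩

theorem IsDecaying.locDominated_fderiv_fderiv (hQ : IsDecaying Q) (α : ℝ) :
    LocDominated (fderiv ℝ (fderiv ℝ (wave α Q))) :=
  locDominated_of_bracket fun _ hρ => (hQ.wave_bound α hρ).imp fun _ h =>
    ⟨h.1, fun z hv hs => (h.2 z hv hs).2.2⟩

/-- The rescaled soliton as an element of `L²`. -/
noncomputable def solMap (α : ℝ) (Q : E N → ℝ) (σ : LParam N) : L2 N :=
  toL2 (fun y => wave α Q (σ, y))

variable (hQ : IsDecaying Q)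
include hQ

theorem IsDecaying.contDiff_solMap (α : ℝ) : ContDiff ℝ 2 (solMap α Q) :=
  contDiff_two_toL2 (contDiff_wave hQ.contDiff) (hQ.locDominated α) (hQ.locDominated_fderiv α)
    (hQ.locDominated_fderiv_fderiv α)

theorem IsDecaying.continuous_wave (α : ℝ) : Continuous (wave α Q) :=
  (contDiff_wave hQ.contDiff).continuous

theorem IsDecaying.continuous_fderiv_wave (α : ℝ) : Continuous (fderiv ℝ (wave α Q)) :=
  (contDiff_wave hQ.contDiff).continuous_fderiv (by simp)

theorem IsDecaying.memLp_wave (α : ℝ) (σ : LParam N) :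
    MemLp (fun y => wave α Q (σ, y)) 2 volume :=
  (hQ.locDominated α).memLp (hQ.continuous_wave α) σ

theorem IsDecaying.continuous_fderiv_wave_apply (α : ℝ) (σ : LParam N) (h : LParam N × E N) :
    Continuous (fun y => fderiv ℝ (wave α Q) (σ, y) h) :=
  ((hQ.continuous_fderiv_wave α).comp (by fun_prop)).clm_apply continuous_const

theorem IsDecaying.memLp_fderiv_wave (α : ℝ) (σ : LParam N) (h : LParam N × E N) :
    MemLp (fun y => fderiv ℝ (wave α Q) (σ, y) h) 2 volume :=
  ((hQ.locDominated_fderiv α).clm_apply h).memLp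
    ((hQ.continuous_fderiv_wave α).clm_apply continuous_const) σ

theorem IsDecaying.fderiv_solMap (α : ℝ) (σ h : LParam N) :
    fderiv ℝ (solMap α Q) σ h = toL2 (fun y => fderiv ℝ (wave α Q) (σ, y) (h, 0)) :=
  fderiv_toL2 ((contDiff_wave hQ.contDiff).of_le (by norm_num)) (hQ.locDominated α)
    (hQ.locDominated_fderiv α) σ h

theorem IsDecaying.fderiv_fderiv_solMap (α : ℝ) (σ h h' : LParam N) :
    fderiv ℝ (fderiv ℝ (solMap α Q)) σ h h'
      = toL2 (fun y => fderiv ℝ (fderiv ℝ (wave α Q)) (σ, y) (h, 0) (h', 0)) :=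
  fderiv_fderiv_toL2 (contDiff_wave hQ.contDiff) (hQ.locDominated α)
    (hQ.locDominated_fderiv α) (hQ.locDominated_fderiv_fderiv α) σ h h'

set_option maxHeartbeats 800000 in
/-- Uniform bounds for the soliton map on a slab, and decay of the interaction of distant
solitons. -/
theorem IsDecaying.exists_bounds (α : ℝ) (hρ : 0 ≤ ρ) : ∃ B, 0 < B ∧
    (∀ σ : LParam N, ‖σ.2.1‖ ≤ ρ → |σ.2.2.2| ≤ ρ → ‖solMap α Q σ‖ ≤ B ∧
      ‖fderiv ℝ (solMap α Q) σ‖ ≤ B ∧ ‖fderiv ℝ (fderiv ℝ (solMap α Q)) σ‖ ≤ B) ∧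
    (∀ σ σ' : LParam N, ‖σ.2.1‖ ≤ ρ → |σ.2.2.2| ≤ ρ → ‖σ'.2.1‖ ≤ ρ → |σ'.2.2.2| ≤ ρ →
      ‖inner ℂ (solMap α Q σ) (solMap α Q σ')‖ ≤ B * (1 + ‖σ.1 - σ'.1‖)⁻¹ ∧
      ∀ h h', ‖inner ℂ (fderiv ℝ (solMap α Q) σ h) (fderiv ℝ (solMap α Q) σ' h')‖
        ≤ B * (1 + ‖σ.1 - σ'.1‖)⁻¹ * ‖h‖ * ‖h'‖) := by
  obtain ⟨C, hC, hb⟩ := hQ.wave_bound α hρ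
  set J := Real.sqrt (∫ y : E N, bracket (N + 2) y ^ 2) with hJ
  set J' := ∫ y : E N, bracket (2 * (N + 1)) y with hJ'
  have hJ'0 : 0 ≤ J' := integral_nonneg fun y => (bracket_pos _ _).le
  have hL2 : ∀ (b : E N) (c : ℝ), 0 ≤ c → ∀ f : E N → ℂ, Continuous f →
      (∀ y, ‖f y‖ ≤ c * bracket (N + 2) (y - b)) → ‖toL2 f‖ ≤ c * J := by
    intro b c hc f hf hfb
    have hm : MemLp (fun y => bracket (N + 2) (y - b)) 2 volume :=
      (memLp_bracket (by omega)).comp_measurePreserving (measurePreserving_sub_right volume b)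
    refine (norm_toL2_le hf (hm.const_mul c) hfb).trans (le_of_eq ?_)
    simp only [mul_pow, integral_const_mul]
    rw [Real.sqrt_mul (sq_nonneg _), Real.sqrt_sq hc, hJ,
      integral_sub_right_eq_self (fun y : E N => bracket (N + 2) y ^ 2) b]
  have hn : ∀ h : LParam N, ‖(h, (0 : E N))‖ = ‖h‖ := fun h => by simp [Prod.norm_def]
  have hd0 : ∀ σ : LParam N, ‖σ.2.1‖ ≤ ρ → |σ.2.2.2| ≤ ρ → ∀ y,
      ‖wave α Q (σ, y)‖ ≤ C * bracket (N + 2) (y - σ.1) := fun σ hv hs y => (hb (σ, y) hv hs).1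
  have hd1 : ∀ (σ h : LParam N), ‖σ.2.1‖ ≤ ρ → |σ.2.2.2| ≤ ρ → ∀ y,
      ‖fderiv ℝ (wave α Q) (σ, y) (h, 0)‖ ≤ C * ‖h‖ * bracket (N + 2) (y - σ.1) := by
    intro σ h hv hs y
    refine ((fderiv ℝ (wave α Q) (σ, y)).le_opNorm _).trans ?_
    rw [hn]
    calc _ ≤ C * bracket (N + 2) (y - σ.1) * ‖h‖ := by gcongr; exact (hb (σ, y) hv hs).2.1
      _ = _ := by ring
  -- C J controls the L² norms, C² J' the overlaps, and the 1 makes the constant positive.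
  refine ⟨C * J + C * C * J' + 1, by positivity, fun σ hv hs => ⟨?_, ?_, ?_⟩,
    fun σ σ' hv hs hv' hs' => ⟨?_, fun h h' => ?_⟩⟩
  · have := hL2 σ.1 C hC (fun y => wave α Q (σ, y)) ((hQ.continuous_wave α).comp (by fun_prop))
      (hd0 σ hv hs)
    refine this.trans ?_
    nlinarith [mul_nonneg (mul_nonneg hC hC) hJ'0]
  · refine ContinuousLinearMap.opNorm_le_bound _ (by positivity) fun h => ?_
    rw [hQ.fderiv_solMap]
    have := hL2 σ.1 (C * ‖h‖) (by positivity) _ (hQ.continuous_fderiv_wave_apply α σ (h, 0))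
      (hd1 σ h hv hs)
    refine this.trans ?_
    nlinarith [mul_nonneg (mul_nonneg (mul_nonneg hC hC) hJ'0) (norm_nonneg h), norm_nonneg h]
  · refine ContinuousLinearMap.opNorm_le_bound₂ _ (by positivity) fun h h' => ?_
    rw [hQ.fderiv_fderiv_solMap]
    have hcont : Continuous (fderiv ℝ (fderiv ℝ (wave α Q))) :=
      ((contDiff_wave hQ.contDiff).fderiv_right (m := 1) (by norm_num)).continuous_fderiv (by simp)
    have := hL2 σ.1 (C * ‖h‖ * ‖h'‖) (by positivity)
      (fun y => fderiv ℝ (fderiv ℝ (wave α Q)) (σ, y) (h, 0) (h', 0))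
      (((hcont.comp (by fun_prop)).clm_apply continuous_const).clm_apply continuous_const)
      (fun y => ?_)
    · refine this.trans ?_
      have h0 := mul_nonneg (norm_nonneg h) (norm_nonneg h')
      nlinarith [mul_nonneg (mul_nonneg (mul_nonneg hC hC) hJ'0) h0]
    · refine ((fderiv ℝ (fderiv ℝ (wave α Q)) (σ, y)).le_opNorm₂ _ _).trans ?_
      rw [hn, hn]
      calc _ ≤ C * bracket (N + 2) (y - σ.1) * ‖h‖ * ‖h'‖ := by
            gcongr; exact (hb (σ, y) hv hs).2.2
        _ = _ := by ring
  · refine (norm_inner_toL2_le (f := fun y => wave α Q (σ, y)) (g := fun y => wave α Q (σ', y))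
      ((hQ.continuous_wave α).comp (by fun_prop)) ((hQ.continuous_wave α).comp (by fun_prop)) hC
      (hd0 σ hv hs) (hd0 σ' hv' hs')).trans ?_
    refine mul_le_mul_of_nonneg_right ?_ (by positivity)
    nlinarith [mul_nonneg hC (Real.sqrt_nonneg (∫ y : E N, bracket (N + 2) y ^ 2))]
  · rw [hQ.fderiv_solMap, hQ.fderiv_solMap]
    refine (norm_inner_toL2_le (hQ.continuous_fderiv_wave_apply α σ (h, 0))
      (hQ.continuous_fderiv_wave_apply α σ' (h', 0)) (by positivity)
      (hd1 σ h hv hs) (hd1 σ' h' hv' hs')).trans ?_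
    have h0 := mul_nonneg (norm_nonneg h) (norm_nonneg h')
    calc _ = C * C * J' * ((1 + ‖σ.1 - σ'.1‖)⁻¹ * (‖h‖ * ‖h'‖)) := by ring
      _ ≤ (C * J + C * C * J' + 1) * ((1 + ‖σ.1 - σ'.1‖)⁻¹ * (‖h‖ * ‖h'‖)) := by
        refine mul_le_mul_of_nonneg_right ?_ (by positivity)
        nlinarith [mul_nonneg hC (Real.sqrt_nonneg (∫ y : E N, bracket (N + 2) y ^ 2))]
      _ = _ := by ring

end SolitonMap

end NLSSoliton

namespace NLSSoliton

/-! ### Nondegeneracy of the symplectic form on the tangent space of one soliton -/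

section Nondegeneracy

variable {N : ℕ} {α ρ : ℝ} {Q : E N → ℝ}

theorem norm_wave (z : LParam N × E N) : ‖wave α Q z‖ = |ampl α Q z| := by
  rw [wave, norm_smul, Complex.norm_exp_ofReal_mul_I, mul_one, Real.norm_eq_abs]

theorem fderiv_wave_apply (hQ : ContDiff ℝ 2 Q) (z k : LParam N × E N) :
    fderiv ℝ (wave α Q) z k = ((fderiv ℝ (ampl α Q) z k : ℂ)
      + ((ampl α Q z * fderiv ℝ phase z k : ℝ) : ℂ) * Complex.I)
        * Complex.exp ((phase z : ℂ) * Complex.I) := by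
  have h1 : HasFDerivAt (ampl α Q) (fderiv ℝ (ampl α Q) z) z :=
    ((contDiff_ampl hQ).differentiable (by simp) z).hasFDerivAt
  have h2 : HasFDerivAt (phase (N := N)) (fderiv ℝ phase z) z :=
    (contDiff_phase.differentiable (by simp) z).hasFDerivAt
  have h3 := (hasDerivAt_expI (phase z)).hasFDerivAt.comp z h2
  have h4 : HasFDerivAt (wave α Q) _ z := h1.smul h3
  rw [h4.fderiv]
  simp
  ring

theorem abs_fderiv_ampl_le (hQ : ContDiff ℝ 2 Q) (z k : LParam N × E N) :
    |fderiv ℝ (ampl α Q) z k| ≤ ‖fderiv ℝ (wave α Q) z‖ * ‖k‖ := by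
  refine le_trans ?_ ((fderiv ℝ (wave α Q) z).le_opNorm k)
  rw [fderiv_wave_apply hQ, norm_mul, Complex.norm_exp_ofReal_mul_I, mul_one]
  refine le_trans (le_of_eq ?_) (Complex.abs_re_le_norm _)
  simp

/-- In polar form the derivative is (∂A + iA∂φ)e^{iφ}. The exponentials cancel, and if the first
direction fixes A then its factor is purely imaginary, so only ∂A of the second direction survives.
-/
theorem fderiv_wave_mul_conj (hQ : ContDiff ℝ 2 Q) (z k k' : LParam N × E N)
    (hk : fderiv ℝ (ampl α Q) z k = 0) :
    (fderiv ℝ (wave α Q) z k * (starRingEnd ℂ) (fderiv ℝ (wave α Q) z k')).im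
      = fderiv ℝ phase z k * (ampl α Q z * fderiv ℝ (ampl α Q) z k') := by
  have he : Complex.exp ((phase z : ℂ) * Complex.I)
      * (starRingEnd ℂ) (Complex.exp ((phase z : ℂ) * Complex.I)) = 1 := by
    rw [Complex.mul_conj, Complex.normSq_eq_norm_sq, Complex.norm_exp_ofReal_mul_I]
    simp
  rw [fderiv_wave_apply hQ, fderiv_wave_apply hQ, hk, map_mul]
  have e : ∀ a b c d : ℂ, a * b * (c * d) = a * c * (b * d) := fun a b c d => by ring
  rw [e, he, mul_one]
  simp
  ring

theorem hasDerivAt_line {F : Type*} [NormedAddCommGroup F] [NormedSpace ℝ F]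
    {f : LParam N × E N → F} (hf : ContDiff ℝ 2 f) (z k : LParam N × E N) :
    HasDerivAt (fun t : ℝ => f (z + t • k)) (fderiv ℝ f z k) 0 := by
  have h1 : HasDerivAt (fun t : ℝ => z + t • k) k 0 := by
    simpa using ((hasDerivAt_id (0 : ℝ)).smul_const k).const_add z
  have h : HasFDerivAt f (fderiv ℝ f z) (z + (0 : ℝ) • k) := by
    simpa using ((hf.differentiable (by simp)) z).hasFDerivAt
  exact h.comp_hasDerivAt (0 : ℝ) h1

theorem fderiv_phase_gauge (z : LParam N × E N) (ν : E N) (g : ℝ) :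
    fderiv ℝ phase z ((0, ν, g, 0), 0) = 1 / 2 * inner ℝ ν (z.2 - z.1.1) + g := by
  refine (hasDerivAt_line contDiff_phase z ((0, ν, g, 0), 0)).unique ?_
  have h : ∀ t : ℝ, phase (z + t • (((0, ν, g, 0), 0) : LParam N × E N))
      = phase z + t * (1 / 2 * inner ℝ ν (z.2 - z.1.1) + g) := by
    intro t
    simp [phase, inner_add_left, inner_smul_left]
    ring
  simp only [h]
  simpa using ((hasDerivAt_id (0 : ℝ)).mul_const
    (1 / 2 * inner ℝ ν (z.2 - z.1.1) + g)).const_add (phase z)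

theorem fderiv_ampl_gauge (hQ : ContDiff ℝ 2 Q) (z : LParam N × E N) (ν : E N) (g : ℝ) :
    fderiv ℝ (ampl α Q) z ((0, ν, g, 0), 0) = 0 := by
  refine (hasDerivAt_line (contDiff_ampl hQ) z ((0, ν, g, 0), 0)).unique ?_
  have h : ∀ t : ℝ, ampl α Q (z + t • (((0, ν, g, 0), 0) : LParam N × E N)) = ampl α Q z := by
    intro t
    simp [ampl]
  simp only [h]
  exact hasDerivAt_const _ _

theorem fderiv_ampl_translation (hQ : ContDiff ℝ 2 Q) (z : LParam N × E N) (β : E N) :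
    fderiv ℝ (ampl α Q) z ((β, 0, 0, 0), 0) = - fderiv ℝ (ampl α Q) z (0, β) := by
  refine (hasDerivAt_line (contDiff_ampl hQ) z ((β, 0, 0, 0), 0)).unique ?_
  have h1 := hasDerivAt_line (contDiff_ampl (α := α) hQ) z (0, -β)
  have e : (0, -β) = -((0, β) : LParam N × E N) := by simp
  rw [e, map_neg, ← e] at h1
  refine h1.congr_of_eventuallyEq (Filter.Eventually.of_forall fun t => ?_)
  simp only [ampl]
  congr 2
  simp
  abel_nf

theorem fderiv_ampl_reflection (hQ : ContDiff ℝ 2 Q) (heven : ∀ x, Q (-x) = Q x)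
    (σ : LParam N) (y : E N) (m : ℝ) :
    fderiv ℝ (ampl α Q) (σ, σ.1 - (y - σ.1)) ((0, 0, 0, m), 0)
      = fderiv ℝ (ampl α Q) (σ, y) ((0, 0, 0, m), 0) := by
  refine (hasDerivAt_line (contDiff_ampl hQ) _ _).unique ?_
  refine (hasDerivAt_line (contDiff_ampl (α := α) hQ) (σ, y) ((0, 0, 0, m), 0)).congr_of_eventuallyEq
    (Filter.Eventually.of_forall fun t => ?_)
  simp only [ampl]
  congr 1
  rw [← heven, ← smul_neg]
  congr 2
  simp

theorem ampl_reflection (heven : ∀ x, Q (-x) = Q x) (σ : LParam N) (y : E N) :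
    ampl α Q (σ, σ.1 - (y - σ.1)) = ampl α Q (σ, y) := by
  simp only [ampl]
  congr 1
  rw [← heven, ← smul_neg]
  congr 2
  simp

/-- The scaling law of the mass. Positivity of 2α - N/2, mass subcriticality, makes the mass
increase with s. -/
theorem norm_sq_solMap (hQ : IsDecaying Q) (σ : LParam N) :
    ‖solMap α Q σ‖ ^ 2 = Real.exp ((2 * α - N / 2) * σ.2.2.2) * ∫ x, Q x ^ 2 := by
  rw [solMap, norm_sq_toL2 (hQ.memLp_wave α σ)]
  simp only [norm_wave, sq_abs]
  have h1 : ∀ y, ampl α Q (σ, y) ^ 2 = Real.exp (2 * α * σ.2.2.2)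
      * (fun w => (fun x => Q x ^ 2) (Real.exp (1 / 2 * σ.2.2.2) • w)) (y - σ.1) := by
    intro y
    simp only [ampl, mul_pow]
    congr 1
    rw [← Real.exp_nat_mul]
    congr 1
    push_cast
    ring
  simp only [h1]
  rw [integral_const_mul, integral_sub_right_eq_self
    (fun w => (fun x => Q x ^ 2) (Real.exp (1 / 2 * σ.2.2.2) • w)) σ.1,
    Measure.integral_comp_smul volume (fun x => Q x ^ 2), smul_eq_mul, ← mul_assoc]
  congr 1
  rw [abs_of_pos (by positivity), ← Real.exp_nat_mul, ← Real.exp_neg, ← Real.exp_add]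
  congr 1
  simp
  ring

variable (hQ : IsDecaying Q)
include hQ

theorem IsDecaying.ampl_bounds (α : ℝ) (σ : LParam N) : ∃ C, 0 ≤ C ∧ ∀ y,
    |ampl α Q (σ, y)| ≤ C * bracket (N + 2) (y - σ.1) ∧
    ∀ k, |fderiv ℝ (ampl α Q) (σ, y) k| ≤ C * ‖k‖ * bracket (N + 2) (y - σ.1) := by
  obtain ⟨C, hC, hb⟩ := hQ.wave_bound α (ρ := max ‖σ.2.1‖ |σ.2.2.2|)
    (le_max_of_le_left (norm_nonneg _))
  refine ⟨C, hC, fun y => ?_⟩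
  obtain ⟨h0, h1, -⟩ := hb (σ, y) (le_max_left _ _) (le_max_right _ _)
  refine ⟨by rwa [norm_wave] at h0, fun k => ?_⟩
  refine (abs_fderiv_ampl_le hQ.contDiff _ k).trans ?_
  calc _ ≤ C * bracket (N + 2) (y - σ.1) * ‖k‖ := by gcongr
    _ = _ := by ring

theorem IsDecaying.integrable_weighted (α : ℝ) (σ : LParam N) (ν : E N) (g : ℝ) {F : E N → ℝ}
    (hF : Continuous F) {C : ℝ} (hFb : ∀ y, |F y| ≤ C * bracket (N + 2) (y - σ.1)) :
    Integrable (fun y => (inner ℝ ν (y - σ.1) + g) * (ampl α Q (σ, y) * F y)) := by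
  obtain ⟨C', hC', hb⟩ := hQ.ampl_bounds α σ
  have hi : Integrable (fun y => bracket (N + 1) (y - σ.1)) :=
    (integrable_bracket (N := N) (n := N + 1) (by omega)).comp_sub_right σ.1
  have hC : 0 ≤ C := nonneg_of_mul_nonneg_left ((abs_nonneg _).trans (hFb 0)) (bracket_pos _ _)
  have hc : Continuous (fun y => ampl α Q (σ, y)) :=
    (contDiff_ampl hQ.contDiff).continuous.comp (by fun_prop)
  refine (hi.const_mul ((‖ν‖ + |g|) * (C' * C))).mono' (by fun_prop) ?_
  filter_upwards with y
  set w := y - σ.1 with hw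
  rw [Real.norm_eq_abs, abs_mul, abs_mul]
  have h1 : |inner ℝ ν w + g| * bracket (N + 2) w ≤ (‖ν‖ + |g|) * bracket (N + 1) w := by
    calc |inner ℝ ν w + g| * bracket (N + 2) w
        ≤ (‖ν‖ * ‖w‖ + |g|) * bracket (N + 2) w := by
          refine mul_le_mul_of_nonneg_right ?_ (bracket_pos _ _).le
          exact (abs_add_le _ _).trans (add_le_add_left (abs_real_inner_le_norm _ _) _)
      _ = ‖ν‖ * (‖w‖ * bracket (N + 1 + 1) w) + |g| * bracket (N + 2) w := by ring
      _ ≤ ‖ν‖ * bracket (N + 1) w + |g| * bracket (N + 1) w := by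
          gcongr
          · exact norm_mul_bracket_le _ _
          · exact bracket_anti (by omega) _
      _ = _ := by ring
  have hb1 : bracket (N + 2) w ≤ 1 := by
    have := bracket_anti (Nat.zero_le (N + 2)) w
    simpa [bracket] using this
  calc |inner ℝ ν w + g| * (|ampl α Q (σ, y)| * |F y|)
      ≤ |inner ℝ ν w + g| * ((C' * bracket (N + 2) w) * (C * 1)) := by
        refine mul_le_mul_of_nonneg_left (mul_le_mul (hb y).1 ?_ (abs_nonneg _)
          (mul_nonneg hC' (bracket_pos _ _).le)) (abs_nonneg _)
        exact (hFb y).trans (mul_le_mul_of_nonneg_left hb1 hC)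
    _ = (C' * C) * (|inner ℝ ν w + g| * bracket (N + 2) w) := by ring
    _ ≤ (C' * C) * ((‖ν‖ + |g|) * bracket (N + 1) w) := by gcongr
    _ = _ := by ring

theorem IsDecaying.integrable_weighted_fderiv (α : ℝ) (σ : LParam N) (ν : E N) (g : ℝ)
    (k : LParam N × E N) : Integrable (fun y => (inner ℝ ν (y - σ.1) + g)
      * (ampl α Q (σ, y) * fderiv ℝ (ampl α Q) (σ, y) k)) := by
  obtain ⟨C, hC, hb⟩ := hQ.ampl_bounds α σ
  refine hQ.integrable_weighted α σ ν g ?_ (fun y => (hb y).2 k)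
  exact (((contDiff_ampl hQ.contDiff).continuous_fderiv (by simp)).comp
    (by fun_prop)).clm_apply continuous_const

theorem IsDecaying.integrable_weighted_sq (α : ℝ) (σ : LParam N) (ν : E N) (g : ℝ) :
    Integrable (fun y => (inner ℝ ν (y - σ.1) + g) * (ampl α Q (σ, y) * ampl α Q (σ, y))) := by
  obtain ⟨C, hC, hb⟩ := hQ.ampl_bounds α σ
  exact hQ.integrable_weighted α σ ν g ((contDiff_ampl hQ.contDiff).continuous.comp (by fun_prop))
    (fun y => (hb y).1)

/-- The derivative of ‖Ψ‖² along h, computed once by the chain rule in L² and once from the scaling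
law. -/
theorem IsDecaying.integral_ampl_fderiv (α : ℝ) (σ h : LParam N) :
    ∫ y, ampl α Q (σ, y) * fderiv ℝ (ampl α Q) (σ, y) (h, 0)
      = 1 / 2 * (2 * α - N / 2) * ‖solMap α Q σ‖ ^ 2 * h.2.2.2 := by
  have h1 : HasDerivAt (fun t : ℝ => σ + t • h) h 0 := by
    simpa using ((hasDerivAt_id (0 : ℝ)).smul_const h).const_add σ
  have h2 : HasDerivAt (fun t : ℝ => solMap α Q (σ + t • h)) (fderiv ℝ (solMap α Q) σ h) 0 := by
    have h : HasFDerivAt (solMap α Q) (fderiv ℝ (solMap α Q) σ) (σ + (0 : ℝ) • h) := by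
      simpa using ((hQ.contDiff_solMap α).differentiable (by simp) σ).hasFDerivAt
    exact h.comp_hasDerivAt (0 : ℝ) h1
  have h3 := h2.norm_sq
  have h4 : HasDerivAt (fun t : ℝ => ‖solMap α Q (σ + t • h)‖ ^ 2)
      ((2 * α - N / 2) * h.2.2.2 * ‖solMap α Q σ‖ ^ 2) 0 := by
    simp only [norm_sq_solMap hQ]
    have e1 : HasDerivAt (fun t : ℝ => (2 * α - N / 2) * (σ + t • h).2.2.2)
        ((2 * α - N / 2) * h.2.2.2) 0 := by
      have := (((hasDerivAt_id (0 : ℝ)).mul_const h.2.2.2).const_add σ.2.2.2).const_mul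
        (2 * α - N / 2)
      simpa using this
    have e2 := e1.exp.mul_const (∫ x, Q x ^ 2)
    refine e2.congr_deriv ?_
    simp
    ring
  have h5 := h3.unique h4
  simp only [zero_smul, add_zero] at h5
  have h6 : inner ℝ (solMap α Q σ) (fderiv ℝ (solMap α Q) σ h)
      = ∫ y, ampl α Q (σ, y) * fderiv ℝ (ampl α Q) (σ, y) (h, 0) := by
    rw [hQ.fderiv_solMap, L2.inner_def]
    refine integral_congr_ae ?_
    filter_upwards [coeFn_toL2 (hQ.memLp_wave α σ),
      coeFn_toL2 (hQ.memLp_fderiv_wave α σ (h, 0))] with y hy1 hy2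
    rw [hy2, solMap, hy1, fderiv_wave_apply hQ.contDiff, wave, Complex.inner]
    have he : Complex.exp ((phase (σ, y) : ℂ) * Complex.I)
        * (starRingEnd ℂ) (Complex.exp ((phase (σ, y) : ℂ) * Complex.I)) = 1 := by
      rw [Complex.mul_conj, Complex.normSq_eq_norm_sq, Complex.norm_exp_ofReal_mul_I]
      simp
    rw [Complex.real_smul, map_mul, Complex.conj_ofReal]
    have e : ∀ a b c d : ℂ, a * b * (c * d) = a * c * (b * d) := fun a b c d => by ring
    rw [e, he, mul_one]
    simp
    ring
  rw [h6] at h5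
  linarith

/-- Moving the centre is moving y backwards, so the integrand is -½ (ν·(y-b)) ∂_β(A²); integrate by
parts against the linear weight. -/
theorem IsDecaying.integral_inner_ampl_fderiv_translation (α : ℝ) (σ : LParam N) (ν β : E N) :
    ∫ y, inner ℝ ν (y - σ.1) * (ampl α Q (σ, y) * fderiv ℝ (ampl α Q) (σ, y) ((β, 0, 0, 0), 0))
      = 1 / 2 * ‖solMap α Q σ‖ ^ 2 * inner ℝ ν β := by
  have hd : ∀ y, HasFDerivAt (fun y => ampl α Q (σ, y))
      ((fderiv ℝ (ampl α Q) (σ, y)).comp (ContinuousLinearMap.inr ℝ (LParam N) (E N))) y :=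
    fun y => ((contDiff_ampl hQ.contDiff).differentiable (by simp) (σ, y)).hasFDerivAt.comp y
      (hasFDerivAt_prodMk_right σ y)
  have hd2 : ∀ y, HasFDerivAt (fun y => ampl α Q (σ, y) * ampl α Q (σ, y)) _ y :=
    fun y => (hd y).mul (hd y)
  have hf : ∀ y, HasFDerivAt (fun y => inner ℝ ν (y - σ.1)) (innerSL ℝ ν) y := fun y => by
    have h := ((innerSL ℝ ν).hasFDerivAt (x := y - σ.1)).comp y ((hasFDerivAt_id y).sub_const σ.1)
    exact h
  have e1 : ∀ y, fderiv ℝ (fun y => ampl α Q (σ, y) * ampl α Q (σ, y)) y β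
      = 2 * (ampl α Q (σ, y) * fderiv ℝ (ampl α Q) (σ, y) (0, β)) := by
    intro y
    rw [(hd2 y).fderiv]
    simp
    ring
  have hparts := integral_mul_fderiv_eq_neg_fderiv_mul_of_integrable (𝕜 := ℝ) (μ := volume)
    (v := β) (f := fun y => inner ℝ ν (y - σ.1))
    (g := fun y => ampl α Q (σ, y) * ampl α Q (σ, y)) ?_ ?_ ?_
    (fun y _ => (hf y).differentiableAt) (fun y _ => (hd2 y).differentiableAt)
  · simp only [fun y => (hf y).fderiv, e1, innerSL_apply_apply] at hparts
    simp only [fderiv_ampl_translation hQ.contDiff]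
    have e2 : ∀ y, inner ℝ ν (y - σ.1)
        * (ampl α Q (σ, y) * -(fderiv ℝ (ampl α Q) (σ, y)) (0, β))
        = - 1 / 2 * (inner ℝ ν (y - σ.1)
          * (2 * (ampl α Q (σ, y) * (fderiv ℝ (ampl α Q) (σ, y)) (0, β)))) := fun y => by ring
    simp only [e2]
    rw [integral_const_mul, hparts, integral_const_mul, solMap, norm_sq_toL2 (hQ.memLp_wave α σ)]
    simp only [norm_wave, sq_abs, ← sq]
    ring
  · simp only [fun y => (hf y).fderiv, innerSL_apply_apply]
    have := hQ.integrable_weighted_sq α σ 0 (inner ℝ ν β)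
    simpa using this
  · simp only [e1]
    have := (hQ.integrable_weighted_fderiv α σ ν 0 (0, β)).const_mul 2
    refine this.congr (Filter.Eventually.of_forall fun y => ?_)
    simp only
    ring
  · have := hQ.integrable_weighted_sq α σ ν 0
    simpa using this

/-- The amplitude and its scale derivative are even about b, so the integrand is odd. -/
theorem IsDecaying.integral_inner_ampl_fderiv_scale (heven : ∀ x, Q (-x) = Q x) (α : ℝ)
    (σ : LParam N) (ν : E N) (m : ℝ) :
    ∫ y, inner ℝ ν (y - σ.1) * (ampl α Q (σ, y) * fderiv ℝ (ampl α Q) (σ, y) ((0, 0, 0, m), 0))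
      = 0 := by
  set F : E N → ℝ := fun y => inner ℝ ν (y - σ.1)
    * (ampl α Q (σ, y) * fderiv ℝ (ampl α Q) (σ, y) ((0, 0, 0, m), 0)) with hF
  have h1 : ∀ y, F (σ.1 - (y - σ.1)) = - F y := by
    intro y
    simp only [hF]
    rw [ampl_reflection heven, fderiv_ampl_reflection hQ.contDiff heven]
    have : σ.1 - (y - σ.1) - σ.1 = -(y - σ.1) := by abel
    rw [this, inner_neg_right]
    ring
  have h2 : ∫ y, F (σ.1 - (y - σ.1)) = ∫ y, F y := by
    rw [integral_sub_right_eq_self (fun y => F (σ.1 - y)) σ.1, integral_sub_left_eq_self F volume σ.1]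
  simp only [h1, integral_neg] at h2
  linarith

/-- Varying v and θ changes only the phase, by ½ ν·(y-b) + g, so the pairing integrates this affine
weight against A ∂_h A. The linear part sees only translations, by parity; the constant part sees
only the change of mass. The v and θ directions pair to zero among themselves. -/
theorem IsDecaying.omega_gauge (heven : ∀ x, Q (-x) = Q x) (α : ℝ) (σ h : LParam N) (ν : E N)
    (g : ℝ) :
    omega (fderiv ℝ (solMap α Q) σ (0, ν, g, 0)) (fderiv ℝ (solMap α Q) σ h)
      = 1 / 4 * ‖solMap α Q σ‖ ^ 2 * inner ℝ ν h.1
        + 1 / 2 * (2 * α - N / 2) * ‖solMap α Q σ‖ ^ 2 * g * h.2.2.2 := by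
  have m1 := hQ.memLp_fderiv_wave α σ ((0, ν, g, 0), 0)
  have m2 := hQ.memLp_fderiv_wave α σ (h, 0)
  have hint : Integrable (fun y => fderiv ℝ (wave α Q) (σ, y) ((0, ν, g, 0), 0)
      * (starRingEnd ℂ) (fderiv ℝ (wave α Q) (σ, y) (h, 0))) := m1.integrable_mul m2.star
  rw [hQ.fderiv_solMap, hQ.fderiv_solMap, omega_toL2 m1 m2]
  have him := integral_im hint
  simp only [RCLike.im_to_complex] at him
  rw [← him]
  have hpt : ∀ y, (fderiv ℝ (wave α Q) (σ, y) ((0, ν, g, 0), 0)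
      * (starRingEnd ℂ) (fderiv ℝ (wave α Q) (σ, y) (h, 0))).im
      = 1 / 2 * (inner ℝ ν (y - σ.1)
          * (ampl α Q (σ, y) * fderiv ℝ (ampl α Q) (σ, y) ((h.1, 0, 0, 0), 0)))
        + 1 / 2 * (inner ℝ ν (y - σ.1)
          * (ampl α Q (σ, y) * fderiv ℝ (ampl α Q) (σ, y) ((0, 0, 0, h.2.2.2), 0)))
        + g * (ampl α Q (σ, y) * fderiv ℝ (ampl α Q) (σ, y) (h, 0)) := by
    intro y
    rw [fderiv_wave_mul_conj hQ.contDiff _ _ _ (fderiv_ampl_gauge hQ.contDiff _ _ _),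
      fderiv_phase_gauge]
    have hsplit : ((h, 0) : LParam N × E N) = ((h.1, 0, 0, 0), 0) + ((0, 0, 0, h.2.2.2), 0)
        + ((0, h.2.1, h.2.2.1, 0), 0) := by
      ext <;> simp
    have e : fderiv ℝ (ampl α Q) (σ, y) (h, 0)
        = fderiv ℝ (ampl α Q) (σ, y) ((h.1, 0, 0, 0), 0)
          + fderiv ℝ (ampl α Q) (σ, y) ((0, 0, 0, h.2.2.2), 0) := by
      rw [hsplit, map_add, map_add, fderiv_ampl_gauge hQ.contDiff, add_zero]
    rw [e]
    ring
  have i1 := (hQ.integrable_weighted_fderiv α σ ν 0 ((h.1, 0, 0, 0), 0)).const_mul (1 / 2)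
  have i2 := (hQ.integrable_weighted_fderiv α σ ν 0 ((0, 0, 0, h.2.2.2), 0)).const_mul (1 / 2)
  have i3 := hQ.integrable_weighted_fderiv α σ 0 g (h, 0)
  simp only [add_zero, inner_zero_left, zero_add] at i1 i2 i3
  simp only [hpt]
  rw [integral_add (by exact i1.add i2) i3, integral_add i1 i2, integral_const_mul, integral_const_mul,
    integral_const_mul, hQ.integral_inner_ampl_fderiv_translation,
    hQ.integral_inner_ampl_fderiv_scale heven, hQ.integral_ampl_fderiv]
  ring

/-- Block elimination. Pairing τ with the v and θ directions reads off its position and scale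
components. The products of position and scale directions among themselves are not computed, only
bounded by B²; once that contribution is subtracted, the rest is a combination of v and θ
directions, read off by pairing with position and scale. -/
theorem IsDecaying.exists_nondegenerate (heven : ∀ x, Q (-x) = Q x) (hpos : 0 < ∫ x, Q x ^ 2)
    {α : ℝ} (hα : (N : ℝ) / 2 < 2 * α) (hρ : 0 ≤ ρ) : ∃ κ, 0 < κ ∧ ∀ σ : LParam N,
      ‖σ.2.1‖ ≤ ρ → |σ.2.2.2| ≤ ρ → ∀ τ, κ * ‖τ‖
        ≤ ‖(omega (fderiv ℝ (solMap α Q) σ τ)).comp (fderiv ℝ (solMap α Q) σ)‖ := by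
  obtain ⟨B, hB, hb, -⟩ := hQ.exists_bounds α hρ
  set γ := 2 * α - N / 2 with hγ
  have hγ0 : 0 < γ := by rw [hγ]; linarith
  set n₀ := Real.exp (-(γ * ρ)) * ∫ x, Q x ^ 2 with hn₀
  have hn₀pos : 0 < n₀ := mul_pos (Real.exp_pos _) hpos
  -- The reciprocals of the coefficients ¼n and ½γn of `omega_gauge`, at the lower bound n₀ of the
  -- squared norm.
  set c := 4 / n₀ + 2 / (γ * n₀) with hc
  have hc0 : 0 < c := by positivity
  have hK : 0 < c * (1 + B * B * c) := by positivity
  refine ⟨(c * (1 + B * B * c))⁻¹, inv_pos.2 hK, fun σ hv hs τ => ?_⟩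
  rw [inv_mul_le_iff₀ hK]
  set Ω := (omega (fderiv ℝ (solMap α Q) σ τ)).comp (fderiv ℝ (solMap α Q) σ) with hΩ
  set X := ‖Ω‖ with hX
  have hX0 : 0 ≤ X := norm_nonneg _
  have hΩh : ∀ h, |Ω h| ≤ X * ‖h‖ := fun h => Ω.le_opNorm h
  have hΩe : ∀ h, Ω h = omega (fderiv ℝ (solMap α Q) σ τ) (fderiv ℝ (solMap α Q) σ h) :=
    fun h => rfl
  set n := ‖solMap α Q σ‖ ^ 2 with hn
  have hnn : n₀ ≤ n := by
    rw [hn, norm_sq_solMap hQ]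
    refine mul_le_mul_of_nonneg_right (Real.exp_le_exp.2 ?_) hpos.le
    nlinarith [(abs_le.1 hs).1]
  have hgauge := hQ.omega_gauge heven α σ
  have hDb : ∀ τ h, |omega (fderiv ℝ (solMap α Q) σ τ) (fderiv ℝ (solMap α Q) σ h)|
      ≤ B * B * ‖τ‖ * ‖h‖ := by
    intro τ h
    have h1 : ∀ τ, ‖fderiv ℝ (solMap α Q) σ τ‖ ≤ B * ‖τ‖ := fun τ =>
      ((fderiv ℝ (solMap α Q) σ).le_opNorm τ).trans
        (mul_le_mul_of_nonneg_right (hb σ hv hs).2.1 (norm_nonneg _))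
    calc _ ≤ _ := abs_omega_le _ _
      _ ≤ (B * ‖τ‖) * (B * ‖h‖) := mul_le_mul (h1 τ) (h1 h) (norm_nonneg _) (by positivity)
      _ = _ := by ring
  have cancel : ∀ a t Y : ℝ, 0 ≤ t → 0 ≤ Y → a * t ^ 2 ≤ Y * t → a * t ≤ Y := by
    intro a t Y ht hY h
    rcases ht.eq_or_lt with rfl | ht'
    · simpa using hY
    · refine le_of_mul_le_mul_right ?_ ht'
      rwa [mul_assoc, ← sq]
  -- the scale component
  have hs1 : |τ.2.2.2| ≤ 2 / (γ * n₀) * X := by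
    have h1 := hΩh (0, 0, 1, 0)
    rw [hΩe, omega_swap, hgauge] at h1
    simp only [inner_zero_left, mul_zero, zero_add, mul_one, abs_neg] at h1
    have hnorm : ‖((0, 0, 1, 0) : LParam N)‖ = 1 := by simp [Prod.norm_def]
    rw [hnorm, abs_mul, abs_of_nonneg (by positivity : 0 ≤ 1 / 2 * γ * n), mul_one] at h1
    rw [div_mul_eq_mul_div, le_div_iff₀ (by positivity)]
    have h2 := mul_le_mul_of_nonneg_left hnn (mul_nonneg hγ0.le (abs_nonneg τ.2.2.2))
    linarith
  -- the position component
  have hb1 : ‖τ.1‖ ≤ 4 / n₀ * X := by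
    have h1 := hΩh (0, τ.1, 0, 0)
    rw [hΩe, omega_swap, hgauge] at h1
    simp only [mul_zero, zero_mul, add_zero, abs_neg, real_inner_self_eq_norm_sq] at h1
    have hnorm : ‖((0, τ.1, 0, 0) : LParam N)‖ = ‖τ.1‖ := by simp [Prod.norm_def]
    rw [hnorm, abs_of_nonneg (by positivity)] at h1
    have h2 := cancel _ _ _ (norm_nonneg _) hX0 h1
    rw [div_mul_eq_mul_div, le_div_iff₀ (by positivity)]
    have h3 := mul_le_mul_of_nonneg_left hnn (norm_nonneg τ.1)
    linarith
  have hsplit : τ = (τ.1, 0, 0, τ.2.2.2) + (0, τ.2.1, τ.2.2.1, 0) := by ext <;> simp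
  have hr : ‖((τ.1, 0, 0, τ.2.2.2) : LParam N)‖ ≤ c * X := by
    have h1 : ‖((τ.1, 0, 0, τ.2.2.2) : LParam N)‖ ≤ ‖τ.1‖ + |τ.2.2.2| := by
      simp only [Prod.norm_def, norm_zero, Real.norm_eq_abs]
      have := norm_nonneg τ.1
      have := abs_nonneg τ.2.2.2
      simp only [max_le_iff]
      refine ⟨by linarith, by linarith, by linarith, by linarith⟩
    rw [hc, add_mul]
    linarith
  have hrest : ∀ h, |omega (fderiv ℝ (solMap α Q) σ (0, τ.2.1, τ.2.2.1, 0))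
      (fderiv ℝ (solMap α Q) σ h)| ≤ (1 + B * B * c) * X * ‖h‖ := by
    intro h
    have h1 := hΩh h
    have h2 := hDb (τ.1, 0, 0, τ.2.2.2) h
    rw [hΩe, hsplit, map_add, map_add, add_apply] at h1
    have h3 := abs_sub_abs_le_abs_add (omega (fderiv ℝ (solMap α Q) σ (0, τ.2.1, τ.2.2.1, 0))
      (fderiv ℝ (solMap α Q) σ h)) (omega (fderiv ℝ (solMap α Q) σ (τ.1, 0, 0, τ.2.2.2))
      (fderiv ℝ (solMap α Q) σ h))
    rw [add_comm (omega (fderiv ℝ (solMap α Q) σ (0, τ.2.1, τ.2.2.1, 0))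
      (fderiv ℝ (solMap α Q) σ h))] at h3
    have h4 : B * B * ‖((τ.1, 0, 0, τ.2.2.2) : LParam N)‖ * ‖h‖ ≤ B * B * (c * X) * ‖h‖ := by
      gcongr
    nlinarith
  have hY0 : 0 ≤ (1 + B * B * c) * X := by positivity
  -- the phase component
  have hθ : |τ.2.2.1| ≤ 2 / (γ * n₀) * ((1 + B * B * c) * X) := by
    have h1 := hrest (0, 0, 0, 1)
    rw [hgauge] at h1
    simp only [inner_zero_right, mul_zero, zero_add, mul_one] at h1
    have hnorm : ‖((0, 0, 0, 1) : LParam N)‖ = 1 := by simp [Prod.norm_def]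
    rw [hnorm, abs_mul, abs_of_nonneg (by positivity : 0 ≤ 1 / 2 * γ * n), mul_one] at h1
    rw [div_mul_eq_mul_div, le_div_iff₀ (by positivity)]
    have h2 := mul_le_mul_of_nonneg_left hnn (mul_nonneg hγ0.le (abs_nonneg τ.2.2.1))
    linarith
  -- the velocity component
  have hvv : ‖τ.2.1‖ ≤ 4 / n₀ * ((1 + B * B * c) * X) := by
    have h1 := hrest (τ.2.1, 0, 0, 0)
    rw [hgauge] at h1
    simp only [mul_zero, add_zero, real_inner_self_eq_norm_sq] at h1
    have hnorm : ‖((τ.2.1, 0, 0, 0) : LParam N)‖ = ‖τ.2.1‖ := by simp [Prod.norm_def]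
    rw [hnorm, abs_of_nonneg (by positivity)] at h1
    have h2 := cancel _ _ _ (norm_nonneg _) hY0 h1
    rw [div_mul_eq_mul_div, le_div_iff₀ (by positivity)]
    have h3 := mul_le_mul_of_nonneg_left hnn (norm_nonneg τ.2.1)
    linarith
  have hXY : X ≤ (1 + B * B * c) * X := by
    nlinarith [mul_nonneg (mul_nonneg (mul_nonneg hB.le hB.le) hc0.le) hX0]
  have h4c : 4 / n₀ ≤ c := by rw [hc]; linarith [(by positivity : 0 < 2 / (γ * n₀))]
  have h2c : 2 / (γ * n₀) ≤ c := by rw [hc]; linarith [(by positivity : 0 < 4 / n₀)]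
  have e : c * (1 + B * B * c) * X = c * ((1 + B * B * c) * X) := by ring
  rw [e]
  simp only [Prod.norm_def, max_le_iff, Real.norm_eq_abs]
  refine ⟨?_, ?_, ?_, ?_⟩
  · exact hb1.trans (mul_le_mul h4c hXY hX0 hc0.le)
  · exact hvv.trans (mul_le_mul_of_nonneg_right h4c hY0)
  · exact hθ.trans (mul_le_mul_of_nonneg_right h2c hY0)
  · exact hs1.trans (mul_le_mul h2c hXY hX0 hc0.le)

end Nondegeneracy

end NLSSoliton

namespace NLSSoliton

/-! ### Solitons close in L² have close parameters -/

section Closeness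

variable {N : ℕ} {α ρ : ℝ} {Q : E N → ℝ}

/-- The parameter `(0, 0, 2πn, 0)`. -/
noncomputable def turn (N : ℕ) (n : ℤ) : LParam N := (0, 0, n * (2 * Real.pi), 0)

theorem wave_add_turn (σ : LParam N) (n : ℤ) (y : E N) :
    wave α Q (σ + turn N n, y) = wave α Q (σ, y) := by
  have h1 : ampl α Q (σ + turn N n, y) = ampl α Q (σ, y) := by simp [ampl, turn]
  have h2 : phase (σ + turn N n, y) = phase (σ, y) + n * (2 * Real.pi) := by
    simp [phase, turn]; ring
  rw [wave, wave, h1, h2]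
  congr 1
  push_cast
  rw [add_mul, show (n : ℂ) * (2 * Real.pi) * Complex.I = n * (2 * Real.pi * Complex.I) by ring]
  exact Complex.exp_periodic.int_mul n _

theorem solMap_add_turn (σ : LParam N) (n : ℤ) : solMap α Q (σ + turn N n) = solMap α Q σ := by
  simp only [solMap, wave_add_turn]

/-- Translations and phase rotations are isometries of L² that leave v and s alone, so one of two
solitons may be normalised to b = 0, θ = 0. -/
theorem wave_add_shift (σ : LParam N) (β : E N) (g : ℝ) (y : E N) :
    wave α Q (σ + (β, 0, g, 0), y) = Complex.exp ((g : ℂ) * Complex.I) * wave α Q (σ, y - β) := by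
  have e : y - (σ.1 + β) = y - β - σ.1 := by abel
  have h1 : ampl α Q (σ + (β, 0, g, 0), y) = ampl α Q (σ, y - β) := by simp [ampl, e]
  have h2 : phase (σ + (β, 0, g, 0), y) = phase (σ, y - β) + g := by
    simp [phase, e]; ring
  rw [wave, wave, h1, h2]
  push_cast
  rw [add_mul, Complex.exp_add, mul_comm (Complex.exp _) (Complex.exp ((g : ℂ) * Complex.I)),
    mul_smul_comm]

theorem norm_solMap_sub_shift (hQ : IsDecaying Q) (σ σ' : LParam N) (β : E N) (g : ℝ) :
    ‖solMap α Q (σ + (β, 0, g, 0)) - solMap α Q (σ' + (β, 0, g, 0))‖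
      = ‖solMap α Q σ - solMap α Q σ'‖ := by
  rw [← sq_eq_sq₀ (norm_nonneg _) (norm_nonneg _)]
  have h : ∀ σ σ' : LParam N, ‖solMap α Q σ - solMap α Q σ'‖ ^ 2
      = ∫ y, ‖wave α Q (σ, y) - wave α Q (σ', y)‖ ^ 2 := by
    intro σ σ'
    rw [solMap, solMap, ← toL2_sub (hQ.memLp_wave α σ) (hQ.memLp_wave α σ')]
    exact norm_sq_toL2 ((hQ.memLp_wave α σ).sub (hQ.memLp_wave α σ'))
  rw [h, h]
  simp only [wave_add_shift, ← mul_sub, norm_mul, Complex.norm_exp_ofReal_mul_I, one_mul]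
  exact integral_sub_right_eq_self (fun y => ‖wave α Q (σ, y) - wave α Q (σ', y)‖ ^ 2) β

/-- The modulus determines b and s because Q has a strict maximum at 0: comparing the two moduli at
both centres forces equality. The phase at the common centre determines θ modulo 2π, and the phase
along a line determines v. -/
theorem solMap_injective (hQ : IsDecaying Q) (hα : 0 < α) (hpos : ∀ x, 0 < Q x)
    (hmax : ∀ x, x ≠ 0 → Q x < Q 0) {σ σ' : LParam N} (h : solMap α Q σ = solMap α Q σ') :
    ∃ n : ℤ, σ' + turn N n = σ := by
  have hw : ∀ y, wave α Q (σ, y) = wave α Q (σ', y) := by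
    have hc : ∀ σ, Continuous (fun y => wave α Q (σ, y)) := fun σ =>
      (hQ.continuous_wave α).comp (by fun_prop)
    have : (fun y => wave α Q (σ, y)) =ᵐ[volume] (fun y => wave α Q (σ', y)) := by
      have h1 := coeFn_toL2 (hQ.memLp_wave α σ)
      have h2 := coeFn_toL2 (hQ.memLp_wave α σ')
      rw [solMap, solMap] at h
      rw [h] at h1
      exact h1.symm.trans h2
    exact fun y => congrFun (((hc σ).ae_eq_iff_eq volume (hc σ')).1 this) y
  have hap : ∀ σ y, 0 < ampl α Q (σ, y) := fun σ y => mul_pos (Real.exp_pos _) (hpos _)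
  have ha : ∀ y, ampl α Q (σ, y) = ampl α Q (σ', y) := by
    intro y
    have := congrArg norm (hw y)
    rwa [norm_wave, norm_wave, abs_of_pos (hap _ _), abs_of_pos (hap _ _)] at this
  have hle : ∀ x, Q x ≤ Q 0 := fun x => by
    by_cases hx : x = 0
    · rw [hx]
    · exact (hmax x hx).le
  have e1 : Real.exp (α * σ.2.2.2) * Q 0 = Real.exp (α * σ'.2.2.2)
      * Q (Real.exp (1 / 2 * σ'.2.2.2) • (σ.1 - σ'.1)) := by
    have := ha σ.1
    simpa [ampl] using this
  have e2 : Real.exp (α * σ'.2.2.2) * Q 0 = Real.exp (α * σ.2.2.2)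
      * Q (Real.exp (1 / 2 * σ.2.2.2) • (σ'.1 - σ.1)) := by
    have := (ha σ'.1).symm
    simpa [ampl] using this
  have hQ0 := hpos 0
  have l1 : Real.exp (α * σ.2.2.2) * Q 0 ≤ Real.exp (α * σ'.2.2.2) * Q 0 := by
    rw [e1]; exact mul_le_mul_of_nonneg_left (hle _) (Real.exp_pos _).le
  have l2 : Real.exp (α * σ'.2.2.2) * Q 0 ≤ Real.exp (α * σ.2.2.2) * Q 0 := by
    rw [e2]; exact mul_le_mul_of_nonneg_left (hle _) (Real.exp_pos _).le
  have l3 : Real.exp (α * σ.2.2.2) = Real.exp (α * σ'.2.2.2) :=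
    mul_right_cancel₀ hQ0.ne' (le_antisymm l1 l2)
  have hs : σ.2.2.2 = σ'.2.2.2 := mul_left_cancel₀ hα.ne' (Real.exp_injective l3)
  have hb : σ.1 = σ'.1 := by
    rw [l3] at e1
    have e3 := mul_left_cancel₀ (Real.exp_pos _).ne' e1
    by_contra hne
    have : Real.exp (1 / 2 * σ'.2.2.2) • (σ.1 - σ'.1) ≠ 0 :=
      smul_ne_zero (Real.exp_pos _).ne' (sub_ne_zero.2 hne)
    exact absurd e3.symm (hmax _ this).ne
  have hph : ∀ y, Complex.exp ((phase (σ, y) : ℂ) * Complex.I)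
      = Complex.exp ((phase (σ', y) : ℂ) * Complex.I) := by
    intro y
    have h1 := hw y
    rw [wave, wave, ha y] at h1
    exact smul_right_injective ℂ (hap σ' y).ne' h1
  obtain ⟨n, hn⟩ := Complex.exp_eq_exp_iff_exists_int.1 (hph σ'.1)
  have hθ : σ.2.2.1 = σ'.2.2.1 + n * (2 * Real.pi) := by
    have h1 : phase (σ, σ'.1) = σ.2.2.1 := by simp [phase, hb]
    have h2 : phase (σ', σ'.1) = σ'.2.2.1 := by simp [phase]
    rw [h1, h2, show (σ'.2.2.1 : ℂ) * Complex.I + n * (2 * Real.pi * Complex.I)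
      = ((σ'.2.2.1 + n * (2 * Real.pi) : ℝ) : ℂ) * Complex.I by push_cast; ring] at hn
    exact_mod_cast mul_right_cancel₀ Complex.I_ne_zero hn
  have hv : σ.2.1 = σ'.2.1 := by
    set d := σ.2.1 - σ'.2.1 with hd
    -- On the line b' + td the two phases differ by t‖d‖²/2 plus full turns; the derivative at t = 0
    -- of this constant exponential forces d = 0.
    have h1 : ∀ t : ℝ, Complex.exp (((t * (1 / 2 * ‖d‖ ^ 2) : ℝ) : ℂ) * Complex.I) = 1 := by
      intro t
      have h2 := hph (σ'.1 + t • d)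
      have h3 : phase (σ, σ'.1 + t • d) = phase (σ', σ'.1 + t • d)
          + t * (1 / 2 * ‖d‖ ^ 2) + n * (2 * Real.pi) := by
        have h4 : inner ℝ σ.2.1 d = inner ℝ σ'.2.1 d + ‖d‖ ^ 2 := by
          rw [← real_inner_self_eq_norm_sq, ← inner_add_left, hd]; simp
        simp only [phase, hb, add_sub_cancel_left, inner_smul_left, inner_smul_right, h4, hθ]
        simp
        ring
      rw [h3] at h2
      push_cast at h2 ⊢
      rw [add_mul, show (n : ℂ) * (2 * Real.pi) * Complex.I = n * (2 * Real.pi * Complex.I) by ring,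
        Complex.exp_periodic.int_mul n, add_mul, Complex.exp_add] at h2
      exact mul_left_cancel₀ (Complex.exp_ne_zero _) (by rw [h2, mul_one])
    have h2 : HasDerivAt (fun t : ℝ => Complex.exp (((t * (1 / 2 * ‖d‖ ^ 2) : ℝ) : ℂ) * Complex.I))
        ((1 / 2 * ‖d‖ ^ 2) • (Complex.exp (((0 * (1 / 2 * ‖d‖ ^ 2) : ℝ) : ℂ) * Complex.I)
          * Complex.I)) 0 := by
      have h3 : HasDerivAt (fun t : ℝ => t * (1 / 2 * ‖d‖ ^ 2)) (1 / 2 * ‖d‖ ^ 2) 0 := by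
        simpa using (hasDerivAt_id (0 : ℝ)).mul_const (1 / 2 * ‖d‖ ^ 2)
      exact (hasDerivAt_expI _).scomp (0 : ℝ) h3
    simp only [h1] at h2
    have h3 := h2.unique (hasDerivAt_const (0 : ℝ) (1 : ℂ))
    simp at h3
    exact sub_eq_zero.1 h3
  refine ⟨n, ?_⟩
  ext1
  · simp [turn, hb]
  · ext1
    · simp [turn, hv]
    · ext1
      · simp [turn, hθ]
      · simp [turn, hs]

theorem re_inner_self_sub (u w : L2 N) :
    ‖u - w‖ ^ 2 = ‖u‖ ^ 2 + ‖w‖ ^ 2 - 2 * (inner ℂ u w).re := by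
  have := norm_sub_sq (𝕜 := ℂ) u w
  simp only [RCLike.re_to_complex] at this
  linarith

variable (hQ : IsDecaying Q)
include hQ

theorem IsDecaying.exists_norm_lower (hint : 0 < ∫ x, Q x ^ 2) (hα : (N : ℝ) / 2 < 2 * α) (ρ : ℝ) :
    ∃ n₀, 0 < n₀ ∧ ∀ σ : LParam N, |σ.2.2.2| ≤ ρ → n₀ ≤ ‖solMap α Q σ‖ ^ 2 := by
  refine ⟨Real.exp (-((2 * α - N / 2) * ρ)) * ∫ x, Q x ^ 2, mul_pos (Real.exp_pos _) hint,
    fun σ hs => ?_⟩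
  rw [norm_sq_solMap hQ]
  refine mul_le_mul_of_nonneg_right (Real.exp_le_exp.2 ?_) hint.le
  nlinarith [(abs_le.1 hs).1]

/-- If two solitons are close in `L²`, then their parameters are close. -/
theorem IsDecaying.exists_close (hint : 0 < ∫ x, Q x ^ 2) (hα0 : 0 < α)
    (hα : (N : ℝ) / 2 < 2 * α) (hpos : ∀ x, 0 < Q x) (hmax : ∀ x, x ≠ 0 → Q x < Q 0)
    (hρ : 0 ≤ ρ) {r' : ℝ} (hr' : 0 < r') : ∃ r, 0 < r ∧ ∀ σ σ' : LParam N,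
      ‖σ.2.1‖ ≤ ρ → |σ.2.2.2| ≤ ρ → ‖σ'.2.1‖ ≤ ρ → |σ'.2.2.2| ≤ ρ →
      ‖solMap α Q σ - solMap α Q σ'‖ ^ 2 < r → ∃ n : ℤ, ‖σ' + turn N n - σ‖ < r' := by
  obtain ⟨B, hB, -, hb⟩ := hQ.exists_bounds α hρ
  obtain ⟨n₀, hn₀, hlow⟩ := hQ.exists_norm_lower hint hα ρ
  -- Beyond this distance the overlap is at most n₀/2, so the squared distance of the two solitons
  -- is at least 2n₀ - n₀ = n₀.
  set R := 2 * B / n₀ with hR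
  have hR0 : 0 ≤ R := by positivity
  have hcont : Continuous (solMap α Q) := (hQ.contDiff_solMap α).continuous
  -- Normalised pairs that violate the conclusion, with relative position at most R and relative
  -- phase in [-π, π]. By injectivity the L² distance does not vanish on this compact set, so it has
  -- a positive lower bound.
  let K : Set (LParam N × LParam N) := {z | z.1.1 = 0 ∧ z.1.2.2.1 = 0 ∧ ‖z.1.2.1‖ ≤ ρ ∧
    |z.1.2.2.2| ≤ ρ ∧ ‖z.2.1‖ ≤ R ∧ |z.2.2.2.1| ≤ Real.pi ∧ ‖z.2.2.1‖ ≤ ρ ∧ |z.2.2.2.2| ≤ ρ ∧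
    ∀ n : ℤ, r' ≤ ‖z.2 + turn N n - z.1‖}
  have hK : IsCompact K := by
    refine Metric.isCompact_of_isClosed_isBounded ?_ ?_
    · simp only [K, Set.ofPred_and, Set.ofPred_forall]
      refine IsClosed.inter (isClosed_eq (by fun_prop) (by fun_prop)) <|
        IsClosed.inter (isClosed_eq (by fun_prop) (by fun_prop)) <|
        IsClosed.inter (isClosed_le (by fun_prop) (by fun_prop)) <|
        IsClosed.inter (isClosed_le (by fun_prop) (by fun_prop)) <|
        IsClosed.inter (isClosed_le (by fun_prop) (by fun_prop)) <|
        IsClosed.inter (isClosed_le (by fun_prop) (by fun_prop)) <|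
        IsClosed.inter (isClosed_le (by fun_prop) (by fun_prop)) <|
        IsClosed.inter (isClosed_le (by fun_prop) (by fun_prop)) <|
        isClosed_iInter fun n => isClosed_le (by fun_prop) (by fun_prop)
    · refine (Metric.isBounded_closedBall (x := 0) (r := R + ρ + Real.pi)).subset fun z hz => ?_
      obtain ⟨h1, h2, h3, h4, h5, h6, h7, h8, -⟩ := hz
      have := Real.pi_pos
      rw [mem_closedBall_zero_iff]
      simp only [Prod.norm_def, max_le_iff, Real.norm_eq_abs, h1, h2, norm_zero]
      refine ⟨⟨?_, ?_, ?_, ?_⟩, ?_, ?_, ?_, ?_⟩ <;> linarith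
  obtain ⟨m, hm, hmK⟩ := hK.exists_forall_le' (a := 0)
    (f := fun z => ‖solMap α Q z.1 - solMap α Q z.2‖ ^ 2)
    (by fun_prop) (fun z hz => by
      have hne : solMap α Q z.1 ≠ solMap α Q z.2 := by
        intro h
        obtain ⟨n, hn⟩ := solMap_injective hQ hα0 hpos hmax h
        have := hz.2.2.2.2.2.2.2.2 n
        rw [hn, sub_self, norm_zero] at this
        linarith
      have := norm_pos_iff.2 (sub_ne_zero.2 hne)
      positivity)
  refine ⟨min m n₀, lt_min hm hn₀, fun σ σ' hv hs hv' hs' hlt => ?_⟩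
  by_contra! hcon
  have hbR : ‖σ'.1 - σ.1‖ ≤ R := by
    by_contra! hgt
    have h1 := (hb σ σ' hv hs hv' hs').1
    have h2 := re_inner_self_sub (solMap α Q σ) (solMap α Q σ')
    have h3 := (Complex.re_le_norm (inner ℂ (solMap α Q σ) (solMap α Q σ'))).trans h1
    have h4 : B * (1 + ‖σ.1 - σ'.1‖)⁻¹ ≤ n₀ / 2 := by
      rw [norm_sub_rev] at hgt
      rw [← div_eq_mul_inv, div_le_iff₀ (by positivity)]
      rw [hR, div_lt_iff₀ hn₀] at hgt
      nlinarith
    have h5 := hlow σ hs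
    have h6 := hlow σ' hs'
    have h7 := lt_of_lt_of_le hlt (min_le_right _ _)
    linarith
  -- The nearest number of turns brings the relative phase into [-π, π].
  set n₁ := -round ((σ'.2.2.1 - σ.2.2.1) / (2 * Real.pi)) with hn₁
  have hθ : |σ'.2.2.1 + n₁ * (2 * Real.pi) - σ.2.2.1| ≤ Real.pi := by
    have h1 := abs_sub_round ((σ'.2.2.1 - σ.2.2.1) / (2 * Real.pi))
    have hpi := Real.pi_pos
    have e : σ'.2.2.1 + n₁ * (2 * Real.pi) - σ.2.2.1
        = ((σ'.2.2.1 - σ.2.2.1) / (2 * Real.pi) - round ((σ'.2.2.1 - σ.2.2.1) / (2 * Real.pi)))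
          * (2 * Real.pi) := by
      rw [hn₁, sub_mul, div_mul_cancel₀ _ (by positivity)]
      push_cast
      ring
    rw [e, abs_mul, abs_of_pos (by positivity : 0 < 2 * Real.pi)]
    nlinarith
  have hmem : (σ + (-σ.1, 0, -σ.2.2.1, 0), σ' + turn N n₁ + (-σ.1, 0, -σ.2.2.1, 0)) ∈ K := by
    refine ⟨by simp, by simp, by simpa using hv, by simpa using hs, ?_, ?_, ?_, ?_, fun n => ?_⟩
    · simpa [turn, ← sub_eq_add_neg] using hbR
    · simpa [turn, ← sub_eq_add_neg] using hθ
    · simpa [turn] using hv'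
    · simpa [turn] using hs'
    · have h1 := hcon (n₁ + n)
      refine h1.trans (le_of_eq ?_)
      congr 1
      have h2 : turn N (n₁ + n) = turn N n₁ + turn N n := by
        simp [turn]; ring
      rw [h2]
      change _ = σ' + turn N n₁ + (-σ.1, 0, -σ.2.2.1, 0) + turn N n - (σ + (-σ.1, 0, -σ.2.2.1, 0))
      generalize ((-σ.1, 0, -σ.2.2.1, 0) : LParam N) = w
      abel
  have h1 := hmK _ hmem
  simp only at h1
  rw [norm_solMap_sub_shift hQ, solMap_add_turn] at h1
  exact absurd (lt_of_lt_of_le hlt (min_le_left _ _)) (not_lt.2 h1)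

end Closeness

end NLSSoliton

namespace NLSSoliton

/-! ### A quantitative inverse function theorem -/

section Quantitative

variable {X Y : Type*} [NormedAddCommGroup X] [NormedSpace ℝ X] [NormedAddCommGroup Y]
  [NormedSpace ℝ Y]

theorem injective_of_lower_bound {A : X →L[ℝ] Y} {κ : ℝ} (hκ : 0 < κ)
    (h : ∀ x, κ * ‖x‖ ≤ ‖A x‖) : Function.Injective A := by
  refine (injective_iff_map_eq_zero A).2 fun x hx => ?_
  have := h x
  rw [hx, norm_zero] at this
  exact norm_le_zero_iff.1 (nonpos_of_mul_nonpos_right this hκ)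

theorem isInvertible_of_lower_bound [FiniteDimensional ℝ X] [FiniteDimensional ℝ Y]
    (hdim : Module.finrank ℝ X = Module.finrank ℝ Y) {A : X →L[ℝ] Y} {κ : ℝ} (hκ : 0 < κ)
    (h : ∀ x, κ * ‖x‖ ≤ ‖A x‖) : A.IsInvertible := by
  refine ⟨(LinearEquiv.ofInjectiveOfFinrankEq (A : X →ₗ[ℝ] Y)
    (injective_of_lower_bound hκ h) hdim).toContinuousLinearEquiv, ?_⟩
  ext x
  rfl

variable {f : X → Y} {A : X →L[ℝ] Y} {x₀ : X} {r κ : ℝ}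

theorem lower_bound_of_near (h : ∀ x, κ * ‖x‖ ≤ ‖A x‖) {A' : X →L[ℝ] Y}
    (hA : ‖A' - A‖ ≤ κ / 2) (x : X) : κ / 2 * ‖x‖ ≤ ‖A' x‖ := by
  have h1 := ((A' - A).le_opNorm x).trans (mul_le_mul_of_nonneg_right hA (norm_nonneg x))
  rw [sub_apply] at h1
  have h2 := norm_sub_norm_le (A x) (A x - A' x)
  rw [sub_sub_cancel, norm_sub_rev] at h2
  linarith [h x]

theorem approximates_of_fderiv_near (hf : Differentiable ℝ f)
    (hA : ∀ x ∈ Metric.closedBall x₀ r, ‖fderiv ℝ f x - A‖ ≤ κ / 2) {x y : X}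
    (hx : x ∈ Metric.closedBall x₀ r) (hy : y ∈ Metric.closedBall x₀ r) :
    ‖f x - f y - A (x - y)‖ ≤ κ / 2 * ‖x - y‖ :=
  (convex_closedBall x₀ r).norm_image_sub_le_of_norm_fderiv_le' (fun z _ => hf z) hA hy hx

theorem eq_of_fderiv_near (hκ : 0 < κ) (h : ∀ x, κ * ‖x‖ ≤ ‖A x‖) (hf : Differentiable ℝ f)
    (hA : ∀ x ∈ Metric.closedBall x₀ r, ‖fderiv ℝ f x - A‖ ≤ κ / 2) {x y : X}
    (hx : x ∈ Metric.closedBall x₀ r) (hy : y ∈ Metric.closedBall x₀ r) (hxy : f x = f y) :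
    x = y := by
  have h1 := approximates_of_fderiv_near hf hA hx hy
  rw [hxy, sub_self, zero_sub, norm_neg] at h1
  have h2 := h (x - y)
  have h3 : ‖x - y‖ ≤ 0 := by nlinarith
  exact sub_eq_zero.1 (norm_le_zero_iff.1 h3)

/-- A has an inverse of norm at most κ⁻¹ and f - A is κ/2-Lipschitz, so the image of the ball of
radius ε covers the ball of radius (κ - κ/2)ε about f x₀. A is a model operator and need not be the
derivative at x₀, so the constants do not depend on f. -/
theorem exists_zero_of_fderiv_near [FiniteDimensional ℝ X] [FiniteDimensional ℝ Y]
    (hdim : Module.finrank ℝ X = Module.finrank ℝ Y) (hκ : 0 < κ) (h : ∀ x, κ * ‖x‖ ≤ ‖A x‖)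
    (hf : Differentiable ℝ f)
    (hA : ∀ x ∈ Metric.closedBall x₀ r, ‖fderiv ℝ f x - A‖ ≤ κ / 2) {ε : ℝ} (hε : 0 ≤ ε)
    (hεr : ε ≤ r) (h0 : ‖f x₀‖ ≤ κ / 2 * ε) : ∃ x ∈ Metric.closedBall x₀ ε, f x = 0 := by
  have : CompleteSpace X := FiniteDimensional.complete ℝ X
  obtain ⟨e, he⟩ := isInvertible_of_lower_bound hdim hκ h
  obtain ⟨c, hc⟩ : ∃ c : NNReal, (c : ℝ) = κ / 2 := ⟨⟨κ / 2, by positivity⟩, rfl⟩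
  obtain ⟨d, hd⟩ : ∃ d : NNReal, (d : ℝ) = κ⁻¹ := ⟨⟨κ⁻¹, by positivity⟩, rfl⟩
  have happ : ApproximatesLinearOn f A (Metric.closedBall x₀ r) c := fun x hx y hy => by
    rw [hc]
    exact approximates_of_fderiv_near hf hA hx hy
  let inv : A.NonlinearRightInverse :=
    { toFun := e.symm
      nnnorm := d
      bound' := fun y => by
        have h1 := h (e.symm y)
        have h2 : A (e.symm y) = y := by rw [← he]; simp
        rw [h2] at h1
        rwa [hd, inv_mul_eq_div, le_div_iff₀ hκ, mul_comm]
      right_inv' := fun y => by rw [← he]; simp }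
  have hs := happ.surjOn_closedBall_of_nonlinearRightInverse inv hε
    (Metric.closedBall_subset_closedBall hεr)
  have hn : ((inv.nnnorm : ℝ)⁻¹ - c) * ε = κ / 2 * ε := by
    change ((d : ℝ)⁻¹ - c) * ε = _
    rw [hc, hd, inv_inv]; ring
  rw [hn] at hs
  obtain ⟨x, hx, hfx⟩ := hs (show (0 : Y) ∈ Metric.closedBall (f x₀) (κ / 2 * ε) by
    rwa [mem_closedBall_iff_norm, zero_sub, norm_neg])
  exact ⟨x, hx, hfx⟩

end Quantitative

/-! ### The orthogonality map and its derivative -/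

section MultiSoliton

variable {N k : ℕ} {α ρ : ℝ} {Q : E N → ℝ}

/-- The sum of rescaled solitons, in `L²`. -/
noncomputable def multiMap (α : ℝ) (Q : E N → ℝ) (σ : Fin k → LParam N) : L2 N :=
  ∑ j, solMap α Q (σ j)

/-- The symplectic products of `ψ - ∑_j Ψ_{σ_j}` with the tangent vectors at the `Ψ_{σ_l}`. -/
noncomputable def orth (α : ℝ) (Q : E N → ℝ) (z : L2 N × (Fin k → LParam N)) :
    Fin k → (LParam N →L[ℝ] ℝ) :=
  fun l => (omega (z.1 - multiMap α Q z.2)).comp (fderiv ℝ (solMap α Q) (z.2 l))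

theorem orth_apply (z : L2 N × (Fin k → LParam N)) (l : Fin k) (h : LParam N) :
    orth α Q z l h = omega (z.1 - multiMap α Q z.2) (fderiv ℝ (solMap α Q) (z.2 l) h) := rfl

/-- The diagonal part of the derivative of `orth` in the parameters. -/
noncomputable def orthDiag (α : ℝ) (Q : E N → ℝ) (σ : Fin k → LParam N) :
    (Fin k → LParam N) →L[ℝ] (Fin k → (LParam N →L[ℝ] ℝ)) :=
  ContinuousLinearMap.pi fun l =>
    -(((ContinuousLinearMap.compL ℝ (LParam N) (L2 N) ℝ).flip (fderiv ℝ (solMap α Q) (σ l))).comp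
      (omega.comp ((fderiv ℝ (solMap α Q) (σ l)).comp (ContinuousLinearMap.proj l))))

theorem orthDiag_apply (σ τ : Fin k → LParam N) (l : Fin k) :
    orthDiag α Q σ τ l = -((omega (fderiv ℝ (solMap α Q) (σ l) (τ l))).comp
      (fderiv ℝ (solMap α Q) (σ l))) := rfl

theorem finrank_orth : Module.finrank ℝ (Fin k → LParam N)
    = Module.finrank ℝ (Fin k → (LParam N →L[ℝ] ℝ)) := by
  have h : Module.finrank ℝ (LParam N →L[ℝ] ℝ) = Module.finrank ℝ (LParam N) := by
    rw [← (LinearMap.toContinuousLinearMap (𝕜 := ℝ) (E := LParam N) (F' := ℝ)).finrank_eq]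
    exact Subspace.dual_finrank_eq
  rw [Module.finrank_pi_fintype, Module.finrank_pi_fintype, h]

variable (hQ : IsDecaying Q)
include hQ

theorem IsDecaying.contDiff_multiMap (α : ℝ) :
    ContDiff ℝ 2 (multiMap (k := k) α Q) := by
  unfold multiMap
  exact ContDiff.sum fun j _ => (hQ.contDiff_solMap α).comp (contDiff_apply ℝ (LParam N) j)

theorem IsDecaying.contDiff_orth (α : ℝ) : ContDiff ℝ 1 (orth (k := k) α Q) := by
  refine contDiff_pi.2 fun l => ContDiff.clm_comp ?_ ?_
  · exact omega.contDiff.comp (contDiff_fst.sub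
      (((hQ.contDiff_multiMap α).of_le (by norm_num)).comp contDiff_snd))
  · exact ((hQ.contDiff_solMap α).fderiv_right (m := 1) (by norm_num)).comp
      ((contDiff_apply ℝ (LParam N) l).comp contDiff_snd)

theorem IsDecaying.differentiable_orth_right (α : ℝ) (ψ : L2 N) :
    Differentiable ℝ (fun σ : Fin k → LParam N => orth α Q (ψ, σ)) :=
  ((hQ.contDiff_orth α).comp (contDiff_const.prodMk contDiff_id)).differentiable (by simp)

/-- The product rule. The first term is small with the residual, the terms j ≠ l are small with the
separation, and j = l is the block kept in `orthDiag`. -/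
theorem IsDecaying.fderiv_orth_apply (α : ℝ) (ψ : L2 N) (σ τ : Fin k → LParam N) (l : Fin k)
    (h : LParam N) :
    fderiv ℝ (fun σ : Fin k → LParam N => orth α Q (ψ, σ)) σ τ l h
      = omega (ψ - multiMap α Q σ) (fderiv ℝ (fderiv ℝ (solMap α Q)) (σ l) (τ l) h)
        - ∑ j, omega (fderiv ℝ (solMap α Q) (σ j) (τ j)) (fderiv ℝ (solMap α Q) (σ l) h) := by
  have hd1 : Differentiable ℝ (solMap α Q) := (hQ.contDiff_solMap α).differentiable (by simp)
  have hd2 : Differentiable ℝ (fderiv ℝ (solMap α Q)) :=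
    ((hQ.contDiff_solMap α).fderiv_right (m := 1) (by norm_num)).differentiable (by simp)
  have hline : ∀ j, HasDerivAt (fun t : ℝ => (σ + t • τ) j) (τ j) 0 := fun j => by
    simpa using ((hasDerivAt_id (0 : ℝ)).smul_const (τ j)).const_add (σ j)
  have hlσ : HasDerivAt (fun t : ℝ => σ + t • τ) τ 0 := by
    simpa using ((hasDerivAt_id (0 : ℝ)).smul_const τ).const_add σ
  have h1 : HasDerivAt (fun t : ℝ => orth α Q (ψ, σ + t • τ) l h)
      (fderiv ℝ (fun σ : Fin k → LParam N => orth α Q (ψ, σ)) σ τ l h) 0 := by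
    have h2 : HasFDerivAt (fun σ : Fin k → LParam N => orth α Q (ψ, σ))
        (fderiv ℝ (fun σ : Fin k → LParam N => orth α Q (ψ, σ)) σ) (σ + (0 : ℝ) • τ) := by
      simpa using (hQ.differentiable_orth_right α ψ σ).hasFDerivAt
    have h3 := h2.comp_hasDerivAt (0 : ℝ) hlσ
    have h4 := (((ContinuousLinearMap.apply ℝ ℝ h).comp (ContinuousLinearMap.proj
      (R := ℝ) (φ := fun _ : Fin k => LParam N →L[ℝ] ℝ) l)).hasFDerivAt).comp_hasDerivAt (0 : ℝ) h3
    exact h4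
  refine h1.unique ?_
  have h2 : ∀ j, HasDerivAt (fun t : ℝ => solMap α Q ((σ + t • τ) j))
      (fderiv ℝ (solMap α Q) (σ j) (τ j)) 0 := fun j => by
    have h : HasFDerivAt (solMap α Q) (fderiv ℝ (solMap α Q) (σ j)) ((σ + (0 : ℝ) • τ) j) := by
      simpa using (hd1 (σ j)).hasFDerivAt
    exact h.comp_hasDerivAt (0 : ℝ) (hline j)
  have h3 : HasDerivAt (fun t : ℝ => ψ - multiMap α Q (σ + t • τ))
      (-∑ j, fderiv ℝ (solMap α Q) (σ j) (τ j)) 0 := by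
    unfold multiMap
    exact (HasDerivAt.fun_sum fun j _ => h2 j).const_sub ψ
  have h4 : HasDerivAt (fun t : ℝ => fderiv ℝ (solMap α Q) ((σ + t • τ) l) h)
      (fderiv ℝ (fderiv ℝ (solMap α Q)) (σ l) (τ l) h) 0 := by
    have h5 : HasFDerivAt (fderiv ℝ (solMap α Q)) (fderiv ℝ (fderiv ℝ (solMap α Q)) (σ l))
        ((σ + (0 : ℝ) • τ) l) := by
      simpa using (hd2 (σ l)).hasFDerivAt
    exact (ContinuousLinearMap.apply ℝ (L2 N) h).hasFDerivAt.comp_hasDerivAt (0 : ℝ)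
      (h5.comp_hasDerivAt (0 : ℝ) (hline l))
  have h5 := (omega (N := N)).hasFDerivAt_of_bilinear h3.hasFDerivAt h4.hasFDerivAt
  have h6 := h5.hasDerivAt
  refine h6.congr_deriv ?_
  simp
  abel

end MultiSoliton

end NLSSoliton

namespace NLSSoliton

/-! ### Uniform local solvability near separated solitons -/

section Local

variable {N k : ℕ} {α ρ : ℝ} {Q : E N → ℝ}

/-- The parameters with `|v| ≤ ρ` and `|s| ≤ ρ`. -/
def slab (N : ℕ) (ρ : ℝ) : Set (LParam N) := {σ | ‖σ.2.1‖ ≤ ρ ∧ |σ.2.2.2| ≤ ρ}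

theorem slab_of_dist {σ σ₀ : LParam N} {r : ℝ} (h₀ : σ₀ ∈ slab N ρ) (h : ‖σ - σ₀‖ ≤ r) :
    σ ∈ slab N (ρ + r) := by
  have h1 : ‖σ.2.1 - σ₀.2.1‖ ≤ ‖σ - σ₀‖ :=
    (norm_fst_le (σ - σ₀).2).trans (norm_snd_le (σ - σ₀))
  have h2 : |σ.2.2.2 - σ₀.2.2.2| ≤ ‖σ - σ₀‖ :=
    ((norm_snd_le (σ - σ₀).2.2).trans (norm_snd_le (σ - σ₀).2)).trans (norm_snd_le (σ - σ₀))
  constructor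
  · have := norm_add_le (σ.2.1 - σ₀.2.1) σ₀.2.1
    rw [sub_add_cancel] at this
    linarith [h₀.1]
  · have := abs_add_le (σ.2.2.2 - σ₀.2.2.2) σ₀.2.2.2
    rw [sub_add_cancel] at this
    linarith [h₀.2]

theorem slab_mono {ρ ρ' : ℝ} (h : ρ ≤ ρ') : slab N ρ ⊆ slab N ρ' := fun _ hσ =>
  ⟨hσ.1.trans h, hσ.2.trans h⟩

/-- Solitons whose positions have mutual distances at least `R`. -/
def Separated (R : ℝ) (σ : Fin k → LParam N) : Prop := ∀ i j, i ≠ j → R ≤ ‖(σ i).1 - (σ j).1‖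

theorem Separated.of_dist {R r : ℝ} {σ σ₀ : Fin k → LParam N} (h : Separated R σ₀)
    (hd : ‖σ - σ₀‖ ≤ r) : Separated (R - 2 * r) σ := by
  intro i j hij
  have h1 : ∀ i, ‖(σ i).1 - (σ₀ i).1‖ ≤ r := fun i =>
    (norm_fst_le (σ i - σ₀ i)).trans ((norm_le_pi_norm (σ - σ₀) i).trans hd)
  have h2 : (σ₀ i).1 - (σ₀ j).1 = ((σ i).1 - (σ j).1) - ((σ i).1 - (σ₀ i).1)
      + ((σ j).1 - (σ₀ j).1) := by abel
  have h3 := (norm_add_le (((σ i).1 - (σ j).1) - ((σ i).1 - (σ₀ i).1))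
      ((σ j).1 - (σ₀ j).1)).trans (add_le_add_left (norm_sub_le _ _) _)
  rw [← h2] at h3
  linarith [h i j hij, h1 i, h1 j]

theorem abs_omega_le_inner (u w : L2 N) : |omega u w| ≤ ‖inner ℂ w u‖ := by
  rw [omega_apply]; exact Complex.abs_im_le_norm _

variable (hQ : IsDecaying Q)
include hQ

/-- Three errors: the residual against second derivatives and the variation of the diagonal block
between σ₀ and σ, both O(r) and together at most κ/4; and the interactions j ≠ l, O(1/R), allotted
the other κ/4. -/
theorem IsDecaying.exists_fderiv_orth_near (α : ℝ) (k : ℕ) (hρ : 0 ≤ ρ) {κ : ℝ} (hκ : 0 < κ) :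
    ∃ r, 0 < r ∧ r ≤ 1 ∧ ∃ R, 0 < R ∧ ∀ σ₀ : Fin k → LParam N, (∀ j, σ₀ j ∈ slab N ρ) →
      Separated R σ₀ → ∀ ψ, ‖ψ - multiMap α Q σ₀‖ ≤ r → ∀ σ ∈ Metric.closedBall σ₀ r,
      ‖fderiv ℝ (fun σ : Fin k → LParam N => orth α Q (ψ, σ)) σ - orthDiag α Q σ₀‖ ≤ κ / 2 := by
  obtain ⟨B, hB, hb, hcross⟩ := hQ.exists_bounds α (ρ := ρ + 1) (by linarith)
  set X := (1 + k * B) * B + 2 * B * B with hX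
  have hX0 : 0 < X := by positivity
  -- The summand 2 in R pays for two centres moving by at most r ≤ 1 each; the bounds are taken on
  -- the slab ρ + 1 for the same reason.
  refine ⟨min 1 (κ / (4 * X)), by positivity, min_le_left _ _, 2 + 4 * (k * B) / κ, by positivity,
    fun σ₀ hσ₀ hsep ψ hψ σ hσ => ?_⟩
  set r := min 1 (κ / (4 * X)) with hr
  have hr1 : r ≤ 1 := min_le_left _ _
  have hr0 : 0 ≤ r := by positivity
  have hrX : X * r ≤ κ / 4 := by
    have h1 : r ≤ κ / (4 * X) := min_le_right _ _
    calc X * r ≤ X * (κ / (4 * X)) := by gcongr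
      _ = κ / 4 := by field_simp
  rw [mem_closedBall_iff_norm] at hσ
  have hσj : ∀ j, ‖σ j - σ₀ j‖ ≤ r := fun j => (norm_le_pi_norm (σ - σ₀) j).trans hσ
  have hslab : ∀ j, ∀ τ ∈ Metric.closedBall (σ₀ j) r, τ ∈ slab N (ρ + 1) := fun j τ hτ =>
    slab_of_dist (hσ₀ j) ((mem_closedBall_iff_norm.1 hτ).trans hr1)
  have hm : ∀ j, σ j ∈ Metric.closedBall (σ₀ j) r := fun j => mem_closedBall_iff_norm.2 (hσj j)
  have hm0 : ∀ j, σ₀ j ∈ Metric.closedBall (σ₀ j) r := fun j => Metric.mem_closedBall_self hr0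
  have hd1 : Differentiable ℝ (solMap α Q) := (hQ.contDiff_solMap α).differentiable (by simp)
  have hd2 : Differentiable ℝ (fderiv ℝ (solMap α Q)) :=
    ((hQ.contDiff_solMap α).fderiv_right (m := 1) (by norm_num)).differentiable (by simp)
  have hlip0 : ∀ j, ‖solMap α Q (σ j) - solMap α Q (σ₀ j)‖ ≤ B * r := by
    intro j
    refine ((convex_closedBall (σ₀ j) r).norm_image_sub_le_of_norm_fderiv_le (𝕜 := ℝ)
      (fun z _ => hd1 z) (fun z hz => (hb z (hslab j z hz).1 (hslab j z hz).2).2.1)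
      (hm0 j) (hm j)).trans ?_
    gcongr
    exact hσj j
  have hlip1 : ∀ j, ‖fderiv ℝ (solMap α Q) (σ j) - fderiv ℝ (solMap α Q) (σ₀ j)‖ ≤ B * r := by
    intro j
    refine ((convex_closedBall (σ₀ j) r).norm_image_sub_le_of_norm_fderiv_le (𝕜 := ℝ)
      (fun z _ => hd2 z) (fun z hz => (hb z (hslab j z hz).1 (hslab j z hz).2).2.2)
      (hm0 j) (hm j)).trans ?_
    gcongr
    exact hσj j
  have hψσ : ‖ψ - multiMap α Q σ‖ ≤ (1 + k * B) * r := by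
    have h1 : ψ - multiMap α Q σ = (ψ - multiMap α Q σ₀)
        - ∑ j, (solMap α Q (σ j) - solMap α Q (σ₀ j)) := by
      rw [Finset.sum_sub_distrib, multiMap, multiMap]; abel
    rw [h1]
    refine (norm_sub_le _ _).trans ?_
    have h2 : ‖∑ j, (solMap α Q (σ j) - solMap α Q (σ₀ j))‖ ≤ k * (B * r) := by
      refine (norm_sum_le _ _).trans ((Finset.sum_le_sum fun j _ => hlip0 j).trans (le_of_eq ?_))
      simp
    nlinarith
  have hDb : ∀ j, ∀ τ ∈ Metric.closedBall (σ₀ j) r, ∀ h,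
      ‖fderiv ℝ (solMap α Q) τ h‖ ≤ B * ‖h‖ := fun j τ hτ h =>
    ((fderiv ℝ (solMap α Q) τ).le_opNorm h).trans
      (mul_le_mul_of_nonneg_right (hb τ (hslab j τ hτ).1 (hslab j τ hτ).2).2.1 (norm_nonneg _))
  have hoff : ∀ j l, j ≠ l → ∀ h h', |omega (fderiv ℝ (solMap α Q) (σ j) h)
      (fderiv ℝ (solMap α Q) (σ l) h')| ≤ B * (1 + 4 * (k * B) / κ)⁻¹ * ‖h‖ * ‖h'‖ := by
    intro j l hjl h h'
    refine (abs_omega_le_inner _ _).trans (((hcross (σ l) (σ j) (hslab l _ (hm l)).1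
      (hslab l _ (hm l)).2 (hslab j _ (hm j)).1 (hslab j _ (hm j)).2).2 h' h).trans ?_)
    have hs := (hsep.of_dist hσ) l j hjl.symm
    have h1 : (1 + ‖(σ l).1 - (σ j).1‖)⁻¹ ≤ (1 + 4 * (k * B) / κ)⁻¹ := by
      refine inv_anti₀ (by positivity) ?_
      linarith
    calc _ = B * (1 + ‖(σ l).1 - (σ j).1‖)⁻¹ * (‖h‖ * ‖h'‖) := by ring
      _ ≤ B * (1 + 4 * (k * B) / κ)⁻¹ * (‖h‖ * ‖h'‖) := by gcongr
      _ = _ := by ring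
  refine ContinuousLinearMap.opNorm_le_bound _ (by positivity) fun τ => ?_
  refine (pi_norm_le_iff_of_nonneg (by positivity)).2 fun l => ?_
  refine ContinuousLinearMap.opNorm_le_bound _ (by positivity) fun h => ?_
  have hτ : ∀ j, ‖τ j‖ ≤ ‖τ‖ := fun j => norm_le_pi_norm τ j
  have hval : (fderiv ℝ (fun σ : Fin k → LParam N => orth α Q (ψ, σ)) σ - orthDiag α Q σ₀) τ l h
      = omega (ψ - multiMap α Q σ) (fderiv ℝ (fderiv ℝ (solMap α Q)) (σ l) (τ l) h)
        - ∑ j ∈ Finset.univ.erase l, omega (fderiv ℝ (solMap α Q) (σ j) (τ j))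
          (fderiv ℝ (solMap α Q) (σ l) h)
        - (omega (fderiv ℝ (solMap α Q) (σ l) (τ l)) ((fderiv ℝ (solMap α Q) (σ l)
            - fderiv ℝ (solMap α Q) (σ₀ l)) h)
          + omega ((fderiv ℝ (solMap α Q) (σ l) - fderiv ℝ (solMap α Q) (σ₀ l)) (τ l))
            (fderiv ℝ (solMap α Q) (σ₀ l) h)) := by
    have e1 : (fderiv ℝ (fun σ : Fin k → LParam N => orth α Q (ψ, σ)) σ - orthDiag α Q σ₀) τ l h
        = fderiv ℝ (fun σ : Fin k → LParam N => orth α Q (ψ, σ)) σ τ l h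
          - orthDiag α Q σ₀ τ l h := rfl
    have e2 : orthDiag α Q σ₀ τ l h = -omega (fderiv ℝ (solMap α Q) (σ₀ l) (τ l))
        (fderiv ℝ (solMap α Q) (σ₀ l) h) := rfl
    rw [e1, e2, hQ.fderiv_orth_apply, ← Finset.add_sum_erase _ _ (Finset.mem_univ l)]
    simp only [sub_apply, map_sub]
    ring
  rw [hval]
  have hA : |omega (ψ - multiMap α Q σ) (fderiv ℝ (fderiv ℝ (solMap α Q)) (σ l) (τ l) h)|
      ≤ (1 + k * B) * r * (B * ‖τ‖ * ‖h‖) := by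
    refine (abs_omega_le _ _).trans (mul_le_mul hψσ ?_ (norm_nonneg _) (by positivity))
    refine ((fderiv ℝ (fderiv ℝ (solMap α Q)) (σ l)).le_opNorm₂ _ _).trans ?_
    have := (hb (σ l) (hslab l _ (hm l)).1 (hslab l _ (hm l)).2).2.2
    gcongr
    exact hτ l
  have hBd : |∑ j ∈ Finset.univ.erase l, omega (fderiv ℝ (solMap α Q) (σ j) (τ j))
      (fderiv ℝ (solMap α Q) (σ l) h)| ≤ κ / 4 * ‖τ‖ * ‖h‖ := by
    refine (Finset.abs_sum_le_sum_abs _ _).trans ?_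
    have h1 : ∀ j ∈ Finset.univ.erase l, |omega (fderiv ℝ (solMap α Q) (σ j) (τ j))
        (fderiv ℝ (solMap α Q) (σ l) h)| ≤ B * (1 + 4 * (k * B) / κ)⁻¹ * ‖τ‖ * ‖h‖ := by
      intro j hj
      refine (hoff j l (Finset.ne_of_mem_erase hj) _ _).trans ?_
      gcongr
      exact hτ j
    refine (Finset.sum_le_card_nsmul _ _ _ h1).trans ?_
    rw [nsmul_eq_mul]
    have hcard : ((Finset.univ.erase l).card : ℝ) ≤ k := by
      have := Finset.card_le_univ (Finset.univ.erase l)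
      rw [Fintype.card_fin] at this
      exact_mod_cast this
    have h2 : k * (B * (1 + 4 * (k * B) / κ)⁻¹) ≤ κ / 4 := by
      rw [← mul_assoc, ← div_eq_mul_inv, div_le_iff₀ (by positivity)]
      have : κ / 4 * (1 + 4 * (k * B) / κ) = κ / 4 + k * B := by field_simp
      rw [this]
      linarith
    calc _ ≤ k * (B * (1 + 4 * (k * B) / κ)⁻¹ * ‖τ‖ * ‖h‖) := by gcongr
      _ = k * (B * (1 + 4 * (k * B) / κ)⁻¹) * (‖τ‖ * ‖h‖) := by ring
      _ ≤ κ / 4 * (‖τ‖ * ‖h‖) := by gcongr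
      _ = _ := by ring
  have hC : |omega (fderiv ℝ (solMap α Q) (σ l) (τ l)) ((fderiv ℝ (solMap α Q) (σ l)
      - fderiv ℝ (solMap α Q) (σ₀ l)) h)| ≤ (B * ‖τ‖) * (B * r * ‖h‖) := by
    refine (abs_omega_le _ _).trans (mul_le_mul ?_ ?_ (norm_nonneg _) (by positivity))
    · exact (hDb l _ (hm l) _).trans (by gcongr; exact hτ l)
    · exact (ContinuousLinearMap.le_opNorm _ _).trans (by gcongr; exact hlip1 l)
  have hD : |omega ((fderiv ℝ (solMap α Q) (σ l) - fderiv ℝ (solMap α Q) (σ₀ l)) (τ l))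
      (fderiv ℝ (solMap α Q) (σ₀ l) h)| ≤ (B * r * ‖τ‖) * (B * ‖h‖) := by
    refine (abs_omega_le _ _).trans (mul_le_mul ?_ (hDb l _ (hm0 l) _) (norm_nonneg _)
      (by positivity))
    refine (ContinuousLinearMap.le_opNorm _ _).trans ?_
    exact mul_le_mul (hlip1 l) (hτ l) (norm_nonneg _) (by positivity)
  rw [Real.norm_eq_abs]
  refine (abs_sub _ _).trans ((add_le_add ((abs_sub _ _).trans (add_le_add hA hBd))
    ((abs_add_le _ _).trans (add_le_add hC hD))).trans ?_)
  have hth : 0 ≤ ‖τ‖ * ‖h‖ := by positivity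
  calc _ = X * r * (‖τ‖ * ‖h‖) + κ / 4 * (‖τ‖ * ‖h‖) := by rw [hX]; ring
    _ ≤ κ / 4 * (‖τ‖ * ‖h‖) + κ / 4 * (‖τ‖ * ‖h‖) := by gcongr
    _ = _ := by ring

/-- Uniform local solvability of the orthogonality conditions near well separated solitons. -/
theorem IsDecaying.exists_local_solution (heven : ∀ x, Q (-x) = Q x) (hint : 0 < ∫ x, Q x ^ 2)
    (hα : (N : ℝ) / 2 < 2 * α) (k : ℕ) (hρ : 0 ≤ ρ) :
    ∃ r, 0 < r ∧ r ≤ 1 ∧ ∃ R, 0 < R ∧ ∃ C, 0 < C ∧ ∀ σ₀ : Fin k → LParam N,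
      (∀ j, σ₀ j ∈ slab N ρ) → Separated R σ₀ → ∀ ψ, ‖ψ - multiMap α Q σ₀‖ ≤ r →
      (∀ σ ∈ Metric.closedBall σ₀ r, ∀ σ' ∈ Metric.closedBall σ₀ r,
        orth α Q (ψ, σ) = 0 → orth α Q (ψ, σ') = 0 → σ = σ') ∧
      (C * ‖ψ - multiMap α Q σ₀‖ ≤ r →
        ∃ σ ∈ Metric.closedBall σ₀ (C * ‖ψ - multiMap α Q σ₀‖), orth α Q (ψ, σ) = 0) ∧
      (orth α Q (ψ, σ₀) = 0 → ∃ τ : L2 N → Fin k → LParam N, ContDiffAt ℝ 1 τ ψ ∧ τ ψ = σ₀ ∧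
        ∀ᶠ ψ' in nhds ψ, orth α Q (ψ', τ ψ') = 0) := by
  obtain ⟨κ, hκ, hnd⟩ := hQ.exists_nondegenerate heven hint hα hρ
  obtain ⟨B, hB, hb, -⟩ := hQ.exists_bounds α hρ
  obtain ⟨r, hr, hr1, R, hR, hnear⟩ := hQ.exists_fderiv_orth_near α k hρ hκ
  -- At σ₀ the map `orth` is at most B times the residual, and a zero within distance ε requires at
  -- most κε/2.
  refine ⟨r, hr, hr1, R, hR, 2 * B / κ, by positivity, fun σ₀ hσ₀ hsep ψ hψ => ?_⟩
  have hA := hnear σ₀ hσ₀ hsep ψ hψ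
  have hlow : ∀ τ, κ * ‖τ‖ ≤ ‖orthDiag α Q σ₀ τ‖ := by
    intro τ
    rw [mul_comm, ← le_div_iff₀ hκ]
    refine (pi_norm_le_iff_of_nonneg (by positivity)).2 fun l => ?_
    rw [le_div_iff₀ hκ, mul_comm]
    refine (hnd (σ₀ l) (hσ₀ l).1 (hσ₀ l).2 (τ l)).trans ?_
    have := norm_le_pi_norm (orthDiag α Q σ₀ τ) l
    rwa [orthDiag_apply, norm_neg] at this
  have hdiff := hQ.differentiable_orth_right (k := k) α ψ
  refine ⟨fun σ hσ σ' hσ' h h' => ?_, fun hC => ?_, fun h0 => ?_⟩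
  · exact eq_of_fderiv_near hκ hlow hdiff hA hσ hσ' (h.trans h'.symm)
  · refine exists_zero_of_fderiv_near finrank_orth hκ hlow hdiff hA (by positivity) hC ?_
    have e : κ / 2 * (2 * B / κ * ‖ψ - multiMap α Q σ₀‖) = ‖ψ - multiMap α Q σ₀‖ * B := by
      field_simp
    rw [e]
    refine (pi_norm_le_iff_of_nonneg (by positivity)).2 fun l => ?_
    refine (ContinuousLinearMap.opNorm_comp_le _ _).trans ?_
    exact mul_le_mul (norm_omega_le _) (hb (σ₀ l) (hσ₀ l).1 (hσ₀ l).2).2.1 (norm_nonneg _)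
      (norm_nonneg _)
  · have hcd : ContDiffAt ℝ 1 (orth (k := k) α Q) (ψ, σ₀) := (hQ.contDiff_orth α).contDiffAt
    have hpart : fderiv ℝ (orth (k := k) α Q) (ψ, σ₀) ∘L .inr ℝ (L2 N) (Fin k → LParam N)
        = fderiv ℝ (fun σ : Fin k → LParam N => orth α Q (ψ, σ)) σ₀ := by
      have h1 := (hcd.differentiableAt (by simp)).hasFDerivAt.comp σ₀
        (hasFDerivAt_prodMk_right ψ σ₀)
      exact h1.fderiv.symm
    have hinv : (fderiv ℝ (orth (k := k) α Q) (ψ, σ₀)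
        ∘L .inr ℝ (L2 N) (Fin k → LParam N)).IsInvertible := by
      rw [hpart]
      exact isInvertible_of_lower_bound finrank_orth (half_pos hκ)
        (lower_bound_of_near hlow (hA σ₀ (Metric.mem_closedBall_self hr.le)))
    refine ⟨hcd.implicitFunction one_ne_zero hinv, hcd.contDiffAt_implicitFunction one_ne_zero hinv,
      hcd.implicitFunction_apply_self one_ne_zero hinv, ?_⟩
    have := hcd.eventually_apply_implicitFunction one_ne_zero hinv
    simpa only [h0] using this

/-- If two sums of well separated solitons are close in `L²`, then so are the summands. -/
theorem IsDecaying.norm_sub_sq_le_of_separated (α : ℝ) (k : ℕ) (hρ : 0 ≤ ρ) :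
    ∃ B, 0 < B ∧ ∀ σ σ' : Fin k → LParam N, (∀ j, σ j ∈ slab N ρ) → (∀ j, σ' j ∈ slab N ρ) →
      ∀ R, 0 ≤ R → Separated R σ → Separated R σ' →
      (∀ i j, i ≠ j → R ≤ ‖(σ i).1 - (σ' j).1‖) → ∀ l,
      ‖solMap α Q (σ l) - solMap α Q (σ' l)‖ ^ 2
        ≤ B * ‖multiMap α Q σ - multiMap α Q σ'‖ + B * (1 + R)⁻¹ := by
  obtain ⟨B, hB, hb, hcross⟩ := hQ.exists_bounds α hρ
  refine ⟨2 * B + 4 * (k * B), by positivity, fun σ σ' hσ hσ' R hR hs hs' hss l => ?_⟩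
  have hcr : ∀ a ∈ slab N ρ, ∀ b ∈ slab N ρ, R ≤ ‖a.1 - b.1‖ →
      ‖inner ℂ (solMap α Q a) (solMap α Q b)‖ ≤ B * (1 + R)⁻¹ := by
    intro a ha b hb' hab
    refine ((hcross a b ha.1 ha.2 hb'.1 hb'.2).1).trans ?_
    have : (1 + ‖a.1 - b.1‖)⁻¹ ≤ (1 + R)⁻¹ := inv_anti₀ (by positivity) (by linarith)
    gcongr
  set u : Fin k → L2 N := fun j => solMap α Q (σ j) - solMap α Q (σ' j) with hu
  have hsum : multiMap α Q σ - multiMap α Q σ' = ∑ j, u j := by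
    rw [hu, Finset.sum_sub_distrib, multiMap, multiMap]
  have hul : ‖u l‖ ≤ 2 * B := by
    refine (norm_sub_le _ _).trans ?_
    linarith [(hb (σ l) (hσ l).1 (hσ l).2).1, (hb (σ' l) (hσ' l).1 (hσ' l).2).1]
  have hoff : ∀ j ∈ Finset.univ.erase l, ‖inner ℂ (u l) (u j)‖ ≤ 4 * (B * (1 + R)⁻¹) := by
    intro j hj
    have hjl := Finset.ne_of_mem_erase hj
    simp only [hu]
    rw [inner_sub_left, inner_sub_right, inner_sub_right]
    have h1 := hcr _ (hσ l) _ (hσ j) (hs l j hjl.symm)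
    have h2 := hcr _ (hσ l) _ (hσ' j) (hss l j hjl.symm)
    have h3 := hcr _ (hσ' l) _ (hσ j) (by rw [norm_sub_rev]; exact hss j l hjl)
    have h4 := hcr _ (hσ' l) _ (hσ' j) (hs' l j hjl.symm)
    refine (norm_sub_le _ _).trans ((add_le_add (norm_sub_le _ _) (norm_sub_le _ _)).trans ?_)
    linarith
  -- The square ‖u_l‖² is the pairing with the whole sum minus pairings with the other differences,
  -- and these involve only distant solitons.
  have e : inner ℂ (u l) (u l) = inner ℂ (u l) (∑ j, u j)
      - ∑ j ∈ Finset.univ.erase l, inner ℂ (u l) (u j) := by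
    rw [inner_sum, ← Finset.add_sum_erase _ _ (Finset.mem_univ l)]
    ring
  have e2 : ‖u l‖ ^ 2 = ‖inner ℂ (u l) (u l)‖ := by
    rw [inner_self_eq_norm_sq_to_K]; simp
  have hcard : ((Finset.univ.erase l).card : ℝ) ≤ k := by
    have := Finset.card_le_univ (Finset.univ.erase l)
    rw [Fintype.card_fin] at this
    exact_mod_cast this
  have h5 : ‖∑ j ∈ Finset.univ.erase l, inner ℂ (u l) (u j)‖ ≤ k * (4 * (B * (1 + R)⁻¹)) := by
    refine (norm_sum_le _ _).trans ((Finset.sum_le_card_nsmul _ _ _ hoff).trans ?_)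
    rw [nsmul_eq_mul]
    gcongr
  change ‖u l‖ ^ 2 ≤ _
  rw [e2, e, hsum]
  refine (norm_sub_le _ _).trans ((add_le_add ((norm_inner_le_norm _ _).trans
    (mul_le_mul_of_nonneg_right hul (norm_nonneg _))) h5).trans ?_)
  have h6 : 0 ≤ k * B * ‖∑ j, u j‖ := by positivity
  have h7 : 0 ≤ B * (1 + R)⁻¹ := by positivity
  nlinarith

end Local

end NLSSoliton

namespace NLSSoliton

/-! ### Dilation by ε and the weighted Sobolev norm -/

section Dilation

variable {N : ℕ} {ε : ℝ}

theorem quasiMeasurePreserving_dilation (hε : 0 < ε) :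
    Measure.QuasiMeasurePreserving (fun x : E N => ε • x) volume volume := by
  refine ⟨by fun_prop, ?_⟩
  rw [Measure.map_addHaar_smul _ hε.ne']
  exact Measure.smul_absolutelyContinuous

theorem integral_comp_dilation {F : Type*} [NormedAddCommGroup F] [NormedSpace ℝ F] (hε : 0 < ε)
    (f : E N → F) : ∫ x, f (ε • x) = (1 / ε ^ N) • ∫ x, f x := by
  rw [Measure.integral_comp_smul, finrank_euclideanSpace_fin, one_div,
    abs_of_pos (inv_pos.2 (pow_pos hε N))]

/-- The operator `u ↦ u (ε ·)` on `L²`. -/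
noncomputable def dilation (hε : 0 < ε) : L2 N →L[ℝ] L2 N :=
  LinearMap.mkContinuous
    { toFun := fun u => toL2 (fun y => u (ε • y))
      map_add' := fun u w => by
        rw [← toL2_add (memLp_comp_smul (Lp.memLp u) hε.ne') (memLp_comp_smul (Lp.memLp w) hε.ne')]
        exact toL2_congr ((quasiMeasurePreserving_dilation hε).ae_eq_comp (Lp.coeFn_add u w))
      map_smul' := fun c u => by
        rw [RingHom.id_apply, ← toL2_smul c (memLp_comp_smul (Lp.memLp u) hε.ne')]
        exact toL2_congr ((quasiMeasurePreserving_dilation hε).ae_eq_comp (Lp.coeFn_smul c u)) }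
    (Real.sqrt (1 / ε ^ N)) (fun u => by
      refine le_of_sq_le_sq ?_ (by positivity)
      have h := norm_sq_toL2 (memLp_comp_smul (Lp.memLp u) hε.ne')
      rw [integral_comp_dilation hε (fun x => ‖u x‖ ^ 2), ← norm_sq_L2] at h
      rw [mul_pow, Real.sq_sqrt (by positivity)]
      exact h.le)

theorem dilation_apply (hε : 0 < ε) (u : L2 N) : dilation hε u = toL2 (fun y => u (ε • y)) := rfl

theorem coeFn_dilation (hε : 0 < ε) (u : L2 N) :
    dilation hε u =ᵐ[volume] fun y => u (ε • y) :=
  coeFn_toL2 (memLp_comp_smul (Lp.memLp u) hε.ne')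

theorem norm_sq_dilation (hε : 0 < ε) (u : L2 N) : ‖dilation hε u‖ ^ 2 = 1 / ε ^ N * ‖u‖ ^ 2 := by
  have h := norm_sq_toL2 (memLp_comp_smul (Lp.memLp u) hε.ne')
  rwa [integral_comp_dilation hε (fun x => ‖u x‖ ^ 2), ← norm_sq_L2, smul_eq_mul] at h

/-- The operator that forgets the gradient and rescales the space variable by `ε`. -/
noncomputable def scaled (hε : 0 < ε) : H1 N →L[ℝ] L2 N :=
  (dilation hε).comp ((ContinuousLinearMap.fst ℝ _ _).comp (H1 N).subtypeL)

theorem scaled_apply (hε : 0 < ε) (u : H1 N) : scaled hε u = dilation hε u.1.1 := rfl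

theorem h1Norm_eq (u : H1 N) :
    h1Norm ε u = Real.sqrt (1 / ε ^ N * (ε ^ 2 * (∑ i, ‖u.1.2 i‖ ^ 2) + ‖u.1.1‖ ^ 2)) := by
  have hi : ∀ w : L2 N, Integrable (fun x => ‖w x‖ ^ 2) := fun w =>
    (Lp.memLp w).integrable_norm_pow (by norm_num)
  rw [h1Norm, integral_const_mul, integral_add, integral_const_mul, integral_finsetSum,
    ← norm_sq_L2]
  · simp only [← norm_sq_L2]
  · exact fun i _ => hi _
  · exact (integrable_finsetSum _ fun i _ => hi _).const_mul _
  · exact hi _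

theorem h1Norm_nonneg (u : H1 N) : 0 ≤ h1Norm ε u := Real.sqrt_nonneg _

theorem h1Norm_zero : h1Norm ε (0 : H1 N) = 0 := by
  rw [h1Norm_eq]; simp

theorem h1Norm_smul (t : ℝ) (u : H1 N) : h1Norm ε (t • u) = |t| * h1Norm ε u := by
  rw [h1Norm_eq, h1Norm_eq, ← Real.sqrt_sq_eq_abs, ← Real.sqrt_mul (sq_nonneg t)]
  congr 1
  have h1 : ‖(t • u).1.1‖ ^ 2 = t ^ 2 * ‖u.1.1‖ ^ 2 := by
    change ‖t • u.1.1‖ ^ 2 = _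
    rw [norm_smul, mul_pow, Real.norm_eq_abs, sq_abs]
  have h2 : ∀ i, ‖(t • u).1.2 i‖ ^ 2 = t ^ 2 * ‖u.1.2 i‖ ^ 2 := fun i => by
    change ‖t • u.1.2 i‖ ^ 2 = _
    rw [norm_smul, mul_pow, Real.norm_eq_abs, sq_abs]
  simp only [h1, h2, ← Finset.mul_sum]
  ring

theorem norm_scaled_le (hε : 0 < ε) (u : H1 N) : ‖scaled hε u‖ ≤ h1Norm ε u := by
  rw [h1Norm_eq]
  refine Real.le_sqrt_of_sq_le ?_
  rw [scaled_apply, norm_sq_dilation]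
  have h : 0 ≤ ε ^ 2 * ∑ i, ‖u.1.2 i‖ ^ 2 := by positivity
  gcongr
  linarith

/-- The constant depends on ε; it serves only to compare topologies when proving that the
neighbourhood is connected. -/
theorem exists_norm_le_h1Norm (hε : 0 < ε) : ∃ A, 0 < A ∧ ∀ u : H1 N, ‖u‖ ≤ A * h1Norm ε u := by
  refine ⟨Real.sqrt (ε ^ N) * (1 + ε⁻¹), by positivity, fun u => ?_⟩
  have hs : 0 ≤ ∑ i, ‖u.1.2 i‖ ^ 2 := by positivity
  have h0 : Real.sqrt (ε ^ N) * h1Norm ε u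
      = Real.sqrt (ε ^ 2 * (∑ i, ‖u.1.2 i‖ ^ 2) + ‖u.1.1‖ ^ 2) := by
    rw [h1Norm_eq, ← Real.sqrt_mul (by positivity)]
    congr 1
    field_simp
  have h1 : ‖u.1.1‖ ≤ Real.sqrt (ε ^ N) * h1Norm ε u := by
    rw [h0]
    refine Real.le_sqrt_of_sq_le ?_
    nlinarith [sq_nonneg ε]
  have h2 : ∀ i, ‖u.1.2 i‖ ≤ ε⁻¹ * (Real.sqrt (ε ^ N) * h1Norm ε u) := fun i => by
    rw [h0, inv_mul_eq_div, le_div_iff₀ hε]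
    refine Real.le_sqrt_of_sq_le ?_
    have : ‖u.1.2 i‖ ^ 2 ≤ ∑ i, ‖u.1.2 i‖ ^ 2 :=
      Finset.single_le_sum (f := fun i => ‖u.1.2 i‖ ^ 2) (fun _ _ => sq_nonneg _)
        (Finset.mem_univ i)
    nlinarith [sq_nonneg ε, sq_nonneg ‖u.1.1‖]
  have hh : 0 ≤ Real.sqrt (ε ^ N) * h1Norm ε u := mul_nonneg (Real.sqrt_nonneg _) (h1Norm_nonneg u)
  have he : 0 < ε⁻¹ := inv_pos.2 hε
  have e : Real.sqrt (ε ^ N) * (1 + ε⁻¹) * h1Norm ε u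
      = Real.sqrt (ε ^ N) * h1Norm ε u + ε⁻¹ * (Real.sqrt (ε ^ N) * h1Norm ε u) := by ring
  have h3 : 0 ≤ ε⁻¹ * (Real.sqrt (ε ^ N) * h1Norm ε u) := by positivity
  rw [e]
  change max ‖u.1.1‖ ‖u.1.2‖ ≤ _
  refine max_le (by linarith) ?_
  refine (pi_norm_le_iff_of_nonneg (by linarith)).2 fun i => ?_
  linarith [h2 i]

end Dilation

/-! ### Translation between ε-dependent solitons and rescaled ones -/

section Bridge

variable {N k : ℕ} {p lam ε : ℝ} {Q : E N → ℝ}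

/-- The soliton parameters that correspond to rescaled parameters. -/
noncomputable def toParam (ε : ℝ) (σ : LParam N) : Param N :=
  ⟨ε • σ.1, σ.2.1, (σ.2.2.1 : Real.Angle), Real.exp σ.2.2.2, Real.exp_pos _⟩

/-- Rescaled parameters of a soliton, with phase near `θ₀`. -/
noncomputable def lift (ε θ₀ : ℝ) (P : Param N) : LParam N :=
  (ε⁻¹ • P.a, P.v, θ₀ + (P.γ - (θ₀ : Real.Angle)).toReal, Real.log P.μ)

theorem Param.ext' {P P' : Param N} (ha : P.a = P'.a) (hv : P.v = P'.v) (hγ : P.γ = P'.γ)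
    (hμ : P.μ = P'.μ) : P = P' := by
  cases P; cases P'; simp_all

theorem Param.coords_injective : Function.Injective (Param.coords (N := N)) := by
  intro P P' h
  simp only [Param.coords, Prod.mk.injEq] at h
  refine Param.ext' h.1 h.2.1 ?_ h.2.2.2
  have h1 := Real.Angle.arg_toCircle P.γ
  have h2 := Real.Angle.arg_toCircle P'.γ
  rw [h.2.2.1] at h1
  exact h1.symm.trans h2

theorem toParam_lift (hε : 0 < ε) (θ₀ : ℝ) (P : Param N) : toParam ε (lift ε θ₀ P) = P := by
  refine Param.ext' ?_ rfl ?_ ?_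
  · simp [toParam, lift, smul_smul, hε.ne']
  · simp [toParam, lift]
  · simp [toParam, lift, Real.exp_log P.μ_pos]

theorem toParam_add_turn (σ : LParam N) (n : ℤ) : toParam ε (σ + turn N n) = toParam ε σ := by
  refine Param.ext' ?_ ?_ ?_ ?_
  · simp [toParam, turn]
  · simp [toParam, turn]
  · simp only [toParam, turn, Prod.snd_add, Prod.fst_add]
    rw [Real.Angle.coe_add, add_eq_left, Real.Angle.coe_eq_zero_iff]
    exact ⟨n, by simp⟩
  · simp [toParam, turn]

/-- Both occurrences of ε cancel: (√μ/ε)·ε(y-b) = e^{s/2}(y-b), and v·(x-a)/(2ε) = ½ v·(y-b). -/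
theorem soliton_toParam (hε : 0 < ε) (σ : LParam N) (y : E N) :
    soliton p Q ε (ε • σ.1) σ.2.1 (σ.2.2.1 : Real.Angle) (Real.exp σ.2.2.2) (ε • y)
      = wave (1 / (p - 1)) Q (σ, y) := by
  have h1 : ε • y - ε • σ.1 = ε • (y - σ.1) := (smul_sub _ _ _).symm
  have h2 : profile p Q (Real.exp σ.2.2.2) ε (ε • y - ε • σ.1)
      = ampl (1 / (p - 1)) Q (σ, y) := by
    rw [profile, ampl, h1, smul_smul, div_mul_cancel₀ _ hε.ne', ← Real.exp_half, ← Real.exp_mul]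
    congr 2
    · ring
    · congr 2; ring
  have h3 : inner ℝ σ.2.1 (ε • y - ε • σ.1) / (2 * ε) = 1 / 2 * inner ℝ σ.2.1 (y - σ.1) := by
    rw [h1, inner_smul_right]
    field_simp
  rw [soliton, h2, h3, Real.Angle.toCircle_coe, Circle.coe_exp, ← Complex.exp_add, wave, phase,
    inner_smul_left, Complex.real_smul, mul_comm]
  congr 2
  simp
  ring

theorem soliton_eq_wave (hε : 0 < ε) (σ : LParam N) (x : E N) :
    soliton p Q ε (ε • σ.1) σ.2.1 (σ.2.2.1 : Real.Angle) (Real.exp σ.2.2.2) x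
      = wave (1 / (p - 1)) Q (σ, ε⁻¹ • x) := by
  rw [← soliton_toParam hε, smul_smul, mul_inv_cancel₀ hε.ne', one_smul]

/-- The derivative of the soliton in the direction `h` of rescaled parameters. -/
noncomputable def tangentMap (p : ℝ) (Q : E N → ℝ) (ε : ℝ) (σ : LParam N) :
    LParam N →ₗ[ℝ] (E N → ℂ) where
  toFun h x := fderiv ℝ (wave (1 / (p - 1)) Q) (σ, ε⁻¹ • x) (h, 0)
  map_add' h h' := by
    funext x
    rw [Pi.add_apply, ← map_add]; simp
  map_smul' c h := by
    funext x
    rw [Pi.smul_apply, RingHom.id_apply, ← map_smul]; simp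

theorem tangentMap_apply (σ h : LParam N) (x : E N) :
    tangentMap p Q ε σ h x = fderiv ℝ (wave (1 / (p - 1)) Q) (σ, ε⁻¹ • x) (h, 0) := rfl

theorem hasDerivAt_tangentMap (hQ : ContDiff ℝ 2 Q) (σ h : LParam N) (x : E N) :
    HasDerivAt (fun t : ℝ => wave (1 / (p - 1)) Q (σ + t • h, ε⁻¹ • x))
      (tangentMap p Q ε σ h x) 0 := by
  have h := hasDerivAt_line (contDiff_wave (α := 1 / (p - 1)) hQ) (σ, ε⁻¹ • x) (h, 0)
  refine h.congr_of_eventuallyEq (Filter.Eventually.of_forall fun t => ?_)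
  simp

theorem deriv_eq_tangentMap (hQ : ContDiff ℝ 2 Q) (hε : 0 < ε) (σ h : LParam N) (x : E N)
    {f : ℝ → ℂ} (hf : ∀ t : ℝ, f t = soliton p Q ε (ε • (σ + t • h).1) (σ + t • h).2.1
      ((σ + t • h).2.2.1 : Real.Angle) (Real.exp (σ + t • h).2.2.2) x) :
    deriv f 0 = tangentMap p Q ε σ h x := by
  refine ((hasDerivAt_tangentMap hQ σ h x).congr_of_eventuallyEq
    (Filter.Eventually.of_forall fun t => ?_)).deriv
  simp only [hf, soliton_eq_wave hε]

theorem tangentMap_translation (hQ : ContDiff ℝ 2 Q) (hε : 0 < ε) (σ : LParam N) (i : Fin N)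
    (x : E N) :
    (ε : ℂ) * deriv (fun t : ℝ => soliton p Q ε (ε • σ.1 + t • basisVec i) σ.2.1
      (σ.2.2.1 : Real.Angle) (Real.exp σ.2.2.2) x) 0
      = tangentMap p Q ε σ (basisVec i, 0, 0, 0) x := by
  rw [deriv_eq_tangentMap hQ hε σ (ε⁻¹ • (basisVec i, 0, 0, 0)) x fun t => ?_, map_smul,
    Pi.smul_apply, Complex.real_smul, ← mul_assoc, ← Complex.ofReal_mul,
    mul_inv_cancel₀ hε.ne', Complex.ofReal_one, one_mul]
  simp [smul_comm t ε⁻¹, smul_inv_smul₀ hε.ne']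

theorem tangentMap_boost (hQ : ContDiff ℝ 2 Q) (hε : 0 < ε) (σ : LParam N) (i : Fin N) (x : E N) :
    2 * deriv (fun t : ℝ => soliton p Q ε (ε • σ.1) (σ.2.1 + t • basisVec i)
      (σ.2.2.1 : Real.Angle) (Real.exp σ.2.2.2) x) 0
      = tangentMap p Q ε σ ((2 : ℝ) • (0, basisVec i, 0, 0)) x := by
  rw [deriv_eq_tangentMap hQ hε σ (0, basisVec i, 0, 0) x fun t => ?_, map_smul,
    Pi.smul_apply, Complex.real_smul, Complex.ofReal_ofNat]
  simp

theorem tangentMap_phase (hQ : ContDiff ℝ 2 Q) (hε : 0 < ε) (σ : LParam N) (x : E N) :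
    deriv (fun t : ℝ => soliton p Q ε (ε • σ.1) σ.2.1
      ((σ.2.2.1 : Real.Angle) + (t : Real.Angle)) (Real.exp σ.2.2.2) x) 0
      = tangentMap p Q ε σ (0, 0, 1, 0) x := by
  rw [deriv_eq_tangentMap hQ hε σ (0, 0, 1, 0) x fun t => ?_]
  simp

theorem tangentMap_scale (hQ : ContDiff ℝ 2 Q) (hε : 0 < ε) (σ : LParam N) (x : E N) :
    deriv (fun t : ℝ => soliton p Q ε (ε • σ.1) σ.2.1
      (σ.2.2.1 : Real.Angle) t x) (Real.exp σ.2.2.2)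
      = tangentMap p Q ε σ ((Real.exp σ.2.2.2)⁻¹ • (0, 0, 0, 1)) x := by
  have hl : HasDerivAt (fun t : ℝ => Real.log t - σ.2.2.2) (Real.exp σ.2.2.2)⁻¹
      (Real.exp σ.2.2.2) := (Real.hasDerivAt_log (Real.exp_pos _).ne').sub_const _
  have hl0 : Real.log (Real.exp σ.2.2.2) - σ.2.2.2 = 0 := by simp
  have h1 := HasDerivAt.scomp_of_eq (Real.exp σ.2.2.2)
    (hasDerivAt_tangentMap (p := p) (ε := ε) hQ σ (0, 0, 0, 1) x) hl hl0.symm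
  rw [map_smul, Pi.smul_apply]
  refine (h1.congr_of_eventuallyEq ?_).deriv
  filter_upwards [lt_mem_nhds (Real.exp_pos σ.2.2.2)] with t ht
  rw [Function.comp_apply, ← soliton_eq_wave hε]
  simp [Real.exp_log ht]

theorem sum_smul_basisVec (b : E N) : ∑ i, b i • basisVec i = b := by
  ext j
  simp [basisVec, Pi.single_apply]

/-- By the chain rule the generators are ∂_b, 2∂_v, ∂_θ and e^{-s}∂_s in rescaled coordinates; the
nonzero factors do not affect the span. -/
theorem tangentSpace_toParam (hQ : ContDiff ℝ 2 Q) (hε : 0 < ε) (σ : LParam N) :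
    tangentSpace p Q ε (toParam ε σ).a (toParam ε σ).v (toParam ε σ).γ (toParam ε σ).μ
      = LinearMap.range (tangentMap p Q ε σ) := by
  simp only [tangentSpace, toParam, tangentMap_translation hQ hε, tangentMap_boost hQ hε,
    tangentMap_phase hQ hε, tangentMap_scale hQ hε]
  refine le_antisymm (Submodule.span_le.2 ?_) ?_
  · rintro _ (((⟨i, rfl⟩ | ⟨i, rfl⟩) | rfl) | rfl) <;> exact ⟨_, rfl⟩
  · rintro _ ⟨h, rfl⟩
    have e : h = (∑ i, h.1 i • ((basisVec i, 0, 0, 0) : LParam N))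
        + (∑ i, (h.2.1 i / 2) • (2 : ℝ) • ((0, basisVec i, 0, 0) : LParam N))
        + h.2.2.1 • (0, 0, 1, 0)
        + (h.2.2.2 * Real.exp σ.2.2.2) • (Real.exp σ.2.2.2)⁻¹ • (0, 0, 0, 1) := by
      have e1 : ∑ i, h.1 i • ((basisVec i, 0, 0, 0) : LParam N) = (h.1, 0, 0, 0) := by
        conv_rhs => rw [← sum_smul_basisVec h.1]
        refine Prod.ext ?_ ?_ <;> simp [Prod.fst_sum, Prod.snd_sum]
      have e2 : ∑ i, (h.2.1 i / 2) • (2 : ℝ) • ((0, basisVec i, 0, 0) : LParam N)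
          = (0, h.2.1, 0, 0) := by
        conv_rhs => rw [← sum_smul_basisVec h.2.1]
        simp only [smul_smul, div_mul_cancel₀ _ (two_ne_zero' ℝ)]
        refine Prod.ext ?_ (Prod.ext ?_ ?_) <;> simp [Prod.fst_sum, Prod.snd_sum]
      rw [e1, e2, smul_smul, mul_assoc, mul_inv_cancel₀ (Real.exp_pos _).ne']
      simp
    have hs : ∀ (S : Submodule ℝ (E N → ℂ)) (c : ℝ) (g : LParam N),
        tangentMap p Q ε σ g ∈ S → tangentMap p Q ε σ (c • g) ∈ S := fun S c g hg => by
      rw [map_smul]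
      exact S.smul_mem c hg
    rw [e]
    simp only [map_add, map_sum]
    refine Submodule.add_mem _ (Submodule.add_mem _ (Submodule.add_mem _
      (Submodule.sum_mem _ fun i _ => ?_) (Submodule.sum_mem _ fun i _ => ?_)) ?_) ?_
    · refine hs _ _ _ (Submodule.subset_span ?_)
      exact Or.inl (Or.inl (Or.inl ⟨i, rfl⟩))
    · refine hs _ _ _ (Submodule.subset_span ?_)
      exact Or.inl (Or.inl (Or.inr ⟨i, rfl⟩))
    · refine hs _ _ _ (Submodule.subset_span ?_)
      exact Or.inl (Or.inr rfl)
    · refine hs _ _ _ (Submodule.subset_span ?_)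
      exact Or.inr rfl

theorem sympl_tangentMap (hQ : IsDecaying Q) (hε : 0 < ε) (u : H1 N) (σ h : LParam N) :
    sympl ε (toFn u) (tangentMap p Q ε σ h)
      = omega (scaled hε u) (fderiv ℝ (solMap (1 / (p - 1)) Q) σ h) := by
  rw [hQ.fderiv_solMap, omega_eq_integral, sympl, integral_const_mul]
  have h1 := integral_comp_dilation hε
    (fun x => toFn u x * (starRingEnd ℂ) (tangentMap p Q ε σ h x))
  rw [← Complex.real_smul, ← h1]
  congr 1
  refine integral_congr_ae ?_
  filter_upwards [coeFn_dilation hε u.1.1, coeFn_toL2 (hQ.memLp_fderiv_wave (1 / (p - 1)) σ (h, 0))]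
    with y h2 h3
  rw [h3, scaled_apply, h2, tangentMap_apply, inv_smul_smul₀ hε.ne']
  rfl

theorem scaled_multiSoliton (hp : 1 < p) (hQ : IsGroundState p lam 1 1 Q)
    (hε : 0 < ε) (σ : Fin k → LParam N) :
    scaled hε (multiSoliton hp hQ hε fun j => toParam ε (σ j)) = multiMap (1 / (p - 1)) Q σ := by
  rw [multiSoliton, map_sum, multiMap]
  refine Finset.sum_congr rfl fun l _ => ?_
  rw [scaled_apply, dilation_apply, solMap]
  refine toL2_congr ?_
  have h := (quasiMeasurePreserving_dilation (N := N) hε).ae_eq_comp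
    (soliton_mem hp hQ hε (toParam ε (σ l))).2.1.coeFn_toLp
  refine h.trans (Filter.Eventually.of_forall fun y => ?_)
  exact soliton_toParam hε (σ l) y

/-- The skew orthogonality conditions in rescaled form. -/
theorem orthogonal_iff (hp : 1 < p) (hQ : IsGroundState p lam 1 1 Q) (hQ' : IsDecaying Q)
    (hε : 0 < ε) (ψ : H1 N) (σ : Fin k → LParam N) :
    (∀ l, ∀ z ∈ tangentSpace p Q ε (toParam ε (σ l)).a (toParam ε (σ l)).v (toParam ε (σ l)).γ
      (toParam ε (σ l)).μ,
      sympl ε (toFn (ψ - multiSoliton hp hQ hε fun j => toParam ε (σ j))) z = 0)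
      ↔ orth (1 / (p - 1)) Q (scaled hε ψ, σ) = 0 := by
  simp only [tangentSpace_toParam hQ'.contDiff hε, LinearMap.mem_range, forall_exists_index,
    forall_apply_eq_imp_iff, sympl_tangentMap hQ' hε, map_sub (scaled hε), scaled_multiSoliton hp hQ hε]
  constructor
  · intro h
    funext l
    refine ContinuousLinearMap.ext fun g => ?_
    rw [orth_apply]
    exact h l g
  · intro h l g
    have := orth_apply (α := 1 / (p - 1)) (Q := Q) (scaled hε ψ, σ) l g
    rw [h] at this
    exact this.symm

/-- The mass is half the squared L² norm of the rescaled soliton, so ε drops out and the scaling law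
becomes a power of μ. -/
theorem mass_eq (hQ : IsDecaying Q) (hε : 0 < ε) {μ : ℝ} (hμ : 0 < μ) :
    mass p Q ε μ = 1 / 2 * (μ ^ (2 * (1 / (p - 1)) - (N : ℝ) / 2) * ∫ x, Q x ^ 2) := by
  have h1 := norm_sq_solMap (α := 1 / (p - 1)) hQ ((0, 0, 0, Real.log μ) : LParam N)
  rw [solMap, norm_sq_toL2 (hQ.memLp_wave _ _)] at h1
  rw [Real.rpow_def_of_pos hμ, mul_comm (Real.log μ), ← h1, mass, integral_const_mul,
    ← smul_eq_mul (1 / ε ^ N), ← integral_comp_dilation hε (fun x => |profile p Q μ ε x| ^ 2)]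
  congr 2
  funext y
  rw [← soliton_toParam hε, soliton]
  simp [Real.exp_log hμ]

theorem deriv_mass (hQ : IsDecaying Q) (hε : 0 < ε) {μ : ℝ} (hμ : 0 < μ) :
    deriv (mass p Q ε) μ = 1 / 2 * ((2 * (1 / (p - 1)) - (N : ℝ) / 2)
      * μ ^ (2 * (1 / (p - 1)) - (N : ℝ) / 2 - 1) * ∫ x, Q x ^ 2) := by
  have h := ((Real.hasDerivAt_rpow_const (p := 2 * (1 / (p - 1)) - (N : ℝ) / 2)
    (Or.inl hμ.ne')).mul_const (∫ x, Q x ^ 2)).const_mul (1 / 2)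
  refine (h.congr_of_eventuallyEq ?_).deriv
  filter_upwards [lt_mem_nhds hμ] with t ht
  exact mass_eq hQ hε ht

end Bridge

end NLSSoliton

namespace NLSSoliton

/-! ### Solving the orthogonality conditions modulo turns of the phases -/

section Modulation

variable {N k : ℕ} {α ρ : ℝ} {Q : E N → ℝ}

theorem fderiv_solMap_add_turn (σ : LParam N) (n : ℤ) :
    fderiv ℝ (solMap α Q) (σ + turn N n) = fderiv ℝ (solMap α Q) σ := by
  rw [← fderiv_comp_add_right]
  simp only [solMap_add_turn]

theorem multiMap_add_turn (σ : Fin k → LParam N) (n : Fin k → ℤ) :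
    multiMap α Q (fun l => σ l + turn N (n l)) = multiMap α Q σ := by
  simp only [multiMap, solMap_add_turn]

theorem orth_add_turn (ψ : L2 N) (σ : Fin k → LParam N) (n : Fin k → ℤ) :
    orth α Q (ψ, fun l => σ l + turn N (n l)) = orth α Q (ψ, σ) := by
  funext l
  refine ContinuousLinearMap.ext fun h => ?_
  rw [orth_apply, orth_apply, multiMap_add_turn, fderiv_solMap_add_turn]

theorem orth_multiMap (σ : Fin k → LParam N) : orth α Q (multiMap α Q σ, σ) = 0 := by
  funext l
  refine ContinuousLinearMap.ext fun h => ?_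
  rw [orth_apply, sub_self, map_zero]
  rfl

theorem convex_slab : Convex ℝ (slab N ρ) := by
  have h1 := (convex_closedBall (0 : E N) ρ).linear_preimage
    ((LinearMap.fst ℝ (E N) (ℝ × ℝ)).comp (LinearMap.snd ℝ (E N) (E N × ℝ × ℝ)))
  have h2 := (convex_closedBall (0 : ℝ) ρ).linear_preimage
    ((LinearMap.snd ℝ ℝ ℝ).comp ((LinearMap.snd ℝ (E N) (ℝ × ℝ)).comp
      (LinearMap.snd ℝ (E N) (E N × ℝ × ℝ))))
  have h := h1.inter h2
  have e : slab N ρ = (LinearMap.fst ℝ (E N) (ℝ × ℝ)).comp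
      (LinearMap.snd ℝ (E N) (E N × ℝ × ℝ)) ⁻¹' Metric.closedBall 0 ρ ∩
      (LinearMap.snd ℝ ℝ ℝ).comp ((LinearMap.snd ℝ (E N) (ℝ × ℝ)).comp
      (LinearMap.snd ℝ (E N) (E N × ℝ × ℝ))) ⁻¹' Metric.closedBall 0 ρ := by
    ext σ
    simp [slab]
  rw [e]
  exact h

/-- Tuples of parameters in a slab with positions within `X` of the points `b j`. -/
def modSet (b : Fin k → E N) (ρ X : ℝ) : Set (Fin k → LParam N) :=
  {σ | ∀ j, σ j ∈ slab N ρ ∧ ‖(σ j).1 - b j‖ ≤ X}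

theorem le_norm_sub_of_mem_modSet {b : Fin k → E N} {X R : ℝ}
    (hb : ∀ i j, i ≠ j → R + 2 * X ≤ ‖b i - b j‖) {σ σ' : Fin k → LParam N}
    (hσ : σ ∈ modSet b ρ X) (hσ' : σ' ∈ modSet b ρ X) {i j : Fin k} (hij : i ≠ j) :
    R ≤ ‖(σ i).1 - (σ' j).1‖ := by
  have h2 : b i - b j = ((σ i).1 - (σ' j).1) - ((σ i).1 - b i) + ((σ' j).1 - b j) := by abel
  have h3 := (norm_add_le (((σ i).1 - (σ' j).1) - ((σ i).1 - b i))
      ((σ' j).1 - b j)).trans (add_le_add_left (norm_sub_le _ _) _)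
  rw [← h2] at h3
  linarith [hb i j hij, (hσ i).2, (hσ' j).2]

/-- A set of parameters near which the orthogonality conditions determine the parameters up to
turns of the phases. -/
structure IsModulationSet (α : ℝ) (Q : E N → ℝ) (G : Set (Fin k → LParam N)) (r r₁ : ℝ) : Prop where
  pos : 0 < r
  pos' : 0 < r₁
  close : ∀ σ ∈ G, ∀ σ' ∈ G, ∀ ψ, ‖ψ - multiMap α Q σ‖ ≤ r → ‖ψ - multiMap α Q σ'‖ ≤ r →
    ∃ n : Fin k → ℤ, ‖(fun l => σ' l + turn N (n l)) - σ‖ ≤ r₁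
  unique : ∀ σ ∈ G, ∀ ψ, ‖ψ - multiMap α Q σ‖ ≤ r → ∀ τ ∈ Metric.closedBall σ r₁,
    ∀ τ' ∈ Metric.closedBall σ r₁, orth α Q (ψ, τ) = 0 → orth α Q (ψ, τ') = 0 → τ = τ'
  implicit : ∀ σ ∈ G, ∀ ψ, ‖ψ - multiMap α Q σ‖ ≤ r → orth α Q (ψ, σ) = 0 →
    ∃ τ : L2 N → Fin k → LParam N, ContDiffAt ℝ 1 τ ψ ∧ τ ψ = σ ∧
      ∀ᶠ ψ' in nhds ψ, orth α Q (ψ', τ ψ') = 0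
  base : ∀ σ ∈ G, ∀ σ' ∈ G, orth α Q (multiMap α Q σ, σ') = 0 →
    (∀ l, (σ l).2.2.2 ≤ (σ' l).2.2.2 + r) → ∃ n : Fin k → ℤ, (fun l => σ' l + turn N (n l)) = σ

variable (hQ : IsDecaying Q)
include hQ

/-- Orthogonality to this single direction is all that the comparison in
`IsDecaying.norm_sub_sq_le_of_orth` uses. -/
theorem IsDecaying.fderiv_solMap_phase (σ : LParam N) :
    fderiv ℝ (solMap α Q) σ (0, 0, 1, 0) = Complex.I • solMap α Q σ := by
  rw [hQ.fderiv_solMap, solMap]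
  refine Lp.ext ?_
  filter_upwards [coeFn_toL2 (hQ.memLp_fderiv_wave α σ ((0, 0, 1, 0), 0)),
    Lp.coeFn_smul Complex.I (toL2 fun y => wave α Q (σ, y)), coeFn_toL2 (hQ.memLp_wave α σ)]
    with y h1 h2 h3
  rw [h1, h2, Pi.smul_apply, h3, fderiv_wave_apply hQ.contDiff, fderiv_ampl_gauge hQ.contDiff,
    fderiv_phase_gauge, wave]
  simp
  ring

theorem IsDecaying.exists_lipschitz (α : ℝ) (k : ℕ) (hρ : 0 ≤ ρ) : ∃ B, 0 < B ∧
    ∀ σ σ' : Fin k → LParam N, (∀ j, σ j ∈ slab N ρ) → (∀ j, σ' j ∈ slab N ρ) →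
      ‖multiMap α Q σ - multiMap α Q σ'‖ ≤ B * ‖σ - σ'‖ := by
  obtain ⟨B, hB, hb, -⟩ := hQ.exists_bounds α hρ
  refine ⟨k * B + 1, by positivity, fun σ σ' hσ hσ' => ?_⟩
  have h : ∀ j, ‖solMap α Q (σ j) - solMap α Q (σ' j)‖ ≤ B * ‖σ - σ'‖ := fun j => by
    refine ((convex_slab (N := N) (ρ := ρ)).norm_image_sub_le_of_norm_fderiv_le (𝕜 := ℝ)
      (fun τ _ => (hQ.contDiff_solMap α).differentiable (by simp) τ)
      (fun τ hτ => (hb τ hτ.1 hτ.2).2.1) (hσ' j) (hσ j)).trans ?_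
    have := norm_le_pi_norm (σ - σ') j
    rw [Pi.sub_apply] at this
    gcongr
  rw [multiMap, multiMap, ← Finset.sum_sub_distrib]
  refine (norm_sum_le_of_le _ fun j _ => h j).trans ?_
  simp only [Finset.sum_const, Finset.card_univ, Fintype.card_fin, nsmul_eq_mul]
  nlinarith [norm_nonneg (σ - σ')]

/-- A solution of the orthogonality conditions for an exact multi-soliton whose scales are not
smaller consists of solitons close to those of the multi-soliton. -/
theorem IsDecaying.norm_sub_sq_le_of_orth (hint : 0 < ∫ x, Q x ^ 2)
    (hα : (N : ℝ) / 2 < 2 * α) (k : ℕ) (hρ : 0 ≤ ρ) : ∃ B, 0 < B ∧ ∀ σ σ' : Fin k → LParam N,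
      (∀ j, σ j ∈ slab N ρ) → (∀ j, σ' j ∈ slab N ρ) →
      ∀ R, 0 ≤ R → Separated R σ' → (∀ i j, i ≠ j → R ≤ ‖(σ' i).1 - (σ j).1‖) →
      orth α Q (multiMap α Q σ, σ') = 0 →
      ∀ t, 0 ≤ t → t * B ≤ 1 → ∀ l, (σ l).2.2.2 ≤ (σ' l).2.2.2 + t →
      ‖solMap α Q (σ l) - solMap α Q (σ' l)‖ ^ 2 ≤ B * t + B * (1 + R)⁻¹ := by
  obtain ⟨B, hB, hb, hcross⟩ := hQ.exists_bounds α hρ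
  set g := 2 * α - N / 2 with hg
  have hg0 : 0 < g := by linarith
  refine ⟨2 * g * B ^ 2 + 4 * (k * B) + g, by positivity,
    fun σ σ' hσ hσ' R hR hs' hss horth t ht htB l hl => ?_⟩
  set u := solMap α Q (σ l)
  set w := solMap α Q (σ' l)
  -- Pairing with i w turns the imaginary part in the symplectic form into a real part.
  have h1 : (inner ℂ w (multiMap α Q σ - multiMap α Q σ')).re = 0 := by
    have h := orth_apply (α := α) (Q := Q) (multiMap α Q σ, σ') l (0, 0, 1, 0)
    rw [horth, hQ.fderiv_solMap_phase, omega_apply, inner_smul_left] at h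
    simpa using h.symm
  have h2 : (inner ℂ w (multiMap α Q σ - multiMap α Q σ')).re = (inner ℂ w (u - w)).re
      + ∑ j ∈ Finset.univ.erase l,
        (inner ℂ w (solMap α Q (σ j) - solMap α Q (σ' j))).re := by
    rw [multiMap, multiMap, ← Finset.sum_sub_distrib,
      ← Finset.add_sum_erase _ _ (Finset.mem_univ l), inner_add_right, inner_sum, Complex.add_re,
      Complex.re_sum]
  have hcr : ∀ a ∈ slab N ρ, ∀ b ∈ slab N ρ, R ≤ ‖a.1 - b.1‖ →
      |(inner ℂ (solMap α Q a) (solMap α Q b)).re| ≤ B * (1 + R)⁻¹ := by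
    intro a ha b hb' hab
    refine (Complex.abs_re_le_norm _).trans (((hcross a b ha.1 ha.2 hb'.1 hb'.2).1).trans ?_)
    have : (1 + ‖a.1 - b.1‖)⁻¹ ≤ (1 + R)⁻¹ := inv_anti₀ (by positivity) (by linarith)
    gcongr
  have h3 : |∑ j ∈ Finset.univ.erase l,
      (inner ℂ w (solMap α Q (σ j) - solMap α Q (σ' j))).re| ≤ k * (2 * (B * (1 + R)⁻¹)) := by
    refine (Finset.abs_sum_le_sum_abs _ _).trans ?_
    refine (Finset.sum_le_card_nsmul _ _ (2 * (B * (1 + R)⁻¹)) fun j hj => ?_).trans ?_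
    · have hjl := (Finset.ne_of_mem_erase hj).symm
      rw [inner_sub_right, Complex.sub_re]
      refine (abs_sub _ _).trans ?_
      linarith [hcr _ (hσ' l) _ (hσ j) (hss l j hjl), hcr _ (hσ' l) _ (hσ' j) (hs' l j hjl)]
    · rw [nsmul_eq_mul]
      refine mul_le_mul_of_nonneg_right ?_ (by positivity)
      have := Finset.card_le_card (Finset.erase_subset l Finset.univ)
      rw [Finset.card_univ, Fintype.card_fin] at this
      exact_mod_cast this
  have h4 : (inner ℂ w (u - w)).re = (inner ℂ u w).re - ‖w‖ ^ 2 := by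
    rw [inner_sub_right, Complex.sub_re, ← inner_conj_symm w u, Complex.conj_re,
      inner_self_eq_norm_sq_to_K]
    norm_cast
  have h5 := re_inner_self_sub u w
  -- The mass increases with s, so a one-sided bound on the scales suffices. Up to interactions
  -- Re⟨u, w⟩ = ‖w‖², hence ‖u - w‖² = ‖u‖² - ‖w‖².
  have h6 : ‖u‖ ^ 2 ≤ Real.exp (g * t) * ‖w‖ ^ 2 := by
    rw [norm_sq_solMap hQ, norm_sq_solMap hQ, ← mul_assoc, ← Real.exp_add]
    refine mul_le_mul_of_nonneg_right (Real.exp_le_exp.2 ?_) hint.le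
    rw [← mul_add]
    exact mul_le_mul_of_nonneg_left (by linarith) hg0.le
  have hgt : g * t ≤ 1 := by
    have : 0 ≤ t * (2 * g * B ^ 2 + 4 * (k * B)) := by positivity
    nlinarith
  have h7 : Real.exp (g * t) - 1 ≤ 2 * (g * t) := by
    have := Real.abs_exp_sub_one_le (x := g * t) (by rw [abs_of_nonneg (by positivity)]; exact hgt)
    rw [abs_of_nonneg (mul_nonneg hg0.le ht)] at this
    exact (le_abs_self _).trans this
  have h8 : ‖w‖ ^ 2 ≤ B ^ 2 :=
    pow_le_pow_left₀ (norm_nonneg _) (hb (σ' l) (hσ' l).1 (hσ' l).2).1 2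
  have h9 : (Real.exp (g * t) - 1) * ‖w‖ ^ 2 ≤ 2 * (g * t) * B ^ 2 := by
    refine mul_le_mul h7 h8 (sq_nonneg _) (by positivity)
  have h10 : 0 ≤ (1 + R)⁻¹ := by positivity
  have h11 := (abs_le.1 h3)
  have h12 : 0 ≤ 4 * (k * B) * t + g * t := by positivity
  have h13 : 0 ≤ (2 * g * B ^ 2 + g) * (1 + R)⁻¹ := by positivity
  nlinarith [h11.1, h11.2]

/-- Solution of the orthogonality conditions near well separated solitons. -/
theorem IsDecaying.exists_modulation (heven : ∀ x, Q (-x) = Q x) (hint : 0 < ∫ x, Q x ^ 2)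
    (hα0 : 0 < α) (hα : (N : ℝ) / 2 < 2 * α) (hpos : ∀ x, 0 < Q x)
    (hmax : ∀ x, x ≠ 0 → Q x < Q 0) (k : ℕ) (hρ : 0 ≤ ρ) :
    ∃ r r₁ R C, 0 < r ∧ 0 < R ∧ 0 < C ∧ ∀ (b : Fin k → E N) (X : ℝ),
      (∀ i j, i ≠ j → R + 2 * X ≤ ‖b i - b j‖) → IsModulationSet α Q (modSet b ρ X) r r₁ ∧
      ∀ σ ∈ modSet b ρ X, ∀ ψ, ‖ψ - multiMap α Q σ‖ ≤ r →
        ∃ σ', ‖σ' - σ‖ ≤ C * ‖ψ - multiMap α Q σ‖ ∧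
          ‖ψ - multiMap α Q σ'‖ ≤ C * ‖ψ - multiMap α Q σ‖ ∧ orth α Q (ψ, σ') = 0 := by
  obtain ⟨r₀, hr₀, hr₁, R₀, hR₀, C₀, hC₀, hloc⟩ := hQ.exists_local_solution heven hint hα k hρ
  obtain ⟨rc, hrc, hclose⟩ := hQ.exists_close hint hα0 hα hpos hmax hρ hr₀
  obtain ⟨B₁, hB₁, hsep⟩ := hQ.norm_sub_sq_le_of_separated α k hρ
  obtain ⟨B₂, hB₂, hbase⟩ := hQ.norm_sub_sq_le_of_orth hint hα k hρ
  obtain ⟨B₃, hB₃, hlip⟩ := hQ.exists_lipschitz α k (ρ := ρ + 1) (by linarith)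
  -- Here and in the choice of R below, each term of the two comparison estimates is kept within
  -- rc/4, so the total stays under the threshold rc of `exists_close`.
  obtain ⟨r, hr, h1, h2, h3, h4, h5⟩ : ∃ r, 0 < r ∧ r ≤ r₀ ∧ C₀ * r ≤ r₀ ∧ B₁ * (2 * r) ≤ rc / 4 ∧
      B₂ * r ≤ rc / 4 ∧ r * B₂ ≤ 1 := by
    refine ⟨min (min r₀ (r₀ / C₀)) (min (rc / (8 * B₁)) (min (rc / (4 * B₂)) (1 / B₂))),
      by positivity, ?_, ?_, ?_, ?_, ?_⟩
    · exact (min_le_left _ _).trans (min_le_left _ _)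
    · rw [mul_comm, ← le_div_iff₀ hC₀]
      exact (min_le_left _ _).trans (min_le_right _ _)
    · have := (min_le_right (min r₀ (r₀ / C₀)) (min (rc / (8 * B₁)) (min (rc / (4 * B₂))
        (1 / B₂)))).trans (min_le_left _ _)
      rw [le_div_iff₀ (by positivity)] at this
      linarith
    · have := (min_le_right (min r₀ (r₀ / C₀)) (min (rc / (8 * B₁)) (min (rc / (4 * B₂))
        (1 / B₂)))).trans ((min_le_right _ _).trans (min_le_left _ _))
      rw [le_div_iff₀ (by positivity)] at this
      linarith
    · rw [← le_div_iff₀ hB₂]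
      exact (min_le_right _ _).trans ((min_le_right _ _).trans (min_le_right _ _))
  refine ⟨r, r₀, R₀ + 4 * B₁ / rc + 4 * B₂ / rc, C₀ + 1 + B₃ * C₀, hr, by positivity, by positivity,
    fun b X hb => ?_⟩
  set R := R₀ + 4 * B₁ / rc + 4 * B₂ / rc with hR
  have hR0 : 0 ≤ R := by positivity
  have hinv : ∀ B, 0 < B → 4 * B / rc ≤ R → B * (1 + R)⁻¹ < rc / 4 := by
    intro B hB h
    rw [div_le_iff₀ hrc] at h
    rw [← div_eq_mul_inv, div_lt_iff₀ (by positivity)]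
    nlinarith
  have hi1 := hinv B₁ hB₁ (by have : 0 < 4 * B₂ / rc := by positivity
                              linarith)
  have hi2 := hinv B₂ hB₂ (by have : 0 < 4 * B₁ / rc := by positivity
                              linarith)
  have hsl : ∀ σ ∈ modSet b ρ X, ∀ j, σ j ∈ slab N ρ := fun σ hσ j => (hσ j).1
  have hsR : ∀ σ ∈ modSet b ρ X, Separated R σ := fun σ hσ i j hij =>
    le_norm_sub_of_mem_modSet hb hσ hσ hij
  have hs0 : ∀ σ ∈ modSet b ρ X, Separated R₀ σ := fun σ hσ i j hij => by
    have : 0 < 4 * B₁ / rc + 4 * B₂ / rc := by positivity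
    linarith [hsR σ hσ i j hij]
  have hturn : ∀ σ ∈ modSet b ρ X, ∀ σ' ∈ modSet b ρ X,
      (∀ l, ‖solMap α Q (σ l) - solMap α Q (σ' l)‖ ^ 2 < rc) →
      ∃ n : Fin k → ℤ, ‖(fun l => σ' l + turn N (n l)) - σ‖ ≤ r₀ := by
    intro σ hσ σ' hσ' hcl
    have : ∀ l, ∃ n : ℤ, ‖σ' l + turn N n - σ l‖ < r₀ := fun l =>
      hclose (σ l) (σ' l) (hσ l).1.1 (hσ l).1.2 (hσ' l).1.1 (hσ' l).1.2 (hcl l)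
    choose n hn using this
    exact ⟨n, (pi_norm_le_iff_of_nonneg hr₀.le).2 fun l => (hn l).le⟩
  have huniq : ∀ σ ∈ modSet b ρ X, ∀ ψ, ‖ψ - multiMap α Q σ‖ ≤ r →
      ∀ τ ∈ Metric.closedBall σ r₀, ∀ τ' ∈ Metric.closedBall σ r₀, orth α Q (ψ, τ) = 0 →
      orth α Q (ψ, τ') = 0 → τ = τ' := fun σ hσ ψ hψ =>
    (hloc σ (hsl σ hσ) (hs0 σ hσ) ψ (hψ.trans h1)).1
  refine ⟨⟨hr, hr₀, ?_, huniq, ?_, ?_⟩, ?_⟩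
  · intro σ hσ σ' hσ' ψ hψ hψ'
    refine hturn σ hσ σ' hσ' fun l => ?_
    refine (hsep σ σ' (hsl σ hσ) (hsl σ' hσ') R hR0 (hsR σ hσ) (hsR σ' hσ')
      (fun i j hij => le_norm_sub_of_mem_modSet hb hσ hσ' hij) l).trans_lt ?_
    have h6 : ‖multiMap α Q σ - multiMap α Q σ'‖ ≤ 2 * r := by
      have := norm_sub_le_norm_sub_add_norm_sub (multiMap α Q σ) ψ (multiMap α Q σ')
      rw [norm_sub_rev _ ψ] at this
      linarith
    have h7 := mul_le_mul_of_nonneg_left h6 hB₁.le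
    linarith
  · intro σ hσ ψ hψ
    exact (hloc σ (hsl σ hσ) (hs0 σ hσ) ψ (hψ.trans h1)).2.2
  · intro σ hσ σ' hσ' h' hs
    obtain ⟨n, hn⟩ := hturn σ hσ σ' hσ' fun l => by
      refine (hbase σ σ' (hsl σ hσ) (hsl σ' hσ') R hR0 (hsR σ' hσ')
        (fun i j hij => le_norm_sub_of_mem_modSet hb hσ' hσ hij) h' r hr.le h5 l (hs l)).trans_lt ?_
      linarith
    -- For the exact multi-soliton σ itself is a zero, so local uniqueness identifies the turned σ'
    -- with σ.
    refine ⟨n, huniq σ hσ _ (by simpa using hr.le) _ (mem_closedBall_iff_norm.2 hn) σ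
      (Metric.mem_closedBall_self hr₀.le) ?_ (orth_multiMap σ)⟩
    rwa [orth_add_turn]
  · intro σ hσ ψ hψ
    have hd := norm_nonneg (ψ - multiMap α Q σ)
    have hle : C₀ * ‖ψ - multiMap α Q σ‖ ≤ r₀ :=
      (mul_le_mul_of_nonneg_left hψ hC₀.le).trans h2
    obtain ⟨σ', hσ', h0⟩ := (hloc σ (hsl σ hσ) (hs0 σ hσ) ψ (hψ.trans h1)).2.1 hle
    rw [mem_closedBall_iff_norm] at hσ'
    have hBC : 0 < B₃ * C₀ := by positivity
    refine ⟨σ', hσ'.trans (by nlinarith), ?_, h0⟩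
    have hl := hlip σ σ' (fun j => slab_mono (by linarith) (hsl σ hσ j)) fun j =>
      slab_of_dist (hsl σ hσ j) ((norm_le_pi_norm (σ' - σ) j).trans (hσ'.trans (hle.trans hr₁)))
    rw [norm_sub_rev σ σ'] at hl
    have h6 : ‖ψ - multiMap α Q σ'‖ ≤ ‖ψ - multiMap α Q σ‖
        + ‖multiMap α Q σ - multiMap α Q σ'‖ := norm_sub_le_norm_sub_add_norm_sub _ _ _
    have h7 := mul_le_mul_of_nonneg_left hσ' hB₃.le
    nlinarith

end Modulation

end NLSSoliton

namespace NLSSoliton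

/-! ### Connectedness of the neighbourhood and local branches of the phase -/

section Neighbourhood

variable {N k : ℕ} {p lam ε : ℝ} {Q : E N → ℝ}

theorem LocDominated.comp_smul {P F : Type*} [NormedAddCommGroup P] [NormedAddCommGroup F]
    {f : P × E N → F} (h : LocDominated f) {s : ℝ} (hs : s ≠ 0) :
    LocDominated (fun z : P × E N => f (z.1, s • z.2)) := by
  intro σ₀
  obtain ⟨t, ht, b, hb, hfb⟩ := h σ₀
  exact ⟨t, ht, fun x => b (s • x), memLp_comp_smul hb hs, fun σ hσ x => hfb σ hσ (s • x)⟩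

theorem fderiv_soliton_toParam (hQ : ContDiff ℝ 2 Q) (hε : 0 < ε) (σ : LParam N) (x v : E N) :
    fderiv ℝ (soliton p Q ε (toParam ε σ).a (toParam ε σ).v (toParam ε σ).γ (toParam ε σ).μ) x v
      = fderiv ℝ (wave (1 / (p - 1)) Q) (σ, ε⁻¹ • x) (0, ε⁻¹ • v) := by
  have e : soliton p Q ε (toParam ε σ).a (toParam ε σ).v (toParam ε σ).γ (toParam ε σ).μ
      = fun x => wave (1 / (p - 1)) Q (σ, ε⁻¹ • x) := funext fun x => soliton_eq_wave hε σ x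
  have h1 : HasFDerivAt (wave (1 / (p - 1)) Q) (fderiv ℝ (wave (1 / (p - 1)) Q) (σ, ε⁻¹ • x))
      (σ, ε⁻¹ • x) := ((contDiff_wave hQ).differentiable (by simp) _).hasFDerivAt
  have h2 : HasFDerivAt (fun x : E N => (σ, ε⁻¹ • x))
      ((0 : E N →L[ℝ] LParam N).prod (ε⁻¹ • ContinuousLinearMap.id ℝ (E N))) x :=
    (hasFDerivAt_const σ x).prodMk ((ε⁻¹ • ContinuousLinearMap.id ℝ (E N)).hasFDerivAt)
  have h3 := (h1.comp x h2).fderiv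
  rw [Function.comp_def] at h3
  rw [e, h3]
  simp

theorem continuous_multiSoliton (hp : 1 < p) (hQ : IsGroundState p lam 1 1 Q) (hQ' : IsDecaying Q)
    (hε : 0 < ε) : Continuous fun σ : Fin k → LParam N =>
      multiSoliton hp hQ hε fun j => toParam ε (σ j) := by
  have hε' : ε⁻¹ ≠ 0 := inv_ne_zero hε.ne'
  have hc : Continuous fun σ : LParam N => toL2 fun x => wave (1 / (p - 1)) Q (σ, ε⁻¹ • x) :=
    ((hQ'.locDominated (1 / (p - 1))).comp_smul hε').continuous_toL2
      ((hQ'.continuous_wave _).comp (by fun_prop))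
  have hd : ∀ v : E N, Continuous fun σ : LParam N => toL2 fun x =>
      fderiv ℝ (wave (1 / (p - 1)) Q) (σ, ε⁻¹ • x) (0, ε⁻¹ • v) := fun v =>
    (((hQ'.locDominated_fderiv (1 / (p - 1))).clm_apply (0, ε⁻¹ • v)).comp_smul hε').continuous_toL2
      ((((hQ'.continuous_fderiv_wave _).clm_apply continuous_const)).comp (by fun_prop))
  unfold multiSoliton
  refine continuous_finsetSum _ fun l _ => ?_
  refine Continuous.comp (g := fun τ : LParam N => H1.ofC1 (soliton p Q ε (toParam ε τ).a
    (toParam ε τ).v (toParam ε τ).γ (toParam ε τ).μ)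
    (soliton_mem hp hQ hε (toParam ε τ)).1 (soliton_mem hp hQ hε (toParam ε τ)).2.1
    (soliton_mem hp hQ hε (toParam ε τ)).2.2) ?_ (continuous_apply l)
  refine continuous_induced_rng.2 (Continuous.prodMk ?_ (continuous_pi fun i => ?_))
  · refine hc.congr fun τ => ?_
    rw [← toL2_eq]
    congr 1
    funext x
    exact (soliton_eq_wave hε τ x).symm
  · refine (hd (basisVec i)).congr fun τ => ?_
    rw [← toL2_eq]
    congr 1
    funext x
    exact (fderiv_soliton_toParam hQ'.contDiff hε τ x _).symm

theorem convex_toParam_preimage (a₀ : E N) (R V : ℝ) {I : Set ℝ} (hI : I.OrdConnected) :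
    Convex ℝ {σ : LParam N | (toParam ε σ).a ∈ Metric.ball a₀ R ∧ (toParam ε σ).v ∈ Metric.ball 0 V
      ∧ (toParam ε σ).μ ∈ I} := by
  have h1 := (convex_ball a₀ R).linear_preimage (ε • LinearMap.fst ℝ (E N) (E N × ℝ × ℝ))
  have h2 := (convex_ball (0 : E N) V).linear_preimage
    ((LinearMap.fst ℝ (E N) (ℝ × ℝ)).comp (LinearMap.snd ℝ (E N) (E N × ℝ × ℝ)))
  have h3 := ((hI.preimage_mono Real.exp_monotone).convex (𝕜 := ℝ)).linear_preimage
    ((LinearMap.snd ℝ ℝ ℝ).comp ((LinearMap.snd ℝ (E N) (ℝ × ℝ)).comp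
        (LinearMap.snd ℝ (E N) (E N × ℝ × ℝ))))
  exact h1.inter (h2.inter h3)

theorem bddBelow_h1Norm {ι : Sort*} (f : ι → H1 N) : BddBelow (Set.range fun i => h1Norm ε (f i)) :=
  ⟨0, by rintro _ ⟨i, rfl⟩; exact h1Norm_nonneg _⟩

theorem mem_nbhd_of_le (hp : 1 < p) (hQ : IsGroundState p lam 1 1 Q) (hε : 0 < ε)
    {S : Set (Fin k → Param N)} {δ : ℝ} {σ : Fin k → Param N} (hσ : σ ∈ S) {ψ : H1 N}
    (h : h1Norm ε (ψ - multiSoliton hp hQ hε σ) ≤ δ) : ψ ∈ nbhd hp hQ hε S δ :=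
  ciInf_le_of_le (bddBelow_h1Norm fun σ : S => ψ - multiSoliton hp hQ hε σ.1) ⟨σ, hσ⟩ h

theorem exists_lt_of_mem_nbhd (hp : 1 < p) (hQ : IsGroundState p lam 1 1 Q) (hε : 0 < ε)
    {S : Set (Fin k → Param N)} (hS : S.Nonempty) {δ δ' : ℝ} (hδ : δ < δ') {ψ : H1 N}
    (h : ψ ∈ nbhd hp hQ hε S δ) : ∃ σ ∈ S, h1Norm ε (ψ - multiSoliton hp hQ hε σ) < δ' := by
  have : Nonempty S := hS.to_subtype
  obtain ⟨σ, hσ⟩ := exists_lt_of_ciInf_lt (lt_of_le_of_lt h hδ)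
  exact ⟨σ.1, σ.2, hσ⟩

/-- The neighbourhood lies between a connected set and its closure: the set of sums of
multi-solitons, parametrised by a convex set of lifted parameters, and errors from a closed δ-ball.
The closure is needed because the infimum defining the neighbourhood may not be attained. -/
theorem isPreconnected_nbhd (hp : 1 < p) (hQ : IsGroundState p lam 1 1 Q) (hQ' : IsDecaying Q)
    (hε : 0 < ε) {a₀ : Fin k → E N} {R V δ : ℝ} {I : Set ℝ} (hI : I.OrdConnected)
    (hS : (paramSet a₀ R V I).Nonempty) (hδ : 0 < δ) :
    IsPreconnected (nbhd hp hQ hε (paramSet a₀ R V I) δ) := by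
  set S := paramSet a₀ R V I with hSdef
  let Λ : Set (Fin k → LParam N) := {σ | (fun j => toParam ε (σ j)) ∈ S}
  let W : Set (H1 N) := {w | h1Norm ε w ≤ δ}
  have hΛ : IsPreconnected Λ := by
    have : Λ = Set.univ.pi fun j => {σ : LParam N | (toParam ε σ).a ∈ Metric.ball (a₀ j) R ∧
        (toParam ε σ).v ∈ Metric.ball 0 V ∧ (toParam ε σ).μ ∈ I} := by
      ext σ
      simp [Λ, hSdef, paramSet]
    rw [this]
    exact (convex_pi fun j _ => convex_toParam_preimage (a₀ j) R V hI).isPreconnected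
  have hW : IsPreconnected W := by
    have h0 : (0 : H1 N) ∈ W := by simpa [W, h1Norm_zero] using hδ.le
    -- Star-shapedness needs only the homogeneity of `h1Norm`.
    refine (StarConvex.isPathConnected (a := (0 : H1 N)) ?_ h0).isConnected.isPreconnected
    refine starConvex_zero_iff.2 fun w hw t ht ht1 => ?_
    change h1Norm ε (t • w) ≤ δ
    rw [h1Norm_smul, abs_of_nonneg ht]
    exact (mul_le_of_le_one_left (h1Norm_nonneg w) ht1).trans hw
  have him : IsPreconnected ((fun z : (Fin k → LParam N) × H1 N =>
      (multiSoliton hp hQ hε fun j => toParam ε (z.1 j)) + z.2) '' (Λ ×ˢ W)) :=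
    (hΛ.prod hW).image _ (((continuous_multiSoliton hp hQ hQ' hε).comp continuous_fst).add
      continuous_snd).continuousOn
  refine him.subset_closure ?_ ?_
  · rintro _ ⟨⟨σ, w⟩, ⟨hσ, hw⟩, rfl⟩
    refine mem_nbhd_of_le hp hQ hε hσ ?_
    rw [add_sub_cancel_left]
    exact hw
  · intro ψ hψ
    rw [Metric.mem_closure_iff]
    intro e he
    obtain ⟨A, hA, hle⟩ := exists_norm_le_h1Norm (N := N) hε
    -- With a multi-soliton at distance below δ + η, shrinking the error by δ/(δ+η) brings it into
    -- the δ-ball and moves ψ by at most ηA = e/2.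
    set η := e / (2 * A) with hη
    have hη0 : 0 < η := by positivity
    obtain ⟨σ, hσ, hlt⟩ := exists_lt_of_mem_nbhd hp hQ hε hS (by linarith : δ < δ + η) hψ
    set w := ψ - multiSoliton hp hQ hε σ with hw
    set t := δ / (δ + η) with ht
    have hlift : (fun j => toParam ε (lift ε 0 (σ j))) = σ :=
      funext fun j => toParam_lift hε 0 (σ j)
    refine ⟨_, ⟨(fun j => lift ε 0 (σ j), t • w), ⟨?_, ?_⟩, rfl⟩, ?_⟩
    · change (fun j => toParam ε (lift ε 0 (σ j))) ∈ S
      rwa [hlift]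
    · change h1Norm ε (t • w) ≤ δ
      rw [h1Norm_smul, abs_of_nonneg (by positivity), ht, div_mul_eq_mul_div,
        div_le_iff₀ (by positivity)]
      exact mul_le_mul_of_nonneg_left hlt.le hδ.le
    · simp only [hlift]
      have e1 : ψ - (multiSoliton hp hQ hε σ + t • w) = (1 - t) • w := by
        rw [hw]; module
      have e2 : 1 - t = η / (δ + η) := by rw [ht]; field_simp; ring
      rw [dist_eq_norm, e1, norm_smul, e2, Real.norm_of_nonneg (by positivity)]
      calc η / (δ + η) * ‖w‖ ≤ η / (δ + η) * (A * (δ + η)) := by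
            gcongr
            exact (hle w).trans (mul_le_mul_of_nonneg_left hlt.le hA.le)
        _ = e / 2 := by rw [hη]; field_simp
        _ < e := by linarith

/-- A local section of the map from parameters to coordinates. -/
noncomputable def liftCoords (ε θ₀ : ℝ) (c : E N × E N × ℂ × ℝ) : LParam N :=
  (ε⁻¹ • c.1, c.2.1, θ₀ + (c.2.2.1 * Complex.exp (-(θ₀ : ℂ) * Complex.I)).arg, Real.log c.2.2.2)

theorem toParam_liftCoords (hε : 0 < ε) (θ₀ : ℝ) (P : Param N) :
    toParam ε (liftCoords ε θ₀ P.coords) = P := by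
  have : liftCoords ε θ₀ P.coords = lift ε θ₀ P := by
    simp only [liftCoords, lift, Param.coords, Prod.mk.injEq, true_and, and_true]
    congr 1
    have h : ((P.γ - (θ₀ : Real.Angle)).toCircle : ℂ)
        = (P.γ.toCircle : ℂ) * Complex.exp (-(θ₀ : ℂ) * Complex.I) := by
      rw [sub_eq_add_neg, Real.Angle.toCircle_add, ← Real.Angle.coe_neg, Real.Angle.toCircle_coe,
        Circle.coe_mul, Circle.coe_exp]
      simp
    rw [← h, ← Complex.arg_coe_angle_toReal_eq_arg, Real.Angle.arg_toCircle]
  rw [this, toParam_lift hε]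

/-- Centring the branch at the phase of σ rotates the phase factor to 1, away from the cut of
`Complex.arg`. -/
theorem continuousAt_liftCoords (hε : 0 < ε) (σ : LParam N) :
    ContinuousAt (liftCoords ε σ.2.2.1) (toParam ε σ).coords ∧
      liftCoords ε σ.2.2.1 (toParam ε σ).coords = σ := by
  have h1 : ((toParam ε σ).coords.2.2.1 * Complex.exp (-(σ.2.2.1 : ℂ) * Complex.I)) = 1 := by
    simp [Param.coords, toParam, Real.Angle.toCircle_coe, Circle.coe_exp, ← Complex.exp_add]
  constructor
  · have h2 : ContinuousAt (fun c : E N × E N × ℂ × ℝ =>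
        (c.2.2.1 * Complex.exp (-(σ.2.2.1 : ℂ) * Complex.I)).arg) (toParam ε σ).coords := by
      refine ContinuousAt.comp_of_eq (g := Complex.arg) (y := 1) ?_ (by fun_prop) h1
      exact Complex.continuousAt_arg (by simp)
    have h3 : ContinuousAt (fun c : E N × E N × ℂ × ℝ => Real.log c.2.2.2)
        (toParam ε σ).coords := by
      refine ContinuousAt.log (by fun_prop) ?_
      exact (Real.exp_pos _).ne'
    unfold liftCoords
    exact ContinuousAt.prodMk (by fun_prop) (ContinuousAt.prodMk (by fun_prop)
      (ContinuousAt.prodMk (h2.const_add _) h3))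
  · rw [liftCoords, h1]
    refine Prod.ext ?_ (Prod.ext ?_ (Prod.ext ?_ ?_))
    · simp [Param.coords, toParam, smul_smul, hε.ne']
    · simp [Param.coords, toParam]
    · simp
    · simp [Param.coords, toParam]

theorem contDiff_coords_toParam :
    ContDiff ℝ 1 (fun σ : LParam N => (toParam ε σ).coords) := by
  have h : ContDiff ℝ 1 (fun σ : LParam N => Complex.exp ((σ.2.2.1 : ℂ) * Complex.I)) :=
    (contDiff_expI.of_le (by norm_num)).comp (by fun_prop : ContDiff ℝ 1 fun σ : LParam N => σ.2.2.1)
  have e : (fun σ : LParam N => (toParam ε σ).coords) = fun σ : LParam N =>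
      (ε • σ.1, σ.2.1, Complex.exp ((σ.2.2.1 : ℂ) * Complex.I), Real.exp σ.2.2.2) := by
    funext σ
    simp [Param.coords, toParam, Real.Angle.toCircle_coe, Circle.coe_exp]
  rw [e]
  exact ContDiff.prodMk (by fun_prop) (ContDiff.prodMk (by fun_prop)
    (ContDiff.prodMk h (by fun_prop)))

end Neighbourhood

end NLSSoliton

namespace NLSSoliton

/-! ### From pointwise zeros to a C¹ map, and uniqueness by connectedness -/

section Decomposition

variable {N k : ℕ} {p lam ε r r₁ : ℝ} {Q : E N → ℝ} {G : Set (Fin k → LParam N)} {U : Set (H1 N)}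
  {T : Set (Fin k → Param N)}

/-- Pointwise solutions of the orthogonality conditions form a `C¹` map. -/
theorem IsModulationSet.exists_skewDecomposition
    (hG : IsModulationSet (1 / (p - 1)) Q G r r₁)
    (hp : 1 < p) (hQ : IsGroundState p lam 1 1 Q) (hQ' : IsDecaying Q) (hε : 0 < ε)
    (h : ∀ ψ ∈ U, ∃ σ ∈ G, (fun j => toParam ε (σ j)) ∈ T ∧
      ‖scaled hε ψ - multiMap (1 / (p - 1)) Q σ‖ ≤ r / 2 ∧
      orth (1 / (p - 1)) Q (scaled hε ψ, σ) = 0) :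
    ∃ σ : H1 N → Fin k → LParam N, (∀ ψ ∈ U, σ ψ ∈ G ∧
      ‖scaled hε ψ - multiMap (1 / (p - 1)) Q (σ ψ)‖ ≤ r / 2) ∧
      IsSkewDecomposition hp hQ hε U T fun ψ j => toParam ε (σ ψ j) := by
  set α := 1 / (p - 1)
  -- An arbitrary choice without continuity. Residuals are at most r/2, which leaves room for ψ'
  -- near ψ to stay within r of the same multi-soliton.
  choose! σ hσG hσT hres horth using h
  have hr := hG.pos
  refine ⟨σ, fun ψ hψ => ⟨hσG ψ hψ, hres ψ hψ⟩, ⟨fun ψ hψ => ?_, hσT, fun ψ hψ =>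
    (orthogonal_iff hp hQ hQ' hε ψ (σ ψ)).2 (horth ψ hψ)⟩⟩
  obtain ⟨τ, hτ, hτ0, hτe⟩ := hG.implicit (σ ψ) (hσG ψ hψ) (scaled hε ψ)
    ((hres ψ hψ).trans (by linarith)) (horth ψ hψ)
  have hS : ContinuousAt (scaled (N := N) hε) ψ := (scaled hε).continuous.continuousAt
  have hc : ContDiffAt ℝ 1 (fun ψ' l => (toParam ε (τ (scaled hε ψ') l)).coords) ψ := by
    refine contDiffAt_pi.2 fun l => ?_
    refine contDiff_coords_toParam.contDiffAt.comp ψ ?_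
    exact (contDiff_apply ℝ (LParam N) l).contDiffAt.comp ψ
      (hτ.comp ψ (scaled hε).contDiff.contDiffAt)
  have e1 : ∀ᶠ ψ' in nhds ψ, orth α Q (scaled hε ψ', τ (scaled hε ψ')) = 0 :=
    hS.eventually hτe
  have e2 : ∀ᶠ ψ' in nhds ψ, τ (scaled hε ψ') ∈ Metric.closedBall (σ ψ) r₁ := by
    have : ContinuousAt (fun ψ' => τ (scaled hε ψ')) ψ :=
      ContinuousAt.comp (g := τ) hτ.continuousAt hS
    refine this.eventually (Metric.closedBall_mem_nhds_of_mem ?_)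
    change τ (scaled hε ψ) ∈ _
    rw [hτ0]
    exact Metric.mem_ball_self hG.pos'
  have e3 : ∀ᶠ ψ' in nhds ψ, ‖scaled hε ψ' - multiMap α Q (σ ψ)‖ ≤ r := by
    have : ContinuousAt (fun ψ' => ‖scaled hε ψ' - multiMap α Q (σ ψ)‖) ψ :=
      (hS.sub continuousAt_const).norm
    exact this.eventually (Iic_mem_nhds (lt_of_le_of_lt (hres ψ hψ) (by linarith)))
  -- By `close` the value chosen at ψ' is near σ ψ after turns, by `unique` it is then the implicit
  -- function, and turns are invisible in the coordinates.
  have key : ∀ᶠ ψ' in nhds ψ, ψ' ∈ U → (fun l => (toParam ε (σ ψ' l)).coords)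
      = fun l => (toParam ε (τ (scaled hε ψ') l)).coords := by
    filter_upwards [e1, e2, e3] with ψ' h1 h2 h3 hU
    obtain ⟨n, hn⟩ := hG.close (σ ψ) (hσG ψ hψ) (σ ψ') (hσG ψ' hU) (scaled hε ψ') h3
      ((hres ψ' hU).trans (by linarith))
    have := hG.unique (σ ψ) (hσG ψ hψ) (scaled hε ψ') h3 _ (mem_closedBall_iff_norm.2 hn) _ h2
      (by rw [orth_add_turn]; exact horth ψ' hU) h1
    rw [← this]
    simp only [toParam_add_turn]
  refine hc.contDiffWithinAt.congr_of_eventuallyEq_of_mem ?_ hψ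
  exact eventually_nhdsWithin_iff.2 key

/-- Two `C¹` decompositions that agree at one point agree. -/
theorem IsModulationSet.eqOn (hG : IsModulationSet (1 / (p - 1)) Q G r r₁)
    (hp : 1 < p) (hQ : IsGroundState p lam 1 1 Q) (hQ' : IsDecaying Q) (hε : 0 < ε)
    (hU : IsPreconnected U) {σ : H1 N → Fin k → LParam N}
    (hσ : ∀ ψ ∈ U, σ ψ ∈ G ∧ ‖scaled hε ψ - multiMap (1 / (p - 1)) Q (σ ψ)‖ ≤ r / 2)
    (hdec : IsSkewDecomposition hp hQ hε U T fun ψ j => toParam ε (σ ψ j))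
    {σ' : H1 N → Fin k → Param N} (hdec' : IsSkewDecomposition hp hQ hε U T σ')
    {ψ₀ : H1 N} (h₀ : ψ₀ ∈ U) (heq : σ' ψ₀ = fun j => toParam ε (σ ψ₀ j)) :
    Set.EqOn σ' (fun ψ j => toParam ε (σ ψ j)) U := by
  set α := 1 / (p - 1)
  have hr := hG.pos
  have hc := hdec.contDiffOn.continuousOn.domRestrict
  have hc' := hdec'.contDiffOn.continuousOn.domRestrict
  -- The coincidence set, taken in the subspace U because continuity is known only relative to U.
  let A : Set U := {ψ | ∀ l, (σ' ψ.1 l).coords = (toParam ε (σ ψ.1 l)).coords}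
  have hclosed : IsClosed A := by
    have : A = {ψ : U | (fun l => (σ' ψ.1 l).coords) = fun l => (toParam ε (σ ψ.1 l)).coords} := by
      ext ψ
      exact funext_iff.symm
    rw [this]
    exact isClosed_eq hc' hc
  have hopen : IsOpen A := by
    refine isOpen_iff_mem_nhds.2 fun ψ hψ => ?_
    -- One continuous branch of the phases around σ ψ lifts both maps into the same ball, where
    -- zeros are unique.
    let ℓ : (Fin k → E N × E N × ℂ × ℝ) → Fin k → LParam N :=
      fun c l => liftCoords ε (σ ψ.1 l).2.2.1 (c l)
    have hℓ : ContinuousAt ℓ fun l => (toParam ε (σ ψ.1 l)).coords :=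
      continuousAt_pi.2 fun l => ContinuousAt.comp (g := liftCoords ε (σ ψ.1 l).2.2.1)
        (f := fun c : Fin k → E N × E N × ℂ × ℝ => c l)
        (continuousAt_liftCoords hε (σ ψ.1 l)).1 (continuousAt_apply l _)
    have hℓ0 : ℓ (fun l => (toParam ε (σ ψ.1 l)).coords) = σ ψ.1 :=
      funext fun l => (continuousAt_liftCoords hε (σ ψ.1 l)).2
    have hball : Metric.closedBall (σ ψ.1) r₁ ∈ nhds (ℓ fun l => (toParam ε (σ ψ.1 l)).coords) := by
      rw [hℓ0]
      exact Metric.closedBall_mem_nhds _ hG.pos'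
    have hψ' : (fun l => (σ' ψ.1 l).coords) = fun l => (toParam ε (σ ψ.1 l)).coords := funext hψ
    have e1 : ∀ᶠ φ : U in nhds ψ, ℓ (fun l => (toParam ε (σ φ.1 l)).coords)
        ∈ Metric.closedBall (σ ψ.1) r₁ :=
      (ContinuousAt.comp (g := ℓ) hℓ (hc.continuousAt (x := ψ))).eventually hball
    have e2 : ∀ᶠ φ : U in nhds ψ, ℓ (fun l => (σ' φ.1 l).coords)
        ∈ Metric.closedBall (σ ψ.1) r₁ := by
      rw [← hψ'] at hℓ hball
      exact (ContinuousAt.comp (g := ℓ) hℓ (hc'.continuousAt (x := ψ))).eventually hball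
    have e3 : ∀ᶠ φ : U in nhds ψ, ‖scaled hε φ.1 - multiMap α Q (σ ψ.1)‖ ≤ r := by
      have hS : Continuous (fun φ : U => scaled (N := N) hε φ.1) :=
        (scaled hε).continuous.comp continuous_subtype_val
      have : Continuous (fun φ : U => ‖scaled hε φ.1 - multiMap α Q (σ ψ.1)‖) :=
        (hS.sub continuous_const).norm
      exact this.continuousAt.eventually
        (Iic_mem_nhds (lt_of_le_of_lt (hσ ψ.1 ψ.2).2 (by linarith)))
    filter_upwards [e1, e2, e3] with φ h1 h2 h3 l
    have t1 : ∀ j, toParam ε (ℓ (fun l => (toParam ε (σ φ.1 l)).coords) j)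
        = toParam ε (σ φ.1 j) := fun j => toParam_liftCoords hε _ _
    have t2 : ∀ j, toParam ε (ℓ (fun l => (σ' φ.1 l).coords) j) = σ' φ.1 j := fun j =>
      toParam_liftCoords hε _ _
    have o1 : orth α Q (scaled hε φ.1, ℓ fun l => (toParam ε (σ φ.1 l)).coords) = 0 := by
      refine (orthogonal_iff hp hQ hQ' hε φ.1 _).1 ?_
      simp only [t1]
      exact hdec.orthogonal φ.1 φ.2
    have o2 : orth α Q (scaled hε φ.1, ℓ fun l => (σ' φ.1 l).coords) = 0 := by
      refine (orthogonal_iff hp hQ hQ' hε φ.1 _).1 ?_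
      simp only [t2]
      exact hdec'.orthogonal φ.1 φ.2
    have := hG.unique (σ ψ.1) (hσ ψ.1 ψ.2).1 (scaled hε φ.1) h3 _ h2 _ h1 o2 o1
    rw [← t1, ← t2, this]
  have : PreconnectedSpace U := isPreconnected_iff_preconnectedSpace.1 hU
  have huniv : A = Set.univ := by
    refine IsClopen.eq_univ ⟨hclosed, hopen⟩ ⟨⟨ψ₀, h₀⟩, fun l => ?_⟩
    change (σ' ψ₀ l).coords = _
    rw [heq]
  intro ψ hψ
  have hA : (⟨ψ, hψ⟩ : U) ∈ A := huniv ▸ Set.mem_univ _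
  exact funext fun l => Param.coords_injective (hA l)

end Decomposition

end NLSSoliton

namespace NLSSoliton

/-! ### Bounds on the parameter domain and the constants -/

section Parameters

variable {N k : ℕ} {p lam ε : ℝ} {Q : E N → ℝ} {K L V d μinf μsup : ℝ} {I : Set ℝ}
  {a₀ : Fin k → E N} {σ σ' : Fin k → LParam N}

/-- The bounds on d keep a_j within 2L of its reference point, |v| below K + 1 and μ between μinf/2
and μsup + 1, so every enlarged domain lies in one slab that does not depend on I, ε or δ. -/
theorem mem_modSet_of_toParam_mem (hε : 0 < ε) (hε1 : ε ≤ 1) (hK : 0 < K) (hμinf : 0 < μinf)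
    (hI : I ⊆ Set.Ioo μinf μsup) (hdL : d ≤ L) (hd1 : d ≤ 1) (hdμ : d ≤ μinf / 2)
    (h : (fun j => toParam ε (σ j)) ∈ paramSet a₀ (L + d) (K * ε + d) (Metric.thickening d I)) :
    σ ∈ modSet (fun j => ε⁻¹ • a₀ j)
      (K + 1 + |Real.log (μinf / 2)| + |Real.log (μsup + 1)|) (2 * L / ε) := by
  intro j
  obtain ⟨ha, hv, hμ⟩ := h j
  rw [mem_ball_iff_norm] at ha
  rw [mem_ball_zero_iff] at hv
  obtain ⟨μ, hμI, hμd⟩ := Metric.mem_thickening_iff.1 hμ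
  rw [Real.dist_eq] at hμd
  have hμ' := hI hμI
  obtain ⟨hd2, hd3⟩ := abs_lt.1 hμd
  simp only [toParam] at ha hv hd2 hd3
  have h1 := abs_nonneg (Real.log (μinf / 2))
  have h2 := abs_nonneg (Real.log (μsup + 1))
  refine ⟨⟨?_, ?_⟩, ?_⟩
  · nlinarith
  · have l1 : Real.log (μinf / 2) ≤ (σ j).2.2.2 := by
      rw [Real.log_le_iff_le_exp (by linarith)]
      linarith [hμ'.1]
    have l2 : (σ j).2.2.2 ≤ Real.log (μsup + 1) := by
      rw [Real.le_log_iff_exp_le (by linarith [hμ'.1, hμ'.2])]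
      linarith [hμ'.2]
    exact abs_le.2 ⟨by linarith [neg_abs_le (Real.log (μinf / 2))],
      by linarith [le_abs_self (Real.log (μsup + 1))]⟩
  · have e : (σ j).1 - ε⁻¹ • a₀ j = ε⁻¹ • (ε • (σ j).1 - a₀ j) := by
      rw [smul_sub, inv_smul_smul₀ hε.ne']
    rw [e, norm_smul, norm_inv, Real.norm_of_nonneg hε.le, inv_mul_eq_div]
    gcongr
    linarith

/-- Positions move by at most εt ≤ t, and μ = e^s by at most 2 μsup t, from |e^x - 1| ≤ 2|x| for |x|
≤ 1. -/
theorem toParam_mem_of_norm_sub_le (hε : 0 < ε) (hε1 : ε ≤ 1) (hI : I ⊆ Set.Ioo μinf μsup)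
    (h : (fun j => toParam ε (σ j)) ∈ paramSet a₀ L V I) {t : ℝ} (ht1 : t ≤ 1)
    (hσ : ‖σ' - σ‖ ≤ t) (htd : t < d) (htd' : 2 * μsup * t < d) :
    (fun j => toParam ε (σ' j)) ∈ paramSet a₀ (L + d) (V + d) (Metric.thickening d I) := by
  intro j
  obtain ⟨ha, hv, hμ⟩ := h j
  rw [mem_ball_iff_norm] at ha
  rw [mem_ball_zero_iff] at hv
  simp only [toParam] at ha hv hμ ⊢
  have hj : ‖σ' j - σ j‖ ≤ t := (norm_le_pi_norm (σ' - σ) j).trans hσ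
  have h1 : ‖(σ' j).1 - (σ j).1‖ ≤ t := (norm_fst_le (σ' j - σ j)).trans hj
  have h2 : ‖(σ' j).2.1 - (σ j).2.1‖ ≤ t :=
    ((norm_fst_le (σ' j - σ j).2).trans (norm_snd_le (σ' j - σ j))).trans hj
  have h3 : |(σ' j).2.2.2 - (σ j).2.2.2| ≤ t :=
    (((norm_snd_le (σ' j - σ j).2.2).trans (norm_snd_le (σ' j - σ j).2)).trans
      (norm_snd_le (σ' j - σ j))).trans hj
  refine ⟨?_, ?_, ?_⟩
  · rw [mem_ball_iff_norm]
    have e : ε • (σ' j).1 - a₀ j = ε • ((σ' j).1 - (σ j).1) + (ε • (σ j).1 - a₀ j) := by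
      rw [smul_sub]; abel
    have h4 : ‖ε • ((σ' j).1 - (σ j).1)‖ ≤ t := by
      rw [norm_smul, Real.norm_of_nonneg hε.le]
      exact (mul_le_of_le_one_left (norm_nonneg _) hε1).trans h1
    rw [e]
    exact (norm_add_le _ _).trans_lt (by linarith)
  · rw [mem_ball_zero_iff]
    have h4 := norm_add_le ((σ' j).2.1 - (σ j).2.1) (σ j).2.1
    rw [sub_add_cancel] at h4
    linarith
  · refine Metric.mem_thickening_iff.2 ⟨_, hμ, ?_⟩
    rw [Real.dist_eq]
    have e : Real.exp (σ' j).2.2.2 - Real.exp (σ j).2.2.2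
        = Real.exp (σ j).2.2.2 * (Real.exp ((σ' j).2.2.2 - (σ j).2.2.2) - 1) := by
      rw [mul_sub, ← Real.exp_add]; ring_nf
    rw [e, abs_mul, abs_of_pos (Real.exp_pos _)]
    have h4 := Real.abs_exp_sub_one_le (h3.trans ht1)
    have h5 := (hI hμ).2
    calc _ ≤ μsup * (2 * t) := by
          refine mul_le_mul h5.le (h4.trans (by linarith)) (abs_nonneg _) ?_
          exact (Real.exp_pos _).le.trans h5.le
      _ < d := by linarith

/-- M is independent of ε and turns δ ≤ c inf m' into δ ≤ cM; nonnegativity makes the set of values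
bounded below, so that its infimum is a genuine one. -/
theorem exists_deriv_mass_bound (hQ : IsDecaying Q) (hint : 0 < ∫ x, Q x ^ 2)
    (hα : (N : ℝ) / 2 < 2 * (1 / (p - 1))) (hμinf : 0 < μinf) (hμ : μinf < μsup) :
    ∃ M, 0 < M ∧ ∀ ε, 0 < ε → ∀ μ ∈ Set.Ioo μinf μsup,
      0 ≤ deriv (mass p Q ε) μ ∧ deriv (mass p Q ε) μ ≤ M := by
  set β := 2 * (1 / (p - 1)) - (N : ℝ) / 2 with hβ
  have hβ0 : 0 < β := by linarith
  have hsup : 0 < μsup := hμinf.trans hμ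
  refine ⟨1 / 2 * (β * (μsup ^ β / μinf) * ∫ x, Q x ^ 2), by positivity, fun ε hε μ hm => ?_⟩
  have hμ0 : 0 < μ := hμinf.trans hm.1
  rw [deriv_mass hQ hε hμ0]
  constructor
  · have := Real.rpow_nonneg hμ0.le (β - 1)
    positivity
  · have : μ ^ (β - 1) ≤ μsup ^ β / μinf := by
      rw [Real.rpow_sub_one hμ0.ne']
      gcongr
      · exact hm.2.le
      · exact hm.1.le
    gcongr

/-- The thickening reaches at most Cδ below inf I and μ is at most δ above it, so e^s ≥ μ - (1+C)δ.
As e^s ≥ μinf/2, the factor e^r ≥ 1 + r makes up the loss. -/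
theorem log_le_add_of_mem_thickening {μ s r δ C : ℝ} (hr : 0 ≤ r) (hμ0 : 0 < μ)
    (hI : I ⊆ Set.Ioo μinf μsup) (hμ : μ < sInf I + δ) (hCμ : C * δ ≤ μinf / 2)
    (hC : 2 * (1 + C) * δ ≤ r * μinf) (hs : Real.exp s ∈ Metric.thickening (C * δ) I) :
    Real.log μ ≤ s + r := by
  obtain ⟨ν, hν, hd⟩ := Metric.mem_thickening_iff.1 hs
  rw [Real.dist_eq] at hd
  have h1 : sInf I ≤ ν := csInf_le ⟨μinf, fun x hx => (hI hx).1.le⟩ hν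
  have h2 := (hI hν).1
  have h3 := (abs_lt.1 hd).1
  rw [Real.log_le_iff_le_exp hμ0, Real.exp_add]
  have h4 := Real.add_one_le_exp r
  have h5 : μinf / 2 ≤ Real.exp s := by linarith
  nlinarith [Real.exp_pos s]

end Parameters

end NLSSoliton

/-! ### Choice of constants and conclusion -/

theorem proposition5p2 {N k : ℕ} (hN : 1 ≤ N) {p lam : ℝ} (hp : 1 < p)
    (hp' : p < 1 + 4 / (N : ℝ)) (hlam : 0 < lam)
    {Q : E N → ℝ} (hQ : IsGroundState p lam 1 1 Q)
    {K L μinf μsup : ℝ} (hK : 0 < K) (hL : 0 < L) (hμinf : 0 < μinf) (hμ : μinf < μsup) :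
    ∃ c > 0, ∃ C > 0, ∃ ε₀ > 0,
      ∀ I : Set ℝ, I.OrdConnected → I.Nonempty → I ⊆ Set.Ioo μinf μsup →
      ∀ a₀ : Fin k → E N, (∀ i j, i ≠ j → 6 * L < ‖a₀ i - a₀ j‖) →
      ∀ (ε : ℝ) (hε : 0 < ε), ε < ε₀ →
      ∀ δ : ℝ, 0 < δ → δ ≤ c * sInf (deriv (mass p Q ε) '' I) →
      ∃ σ : H1 N → Fin k → Param N,
        IsSkewDecomposition hp hQ hε (nbhd hp hQ hε (paramSet a₀ L (K * ε) I) δ)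
          (paramSet a₀ (L + C * δ) (K * ε + C * δ) (Metric.thickening (C * δ) I)) σ ∧
        ∀ σ' : H1 N → Fin k → Param N,
          IsSkewDecomposition hp hQ hε (nbhd hp hQ hε (paramSet a₀ L (K * ε) I) δ)
            (paramSet a₀ (L + C * δ) (K * ε + C * δ) (Metric.thickening (C * δ) I)) σ' →
          Set.EqOn σ' σ (nbhd hp hQ hε (paramSet a₀ L (K * ε) I) δ) := by
  have hQ' : IsDecaying Q := hQ.isDecaying hN hp hlam
  have hp1 : 0 < p - 1 := by linarith
  have hα0 : 0 < 1 / (p - 1) := by positivity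
  have hα : (N : ℝ) / 2 < 2 * (1 / (p - 1)) := by
    have hN0 : (0 : ℝ) < N := by exact_mod_cast hN
    have h1 : (p - 1) * N < 4 := (lt_div_iff₀ hN0).1 (by linarith)
    rw [mul_one_div, div_lt_div_iff₀ two_pos hp1]
    linarith
  have hint : 0 < ∫ x, Q x ^ 2 := by
    refine (integral_pos_iff_support_of_nonneg (fun x => sq_nonneg _) hQ.memLp.integrable_sq).2 ?_
    have : Function.support (fun x => Q x ^ 2) = Set.univ :=
      Set.eq_univ_of_forall fun x => (pow_pos (hQ.pos x) 2).ne'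
    rw [this]
    exact Measure.measure_univ_pos.2 (NeZero.ne _)
  have heven : ∀ x, Q (-x) = Q x := fun x => hQ.radial _ _ (norm_neg x)
  have hmax : ∀ x, x ≠ 0 → Q x < Q 0 := fun x hx =>
    hQ.decreasing 0 x (by simpa using norm_pos_iff.2 hx)
  have hsup : 0 < μsup := hμinf.trans hμ
  obtain ⟨r, r₁, R, C₁, hr, hR, hC₁, hmod⟩ := hQ'.exists_modulation heven hint hα0 hα hQ.pos hmax k
    (ρ := K + 1 + |Real.log (μinf / 2)| + |Real.log (μsup + 1)|) (by positivity)
  obtain ⟨M, hM, hmass⟩ := exists_deriv_mass_bound hQ' hint hα hμinf hμ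
  -- Solving moves the parameters by at most 2C₁δ, hence μ by at most 4C₁ μsup δ; both must stay
  -- strictly below Cδ.
  set C := 2 * C₁ + 4 * C₁ * μsup + 1 with hC
  have hC0 : 0 < C := by positivity
  -- The bounds L, 1 and μinf/2 control the enlarged domain, r the local solver, and r μinf the
  -- comparison of scales at the base point.
  set m := min (min L 1) (min (μinf / 2) (min r (r * μinf))) with hm
  have hm0 : 0 < m := by positivity
  have hm1 : m ≤ L := (min_le_left _ _).trans (min_le_left _ _)
  have hm2 : m ≤ 1 := (min_le_left _ _).trans (min_le_right _ _)
  have hm3 : m ≤ μinf / 2 := (min_le_right _ _).trans (min_le_left _ _)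
  have hm4 : m ≤ r := (min_le_right _ _).trans ((min_le_right _ _).trans (min_le_left _ _))
  have hm5 : m ≤ r * μinf := (min_le_right _ _).trans ((min_le_right _ _).trans (min_le_right _ _))
  -- The denominator dominates every multiple of δ required below. Centres 6L apart, each free in a
  -- ball of radius 2L, stay 2L apart, which after rescaling is 2L/ε ≥ R.
  refine ⟨m / (3 * C + 4 + 4 * C₁) / M, by positivity, C, hC0, min 1 (2 * L / R), by positivity, ?_⟩
  intro I hI hIne hIμ a₀ ha₀ ε hε hε₀ δ hδ hδc
  have hε1 : ε ≤ 1 := (hε₀.le).trans (min_le_left _ _)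
  have hεR : R * ε ≤ 2 * L := by
    have := (hε₀.le).trans (min_le_right _ _)
    rwa [le_div_iff₀ hR, mul_comm] at this
  have hδm : (3 * C + 4 + 4 * C₁) * δ ≤ m := by
    obtain ⟨μ₀, hμ₀⟩ := hIne
    have h1 : sInf (deriv (mass p Q ε) '' I) ≤ M := by
      refine (csInf_le ⟨0, ?_⟩ (Set.mem_image_of_mem _ hμ₀)).trans (hmass ε hε μ₀ (hIμ hμ₀)).2
      rintro _ ⟨μ, hμI, rfl⟩
      exact (hmass ε hε μ (hIμ hμI)).1
    have h2 : δ ≤ m / (3 * C + 4 + 4 * C₁) := by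
      refine hδc.trans ((mul_le_mul_of_nonneg_left h1 (by positivity)).trans (le_of_eq ?_))
      field_simp
    rwa [le_div_iff₀ (by positivity), mul_comm] at h2
  have hCδ0 : 0 < C * δ := by positivity
  have hC₁δ : 0 < C₁ * δ := by positivity
  have hCδ : C * δ ≤ m := by linarith
  obtain ⟨hG, hsolve⟩ := hmod (fun j => ε⁻¹ • a₀ j) (2 * L / ε) fun i j hij => by
    rw [← smul_sub, norm_smul, norm_inv, Real.norm_of_nonneg hε.le, inv_mul_eq_div,
      le_div_iff₀ hε, add_mul, mul_assoc, div_mul_cancel₀ _ hε.ne']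
    linarith [ha₀ i j hij]
  have hlift : ∀ P : Fin k → Param N, (fun j => toParam ε (lift ε 0 (P j))) = P := fun P =>
    funext fun j => toParam_lift hε 0 (P j)
  have hT : ∀ τ : Fin k → LParam N, (fun j => toParam ε (τ j)) ∈
      paramSet a₀ (L + C * δ) (K * ε + C * δ) (Metric.thickening (C * δ) I) → τ ∈ modSet _ _ _ :=
    fun τ hτ => mem_modSet_of_toParam_mem hε hε1 hK hμinf hIμ (hCδ.trans hm1) (hCδ.trans hm2)
      (hCδ.trans hm3) hτ
  have hST : ∀ τ : Fin k → LParam N, (fun j => toParam ε (τ j)) ∈ paramSet a₀ L (K * ε) I →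
      (fun j => toParam ε (τ j)) ∈
      paramSet a₀ (L + C * δ) (K * ε + C * δ) (Metric.thickening (C * δ) I) := fun τ hτ =>
    toParam_mem_of_norm_sub_le hε hε1 hIμ hτ zero_le_one (by simp) hCδ0 (by simpa using hCδ0)
  -- The base point takes μ within δ of inf I, so that no admissible competitor has much smaller
  -- scales.
  obtain ⟨μ₀, hμ₀I, hμ₀⟩ := Real.lt_sInf_add_pos hIne hδ
  have hμ₀0 : 0 < μ₀ := hμinf.trans (hIμ hμ₀I).1
  set P₀ : Fin k → Param N := fun j => ⟨a₀ j, 0, 0, μ₀, hμ₀0⟩ with hP₀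
  have hP₀S : P₀ ∈ paramSet a₀ L (K * ε) I := fun j =>
    ⟨Metric.mem_ball_self hL, Metric.mem_ball_self (by positivity), hμ₀I⟩
  obtain ⟨σ, hσ, hdec⟩ := hG.exists_skewDecomposition (U := nbhd hp hQ hε
      (paramSet a₀ L (K * ε) I) δ) (T := paramSet a₀ (L + C * δ) (K * ε + C * δ)
      (Metric.thickening (C * δ) I)) hp hQ hQ' hε fun ψ hψ => by
    -- The infimum may not be attained, so 2δ replaces δ.
    obtain ⟨P, hP, hlt⟩ := exists_lt_of_mem_nbhd hp hQ hε ⟨P₀, hP₀S⟩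
      (by linarith : δ < 2 * δ) hψ
    rw [← hlift P] at hP hlt
    have hres := norm_scaled_le hε
      (ψ - multiSoliton hp hQ hε fun j => toParam ε (lift ε 0 (P j)))
    rw [map_sub, scaled_multiSoliton] at hres
    have hres2 := hres.trans hlt.le
    obtain ⟨τ, h1, h2, h3⟩ := hsolve _ (hT _ (hST _ hP)) (scaled hε ψ) (hres2.trans (by linarith))
    have h4 := mul_le_mul_of_nonneg_left hres2 hC₁.le
    have hτT := toParam_mem_of_norm_sub_le (d := C * δ) hε hε1 hIμ hP (t := C₁ * (2 * δ))
      (by linarith) (h1.trans h4) (by rw [hC]; nlinarith [mul_pos hC₁δ hsup])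
      (by rw [hC]; nlinarith [mul_pos hC₁δ hsup])
    exact ⟨τ, hT τ hτT, hτT, h2.trans (h4.trans (by linarith)), h3⟩
  have hψ₀ : multiSoliton hp hQ hε P₀ ∈ nbhd hp hQ hε (paramSet a₀ L (K * ε) I) δ :=
    mem_nbhd_of_le hp hQ hε hP₀S (by rw [sub_self, h1Norm_zero]; exact hδ.le)
  have hbase : ∀ σ' : H1 N → Fin k → Param N,
      IsSkewDecomposition hp hQ hε (nbhd hp hQ hε (paramSet a₀ L (K * ε) I) δ)
        (paramSet a₀ (L + C * δ) (K * ε + C * δ) (Metric.thickening (C * δ) I)) σ' →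
      σ' (multiSoliton hp hQ hε P₀) = P₀ := by
    intro σ' hσ'
    set P := σ' (multiSoliton hp hQ hε P₀) with hP
    have hPT := hσ'.mapsTo hψ₀
    rw [← hP, ← hlift P] at hPT
    have horth := hσ'.orthogonal _ hψ₀
    rw [← hP, ← hlift P] at horth
    have horth' := (orthogonal_iff hp hQ hQ' hε _ fun j => lift ε 0 (P j)).1 horth
    rw [← hlift P₀, scaled_multiSoliton] at horth'
    rw [← hlift P₀] at hP₀S
    obtain ⟨n, hn⟩ := hG.base _ (hT _ (hST _ hP₀S)) _ (hT _ hPT) horth' fun l =>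
      log_le_add_of_mem_thickening hr.le hμ₀0 hIμ hμ₀ (hCδ.trans hm3)
        (by linarith) (hPT l).2.2
    rw [← hlift P₀, ← hlift P]
    funext l
    rw [← congrFun hn l, toParam_add_turn]
  refine ⟨fun ψ j => toParam ε (σ ψ j), hdec, fun σ' hσ' => ?_⟩
  refine hG.eqOn hp hQ hQ' hε (isPreconnected_nbhd hp hQ hQ' hε hI ⟨P₀, hP₀S⟩ hδ) hσ hdec hσ' hψ₀ ?_
  rw [hbase σ' hσ']
  exact (hbase _ hdec).symm
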